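/- Let $\Gamma$ be a countably infinite connected graph with symmetric edge weights $\mu_{x,y}=\mu_{y,x}>0$ for $x\sim y$ (and $\mu_{x,y}=0$ otherwise) such that $\mu(x)=\sum_{y\sim x}\mu_{x,y}<\infty$ for every $x$. Let $P(x,y)=\mu_{x,y}/\mu(x)$ be the transition probabilities of the associated random walk $(X_n)$, $Pf(x)=\sum_y P(x,y)f(y)$ and $\Delta=P-I$. Let $d$ be the graph distance, $B(x,R)=\{y:d(x,y)<R\}$, $V(x,R)=\sum_{y\in B(x,R)}\mu(y)$, and let $E(x,R)=\mathbb{E}_x\big[\min\{k: X_k\notin B(x,R)\}\big]$ be the mean exit time of the ball. For $0<r<R$ let $$\rho(x,r,R)=\Big(\inf\Big\{\sum_y (-\Delta f)(y)\,f(y)\,\mu(y): f \text{ finitely supported},\ f=1 \text{ on } B(x,r),\ f=0 \text{ on } \Gamma\setminus B(x,R)\Big\}\Big)^{-1}.$$ Consider the following conditions. * $(p_0)$: there is $p_0>0$ with $\mu_{x,y}/\mu(x)\ge p_0$ for all $x\sim y$. * $(H)$ (elliptic Harnack inequality): there is $H>1$ such that for all $x\in\Gamma$, $R>0$, and every function $u$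 which is non-negative on $B(x,2R)$ and its neighbours and satisfies $Pu=u$ on $B(x,2R)$, one has $\max_{B(x,R)}u\le H\min_{B(x,R)}u$. * $(BC)$ (bounded covering): there is an integer $K$ such that for all $x\in\Gamma$, $R>0$ the ball $B(x,2R)$ can be covered by at most $K$ balls of radius $R$. * $(R_2)$ for a constant $C_2>1$: $\rho(x,R,4R)\le C_2\,\rho(x,2R,4R)$ for all $x\in\Gamma$, $R>0$. * $(R_1)$ for a constant $C_1>1$: $\rho(x,R,4R)\le C_1\,\rho(x,R,2R)$ for all $x\in\Gamma$, $R>0$. Assume $(p_0)$ and $(H)$. Then: 1. There are constants $C>0$ and $C_2>1$ such that $(R_2)$ holds with $C_2$ and, with $\gamma_2=\log_2(C_2-1)$, $$V(x,R)\le C\,E(x,R)\,\mu(x)\,R^{\gamma_2}\qquad\text{for all }x\in\Gamma,\ R\ge 1.$$ 2. For every $C_2>1$ for which $(R_2)$ holds there is $C>0$ such that, with $\gamma_2=\log_2(C_2-1)$, $V(x,R)\le C\,E(x,2R)\,\mu(x)\,R^{\gamma_2}$ for all $x\in\Gamma$, $R\ge 1$. 3. There is $c>0$ such that $cR^2\le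 E(x,R)<\infty$ for all $x\in\Gamma$, $R>0$. 4. If in addition $(BC)$ holds, then there is a constant $C_1>1$ for which $(R_1)$ holds, and for every $C_1>1$ for which $(R_1)$ holds there is $c>0$ such that, with $\gamma_1=\log_2(C_1-1)$, $$V(x,2R)\ge c\,\mu(x)\,R^{2-\gamma_1}\qquad\text{for all }x\in\Gamma,\ R\ge 1.$$ -/

import Mathlib

open MeasureTheory ProbabilityTheory
open scoped ENNReal

/-- A connected weighted graph: a symmetric weight function which is positive exactly on the
edges and has finite total weight at every vertex. -/
structure WeightedGraph (Γ : Type*) where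
  graph : SimpleGraph Γ
  connected : graph.Connected
  weight : Γ → Γ → ℝ
  weight_symm : ∀ x y, weight x y = weight y x
  weight_pos : ∀ x y, graph.Adj x y → 0 < weight x y
  weight_eq_zero : ∀ x y, ¬ graph.Adj x y → weight x y = 0
  summable_weight : ∀ x, Summable (weight x)

namespace WeightedGraph

variable {Γ : Type*}

/-! ### The weighted graph: measure, transition probabilities, balls -/

/-- `μ(x)`, the sum of the weights of the edges at `x`. -/
noncomputable def mu (G : WeightedGraph Γ) (x : Γ) : ℝ := ∑' y, G.weight x y

/-- The transition probabilities `P(x,y) = μ_{x,y} / μ(x)`. -/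
noncomputable def P (G : WeightedGraph Γ) (x y : Γ) : ℝ := G.weight x y / G.mu x

/-- The open ball `B(x,R)` of the shortest path metric. -/
def ball (G : WeightedGraph Γ) (x : Γ) (R : ℝ) : Set Γ := {y | (G.graph.dist x y : ℝ) < R}

/-- `V(x,R) = μ(B(x,R))`. -/
noncomputable def vol (G : WeightedGraph Γ) (x : Γ) (R : ℝ) : ℝ≥0∞ :=
  ∑' y : G.ball x R, ENNReal.ofReal (G.mu y)

/-- The condition `(p₀)`: controlled weights. -/
def ControlledWeights (G : WeightedGraph Γ) : Prop :=
  ∃ p₀ : ℝ, 0 < p₀ ∧ ∀ x y, G.graph.Adj x y → p₀ ≤ G.weight x y / G.mu x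

/-- The bounded covering condition `(BC)`. -/
def BoundedCovering (G : WeightedGraph Γ) : Prop :=
  ∃ K : ℕ, ∀ (x : Γ) (R : ℝ), 0 < R →
    ∃ s : Finset Γ, s.card ≤ K ∧ G.ball x (2 * R) ⊆ ⋃ y ∈ s, G.ball y R

/-! ### Markov operator, Laplacian, harmonic functions, Harnack inequality -/

/-- The Markov operator `P f(x) = ∑ P(x,y) f(y)`. -/
noncomputable def markovOp (G : WeightedGraph Γ) (f : Γ → ℝ) (x : Γ) : ℝ :=
  ∑' y, G.P x y * f y

/-- The Laplacian `Δ = P - I`. -/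
noncomputable def laplacian (G : WeightedGraph Γ) (f : Γ → ℝ) (x : Γ) : ℝ :=
  G.markovOp f x - f x

/-- `A` together with all neighbours of points of `A`. -/
def closedNhd (G : WeightedGraph Γ) (A : Set Γ) : Set Γ :=
  A ∪ {y | ∃ x ∈ A, G.graph.Adj x y}

/-- `u` is harmonic on `A`; only the values of `u` on `A` and its neighbours matter. -/
def HarmonicOn (G : WeightedGraph Γ) (u : Γ → ℝ) (A : Set Γ) : Prop :=
  ∀ x ∈ A, G.markovOp u x = u x

/-- The elliptic Harnack inequality `(H)`. -/
def EllipticHarnack (G : WeightedGraph Γ) : Prop :=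
  ∃ H : ℝ, 1 < H ∧ ∀ (x : Γ) (R : ℝ), 0 < R → ∀ u : Γ → ℝ,
    (∀ y ∈ G.closedNhd (G.ball x (2 * R)), 0 ≤ u y) → G.HarmonicOn u (G.ball x (2 * R)) →
      ∀ y ∈ G.ball x R, ∀ z ∈ G.ball x R, u y ≤ H * u z

/-! ### Resistance -/

/-- The inner product `(f,g)_μ`, used for finitely supported functions. -/
noncomputable def innerMu (G : WeightedGraph Γ) (f g : Γ → ℝ) : ℝ :=
  ∑' x, f x * g x * G.mu x

/-- The Dirichlet energy `(-Δ f, f)_μ`. -/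
noncomputable def energy (G : WeightedGraph Γ) (f : Γ → ℝ) : ℝ :=
  G.innerMu (fun x => -G.laplacian f x) f

/-- The resistance `ρ(A,B)`: the inverse of the infimum of the energies of the finitely supported
functions which are `1` on `A` and `0` on `B`. -/
noncomputable def resistance (G : WeightedGraph Γ) (A B : Set Γ) : ℝ≥0∞ :=
  (sInf ((fun f => ENNReal.ofReal (G.energy f)) ''
    {f : Γ → ℝ | f.support.Finite ∧ (∀ x ∈ A, f x = 1) ∧ ∀ x ∈ B, f x = 0}))⁻¹

/-- The resistance `ρ(x,r,R)` of an annulus. -/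
noncomputable def rho (G : WeightedGraph Γ) (x : Γ) (r R : ℝ) : ℝ≥0∞ :=
  G.resistance (G.ball x r) (G.ball x R)ᶜ

/-- `ρ(x,R,4R) ≤ C ρ(x,2R,4R)` for all `x` and `R > 0`. -/
def OuterResistanceBound (G : WeightedGraph Γ) (C : ℝ) : Prop :=
  ∀ (x : Γ) (R : ℝ), 0 < R →
    G.rho x R (4 * R) ≤ ENNReal.ofReal C * G.rho x (2 * R) (4 * R)

/-- `ρ(x,R,4R) ≤ C ρ(x,R,2R)` for all `x` and `R > 0`. -/
def InnerResistanceBound (G : WeightedGraph Γ) (C : ℝ) : Prop :=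
  ∀ (x : Γ) (R : ℝ), 0 < R →
    G.rho x R (4 * R) ≤ ENNReal.ofReal C * G.rho x R (2 * R)

/-! ### The random walk and its mean exit times -/

lemma weight_nonneg (G : WeightedGraph Γ) (x y : Γ) : 0 ≤ G.weight x y := by
  by_cases h : G.graph.Adj x y
  · exact (G.weight_pos x y h).le
  · exact (G.weight_eq_zero x y h).ge

lemma mu_pos [Nontrivial Γ] (G : WeightedGraph Γ) (x : Γ) : 0 < G.mu x := by
  obtain ⟨y, hy⟩ := G.connected.preconnected.exists_adj_of_nontrivial x
  exact (G.summable_weight x).tsum_pos (G.weight_nonneg x) y (G.weight_pos x y hy)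

lemma hasSum_P [Nontrivial Γ] (G : WeightedGraph Γ) (x : Γ) :
    HasSum (fun y => ENNReal.ofReal (G.P x y)) 1 := by
  have h : HasSum (G.P x) 1 := by
    have := (G.summable_weight x).hasSum.div_const (G.mu x)
    rwa [show (∑' y, G.weight x y) / G.mu x = 1 from div_self (G.mu_pos x).ne'] at this
  have h0 : ∀ y, 0 ≤ G.P x y := fun y => div_nonneg (G.weight_nonneg x y) (G.mu_pos x).le
  have h1 := ENNReal.ofReal_tsum_of_nonneg h0 h.summable
  rw [h.tsum_eq, ENNReal.ofReal_one] at h1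
  rw [h1]
  exact ENNReal.summable.hasSum

/-- The law `P(x,·)` of one step of the walk. -/
noncomputable def stepPMF [Nontrivial Γ] (G : WeightedGraph Γ) (x : Γ) : PMF Γ :=
  ⟨fun y => ENNReal.ofReal (G.P x y), G.hasSum_P x⟩

/-- The transition kernel of the walk. -/
noncomputable def stepKernel [Nontrivial Γ] [MeasurableSpace Γ] [DiscreteMeasurableSpace Γ]
    (G : WeightedGraph Γ) : Kernel Γ Γ where
  toFun x := (G.stepPMF x).toMeasure
  measurable' := Measurable.of_discrete

instance [Nontrivial Γ] [MeasurableSpace Γ] [DiscreteMeasurableSpace Γ] (G : WeightedGraph Γ) :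
    IsMarkovKernel G.stepKernel :=
  ⟨fun x => PMF.toMeasure.isProbabilityMeasure (G.stepPMF x)⟩

/-- The law of `X_{n+1}` given `X_0, …, X_n`: the step kernel at the current position `X_n`. -/
noncomputable def historyKernel [Nontrivial Γ] [MeasurableSpace Γ] [DiscreteMeasurableSpace Γ]
    (G : WeightedGraph Γ) (n : ℕ) : Kernel (Finset.Iic n → Γ) Γ :=
  G.stepKernel.comap (fun h => h ⟨n, Finset.mem_Iic.2 le_rfl⟩) (measurable_pi_apply _)

instance [Nontrivial Γ] [MeasurableSpace Γ] [DiscreteMeasurableSpace Γ] (G : WeightedGraph Γ)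
    (n : ℕ) : IsMarkovKernel (G.historyKernel n) := by
  unfold historyKernel
  infer_instance

/-- The law on path space of the random walk `X_0, X_1, …` started at `x`. -/
noncomputable def pathLaw [Nontrivial Γ] [MeasurableSpace Γ] [DiscreteMeasurableSpace Γ]
    (G : WeightedGraph Γ) (x : Γ) : Measure (ℕ → Γ) :=
  Kernel.traj (X := fun _ => Γ) G.historyKernel 0 (fun _ => x)

/-- The exit time `T_A = min {k : X_k ∉ A}` of a path (`∞` if the path stays in `A`). -/
noncomputable def exitTime (A : Set Γ) (X : ℕ → Γ) : ℝ≥0∞ :=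
  sInf ((fun k : ℕ => (k : ℝ≥0∞)) '' {k | X k ∉ A})

/-- The mean exit time `E_z(A)`. -/
noncomputable def meanExit [Nontrivial Γ] [MeasurableSpace Γ] [DiscreteMeasurableSpace Γ]
    (G : WeightedGraph Γ) (z : Γ) (A : Set Γ) : ℝ≥0∞ :=
  ∫⁻ X, exitTime A X ∂(G.pathLaw z)

/-- `E(x,R) = E_x(B(x,R))`. -/
noncomputable def exitE [Nontrivial Γ] [MeasurableSpace Γ] [DiscreteMeasurableSpace Γ]
    (G : WeightedGraph Γ) (x : Γ) (R : ℝ) : ℝ≥0∞ :=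
  G.meanExit x (G.ball x R)

end WeightedGraph

/-! Write E for the Dirichlet form and ρ = 1/cap for the resistances of annuli. Three quantities
attached to a ball are compared: the Green function g with pole at the centre, the capacities, and
the mean exit time. Since E(g,f) = f(x), pairing g with the solution of -Δe = 1 gives E(x,R) = Σ
g(y)μ(y) (`meanExit_eq`, `IsGreen.exitE_eq`). Truncating g shows that a lower bound of g on the
inner ball is at most ρ, and that its maximum on a sphere inside that ball is at least ρ
(`IsGreen.mul_cap_le_one`, `IsGreen.one_le_mul_cap`). Harnack chains and the symmetry of Green
functions make g comparable along spheres (`IsGreen.sphere_le`), so these bounds match up to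
constants. This gives (R₂) for some constant (`cap_outer_le`) and E(x,2R) ≥ cρ(x,R,2R)V(x,R)
(`le_exitE_double`).

The exponents log₂(C-1), instead of log₂ C, come from the series law ρ(R,2R) + ρ(2R,4R) ≤ ρ(R,4R).
On a graph it can fail, because edges leaving B(x,2R) may carry energy for both annuli. `cap_series`
proves it with the second term multiplied by exp(-KR^(-β)), using that the potential of the outer
annulus is polynomially close to 1 just outside B(x,2R). Together with (R₂) this yields ρ(R,2R) ≤
(C₂-1)exp(K'R^(-β))ρ(2R,4R). The errors are summable over dyadic scales (`dyadic_iteration`), so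
cap(x,R,2R) ≤ Cμ(x)R^γ₂, and part 2 follows. In the same way (R₁) gives cap(x,R,2R) ≥ cμ(x)R^(-γ₁),
and the linear cut-off bound R²cap(x,R,2R) ≤ V(x,2R) gives the lower volume bound.

Part 3 combines that cut-off bound, the exit time bound and (R₂) for the existing constant. In part
1 the ball may not be doubled, but C₂ may be chosen: g decays at most polynomially up to the
boundary (`IsGreen.boundary_ge`), and C₂ is taken so large that R^γ₂ absorbs this loss.

For (R₁) under (BC), the spheres of radii about R and 2R are covered by boundedly many small balls.
Each pair of balls is separated at the cost of a multiple of cap(x,R,4R), by transporting the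
capacitor through a distant vertex (`separate_transit`, `separate_pair`), and the separating
functions are glued by minima (`glue_min`). -/

namespace WeightedGraph

variable {Γ : Type*}

/-! ### Paths and balls -/

/-- Uniform lower bound `p` for the transition probabilities along edges. -/
def LowerWeights (G : WeightedGraph Γ) (p : ℝ) : Prop :=
  0 < p ∧ ∀ x y, G.graph.Adj x y → p * G.mu x ≤ G.weight x y

/-- Every vertex has finitely many neighbours. -/
def FiniteNbrs (G : WeightedGraph Γ) : Prop := ∀ x, {y | G.graph.Adj x y}.Finite

lemma ControlledWeights.exists_lowerWeights [Nontrivial Γ] {G : WeightedGraph Γ}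
    (h : G.ControlledWeights) : ∃ p, G.LowerWeights p := by
  obtain ⟨p, hp, h⟩ := h
  refine ⟨p, hp, fun x y hxy => ?_⟩
  exact (le_div_iff₀ (G.mu_pos x)).1 (h x y hxy)

lemma LowerWeights.finiteNbrs [Nontrivial Γ] {G : WeightedGraph Γ} {p : ℝ}
    (h : G.LowerWeights p) : G.FiniteNbrs := by
  intro x
  have hpos : 0 < p * G.mu x := mul_pos h.1 (G.mu_pos x)
  have h0 := (G.summable_weight x).tendsto_cofinite_zero
  have h1 := h0.eventually (gt_mem_nhds hpos)
  rw [Filter.eventually_cofinite] at h1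
  exact h1.subset fun y hy => not_lt.2 (h.2 x y hy)

lemma dist_tri (G : WeightedGraph Γ) (x y z : Γ) :
    G.graph.dist x z ≤ G.graph.dist x y + G.graph.dist y z := G.connected.dist_triangle

lemma dist_triR (G : WeightedGraph Γ) (x y z : Γ) :
    (G.graph.dist x z : ℝ) ≤ G.graph.dist x y + G.graph.dist y z := by
  exact_mod_cast G.dist_tri x y z

lemma dist_adj_le (G : WeightedGraph Γ) (x : Γ) {y z : Γ} (h : G.graph.Adj y z) :
    G.graph.dist x z ≤ G.graph.dist x y + 1 := by
  have := G.dist_tri x y z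
  rwa [SimpleGraph.dist_eq_one_iff_adj.2 h] at this

lemma dist_adj_leR (G : WeightedGraph Γ) (x : Γ) {y z : Γ} (h : G.graph.Adj y z) :
    (G.graph.dist x z : ℝ) ≤ G.graph.dist x y + 1 := by
  exact_mod_cast G.dist_adj_le x h

lemma mem_ball (G : WeightedGraph Γ) {x y : Γ} {R : ℝ} :
    y ∈ G.ball x R ↔ (G.graph.dist x y : ℝ) < R := Iff.rfl

lemma mem_ball_self (G : WeightedGraph Γ) (x : Γ) {R : ℝ} (hR : 0 < R) : x ∈ G.ball x R := by
  simpa [mem_ball] using hR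

lemma ball_subset_ball (G : WeightedGraph Γ) (x : Γ) {r R : ℝ} (h : r ≤ R) :
    G.ball x r ⊆ G.ball x R := fun _ hy => lt_of_lt_of_le hy h

lemma exists_geodesic (G : WeightedGraph Γ) (u v : Γ) :
    ∃ p : ℕ → Γ, p 0 = u ∧ p (G.graph.dist u v) = v ∧
      (∀ i, i < G.graph.dist u v → G.graph.Adj (p i) (p (i + 1))) ∧
      (∀ i, i ≤ G.graph.dist u v → G.graph.dist u (p i) = i) ∧
      ∀ i, i ≤ G.graph.dist u v → G.graph.dist (p i) v + i = G.graph.dist u v := by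
  obtain ⟨w, hw⟩ := G.connected.exists_walk_length_eq_dist u v
  have hadj : ∀ i, i < G.graph.dist u v → G.graph.Adj (w.getVert i) (w.getVert (i + 1)) :=
    fun i hi => w.adj_getVert_succ (hw ▸ hi)
  have h1 : ∀ i, i ≤ G.graph.dist u v → G.graph.dist u (w.getVert i) ≤ i := by
    intro i
    induction i with
    | zero => simp
    | succ i ih =>
      intro hi
      exact (G.dist_adj_le u (hadj i hi)).trans (Nat.add_le_add_right (ih (by omega)) 1)
  have h2 : ∀ j, j ≤ G.graph.dist u v →
      G.graph.dist (w.getVert (G.graph.dist u v - j)) v ≤ j := by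
    intro j
    induction j with
    | zero => intro _; simp [← hw]
    | succ j ih =>
      intro hj
      have h := hadj (G.graph.dist u v - (j + 1)) (by omega)
      rw [show G.graph.dist u v - (j + 1) + 1 = G.graph.dist u v - j by omega] at h
      have := G.dist_adj_le v h.symm
      have h3 := ih (by omega)
      rw [SimpleGraph.dist_comm, SimpleGraph.dist_comm (v := w.getVert (G.graph.dist u v - j))]
        at this
      omega
  refine ⟨w.getVert, w.getVert_zero, by rw [← hw]; simp, hadj, ?_, ?_⟩
  · intro i hi
    have a := h1 i hi
    have b := h2 (G.graph.dist u v - i) (by omega)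
    rw [show G.graph.dist u v - (G.graph.dist u v - i) = i by omega] at b
    have c := G.dist_tri u (w.getVert i) v
    omega
  · intro i hi
    have a := h1 i hi
    have b := h2 (G.graph.dist u v - i) (by omega)
    rw [show G.graph.dist u v - (G.graph.dist u v - i) = i by omega] at b
    have c := G.dist_tri u (w.getVert i) v
    omega

lemma FiniteNbrs.ball_finite {G : WeightedGraph Γ} (h : G.FiniteNbrs) (x : Γ) (R : ℝ) :
    (G.ball x R).Finite := by
  have key : ∀ n : ℕ, {y | G.graph.dist x y ≤ n}.Finite := by
    intro n
    induction n with
    | zero =>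
      refine (Set.finite_singleton x).subset fun y hy => ?_
      simp only [Set.mem_ofPred_eq, Nat.le_zero, G.connected.dist_eq_zero_iff] at hy
      exact hy.symm
    | succ n ih =>
      refine (ih.union (ih.biUnion fun y _ => h y)).subset fun y hy => ?_
      rcases Nat.lt_or_ge n (G.graph.dist x y) with h1 | h1
      · right
        have h2 : G.graph.dist x y = n + 1 := le_antisymm hy h1
        obtain ⟨p, hp0, hpn, hadj, hd, -⟩ := G.exists_geodesic x y
        rw [Set.mem_iUnion₂]
        refine ⟨p n, (hd n (by omega)).le, ?_⟩
        have h3 := hadj n (by omega)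
        rw [show n + 1 = G.graph.dist x y from h2.symm, hpn] at h3
        exact h3
      · exact Or.inl h1
  refine (key ⌈R⌉₊).subset fun y hy => ?_
  have : (G.graph.dist x y : ℝ) < ⌈R⌉₊ := lt_of_lt_of_le hy (Nat.le_ceil R)
  exact_mod_cast this.le

lemma FiniteNbrs.exists_dist_eq [Infinite Γ] {G : WeightedGraph Γ} (h : G.FiniteNbrs)
    (x : Γ) (n : ℕ) : ∃ y, G.graph.dist x y = n := by
  obtain ⟨z, hz⟩ := (h.ball_finite x n).exists_notMem
  have hz : n ≤ G.graph.dist x z := by simpa [mem_ball] using hz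
  obtain ⟨p, -, -, -, hd, -⟩ := G.exists_geodesic x z
  exact ⟨p n, hd n hz⟩

lemma FiniteNbrs.closedNhd_finite {G : WeightedGraph Γ} (h : G.FiniteNbrs) {D : Set Γ}
    (hD : D.Finite) : (G.closedNhd D).Finite := by
  refine (hD.union (hD.biUnion fun y _ => h y)).subset fun y hy => ?_
  rcases hy with hy | ⟨x, hx, hy⟩
  · exact Or.inl hy
  · exact Or.inr (Set.mem_iUnion₂.2 ⟨x, hx, hy⟩)

lemma adj_mem_closedNhd (G : WeightedGraph Γ) {D : Set Γ} {a b : Γ} (ha : a ∈ D)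
    (h : G.graph.Adj a b) : b ∈ G.closedNhd D := Or.inr ⟨a, ha, h⟩

lemma subset_closedNhd (G : WeightedGraph Γ) (D : Set Γ) : D ⊆ G.closedNhd D :=
  fun _ => Or.inl

lemma mu_le_of_adj [Nontrivial Γ] {G : WeightedGraph Γ} {p : ℝ} (h : G.LowerWeights p)
    {x y : Γ} (hxy : G.graph.Adj x y) : p * G.mu x ≤ G.mu y := by
  refine (h.2 x y hxy).trans ?_
  rw [G.weight_symm]
  exact (G.summable_weight y).le_tsum x fun z _ => G.weight_nonneg y z

lemma LowerWeights.le_one [Nontrivial Γ] {G : WeightedGraph Γ} {p : ℝ} (h : G.LowerWeights p) :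
    p ≤ 1 := by
  obtain ⟨x, -⟩ := exists_pair_ne Γ
  obtain ⟨y, hy⟩ := G.connected.preconnected.exists_adj_of_nontrivial x
  have h1 := h.2 x y hy
  have h2 : G.weight x y ≤ G.mu x :=
    (G.summable_weight x).le_tsum y fun z _ => G.weight_nonneg x z
  have := G.mu_pos x
  nlinarith

/-! ### Finite sums for the Laplacian and the Dirichlet form -/

lemma weight_eq_zero_of_notMem (G : WeightedGraph Γ) {W : Finset Γ} {a b : Γ}
    (h : ∀ b, G.graph.Adj a b → b ∈ W) (hb : b ∉ W) : G.weight a b = 0 :=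
  G.weight_eq_zero a b fun hab => hb (h b hab)

lemma mu_eq_sum (G : WeightedGraph Γ) {W : Finset Γ} {a : Γ}
    (h : ∀ b, G.graph.Adj a b → b ∈ W) : G.mu a = ∑ b ∈ W, G.weight a b :=
  tsum_eq_sum fun _ hb => G.weight_eq_zero_of_notMem h hb

lemma markovOp_eq_sum (G : WeightedGraph Γ) {W : Finset Γ} {a : Γ}
    (h : ∀ b, G.graph.Adj a b → b ∈ W) (u : Γ → ℝ) :
    G.markovOp u a = ∑ b ∈ W, G.weight a b / G.mu a * u b :=
  tsum_eq_sum fun b hb => by simp [P, G.weight_eq_zero_of_notMem h hb]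

lemma mu_mul_markovOp [Nontrivial Γ] (G : WeightedGraph Γ) {W : Finset Γ} {a : Γ}
    (h : ∀ b, G.graph.Adj a b → b ∈ W) (u : Γ → ℝ) :
    G.mu a * G.markovOp u a = ∑ b ∈ W, G.weight a b * u b := by
  rw [G.markovOp_eq_sum h, Finset.mul_sum]
  refine Finset.sum_congr rfl fun b _ => ?_
  have := (G.mu_pos a).ne'
  field_simp

lemma mu_mul_neg_laplacian [Nontrivial Γ] (G : WeightedGraph Γ) {W : Finset Γ} {a : Γ}
    (h : ∀ b, G.graph.Adj a b → b ∈ W) (u : Γ → ℝ) :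
    G.mu a * (u a - G.markovOp u a) = ∑ b ∈ W, G.weight a b * (u a - u b) := by
  rw [mul_sub, G.mu_mul_markovOp h, G.mu_eq_sum h, Finset.sum_mul, ← Finset.sum_sub_distrib]
  exact Finset.sum_congr rfl fun b _ => by ring

lemma FiniteNbrs.exists_finset {G : WeightedGraph Γ} (h : G.FiniteNbrs) (a : Γ) :
    ∃ W : Finset Γ, ∀ b, G.graph.Adj a b → b ∈ W :=
  ⟨(h a).toFinset, fun b hb => by simpa using hb⟩

/-- The Dirichlet form restricted to pairs of points of `W`. -/
noncomputable def dform (G : WeightedGraph Γ) (W : Finset Γ) (f g : Γ → ℝ) : ℝ :=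
  (1 / 2) * ∑ a ∈ W, ∑ b ∈ W, G.weight a b * ((f a - f b) * (g a - g b))

lemma dform_comm (G : WeightedGraph Γ) (W : Finset Γ) (f g : Γ → ℝ) :
    G.dform W f g = G.dform W g f := by
  simp only [dform, mul_comm (f _ - f _)]

lemma dform_self_nonneg (G : WeightedGraph Γ) (W : Finset Γ) (f : Γ → ℝ) :
    0 ≤ G.dform W f f :=
  mul_nonneg (by norm_num) (Finset.sum_nonneg fun a _ => Finset.sum_nonneg fun b _ =>
    mul_nonneg (G.weight_nonneg a b) (mul_self_nonneg _))

lemma dform_le_dform (G : WeightedGraph Γ) (W : Finset Γ) {f g f' g' : Γ → ℝ}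
    (h : ∀ a b, G.graph.Adj a b → (f a - f b) * (g a - g b) ≤ (f' a - f' b) * (g' a - g' b)) :
    G.dform W f g ≤ G.dform W f' g' := by
  refine mul_le_mul_of_nonneg_left ?_ (by norm_num)
  refine Finset.sum_le_sum fun a _ => Finset.sum_le_sum fun b _ => ?_
  by_cases hab : G.graph.Adj a b
  · exact mul_le_mul_of_nonneg_left (h a b hab) (G.weight_nonneg a b)
  · simp [G.weight_eq_zero a b hab]

lemma dform_congr (G : WeightedGraph Γ) (W : Finset Γ) {f g f' g' : Γ → ℝ}
    (h : ∀ a b, G.graph.Adj a b → (f a - f b) * (g a - g b) = (f' a - f' b) * (g' a - g' b)) :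
    G.dform W f g = G.dform W f' g' :=
  le_antisymm (G.dform_le_dform W fun a b hab => (h a b hab).le)
    (G.dform_le_dform W fun a b hab => (h a b hab).ge)

/-- Green's formula. -/
lemma dform_eq_sum [Nontrivial Γ] (G : WeightedGraph Γ) {W : Finset Γ} {D : Set Γ}
    (hDW : G.closedNhd D ⊆ W) (u : Γ → ℝ) {f : Γ → ℝ} (hf : ∀ a, a ∉ D → f a = 0) :
    G.dform W u f = ∑ a ∈ W, (u a - G.markovOp u a) * f a * G.mu a := by
  have h1 : ∑ a ∈ W, ∑ b ∈ W, G.weight a b * ((u a - u b) * f b) =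
      - ∑ a ∈ W, ∑ b ∈ W, G.weight a b * ((u a - u b) * f a) := by
    rw [Finset.sum_comm, ← Finset.sum_neg_distrib]
    refine Finset.sum_congr rfl fun a _ => ?_
    rw [← Finset.sum_neg_distrib]
    refine Finset.sum_congr rfl fun b _ => ?_
    rw [G.weight_symm b a]
    ring
  have h2 : G.dform W u f = ∑ a ∈ W, ∑ b ∈ W, G.weight a b * ((u a - u b) * f a) := by
    have : ∀ a b, G.weight a b * ((u a - u b) * (f a - f b)) =
        G.weight a b * ((u a - u b) * f a) - G.weight a b * ((u a - u b) * f b) := by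
      intro a b; ring
    simp only [dform, this, Finset.sum_sub_distrib, h1]
    ring
  rw [h2]
  refine Finset.sum_congr rfl fun a _ => ?_
  by_cases ha : a ∈ D
  · have := G.mu_mul_neg_laplacian (W := W)
      (fun b hb => hDW (G.adj_mem_closedNhd ha hb)) u
    rw [mul_right_comm, mul_comm (u a - _), this, Finset.sum_mul]
    exact Finset.sum_congr rfl fun b _ => by ring
  · simp [hf a ha]

lemma energy_eq_dform [Nontrivial Γ] (G : WeightedGraph Γ) {W : Finset Γ} {D : Set Γ}
    (hDW : G.closedNhd D ⊆ W) {f : Γ → ℝ} (hf : ∀ a, a ∉ D → f a = 0) :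
    G.energy f = G.dform W f f := by
  rw [G.dform_eq_sum hDW f hf, energy, innerMu, tsum_eq_sum (s := W)]
  · refine Finset.sum_congr rfl fun a _ => ?_
    simp [laplacian]
  · intro a ha
    rw [hf a fun h => ha (hDW (G.subset_closedNhd D h))]
    simp

lemma dform_cauchy_schwarz (G : WeightedGraph Γ) (W : Finset Γ) (f g : Γ → ℝ) :
    G.dform W f g ^ 2 ≤ G.dform W f f * G.dform W g g := by
  have key : ∀ t : ℝ, 0 ≤ G.dform W f f * (t * t) + 2 * G.dform W f g * t + G.dform W g g := by
    intro t
    have h := G.dform_self_nonneg W fun x => t * f x + g x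
    have : G.dform W (fun x => t * f x + g x) (fun x => t * f x + g x) =
        G.dform W f f * (t * t) + 2 * G.dform W f g * t + G.dform W g g := by
      simp only [dform, Finset.mul_sum, Finset.sum_mul, ← Finset.sum_add_distrib]
      refine Finset.sum_congr rfl fun a _ => Finset.sum_congr rfl fun b _ => ?_
      ring
    linarith
  have := discrim_le_zero key
  rw [discrim] at this
  nlinarith

lemma dform_smul_smul (G : WeightedGraph Γ) (W : Finset Γ) (c d : ℝ) (f g : Γ → ℝ) :
    G.dform W (fun x => c * f x) (fun x => d * g x) = c * d * G.dform W f g := by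
  simp only [dform, Finset.mul_sum]
  refine Finset.sum_congr rfl fun a _ => Finset.sum_congr rfl fun b _ => ?_
  ring

/-! ### Minimum principle and the Dirichlet problem -/

lemma markovOp_const_sub [Nontrivial Γ] {G : WeightedGraph Γ} (hf : G.FiniteNbrs) (c : ℝ)
    (u : Γ → ℝ) (a : Γ) : G.markovOp (fun x => c - u x) a = c - G.markovOp u a := by
  obtain ⟨W, hW⟩ := hf.exists_finset a
  have h := (G.mu_pos a).ne'
  refine mul_left_cancel₀ h ?_
  rw [mul_sub, G.mu_mul_markovOp hW, G.mu_mul_markovOp hW, G.mu_eq_sum hW, Finset.sum_mul,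
    ← Finset.sum_sub_distrib]
  exact Finset.sum_congr rfl fun b _ => by ring

lemma markovOp_lin [Nontrivial Γ] {G : WeightedGraph Γ} (hf : G.FiniteNbrs) (c d : ℝ)
    (u v : Γ → ℝ) (a : Γ) :
    G.markovOp (fun x => c * u x + d * v x) a = c * G.markovOp u a + d * G.markovOp v a := by
  obtain ⟨W, hW⟩ := hf.exists_finset a
  rw [G.markovOp_eq_sum hW, G.markovOp_eq_sum hW, G.markovOp_eq_sum hW, Finset.mul_sum,
    Finset.mul_sum, ← Finset.sum_add_distrib]
  exact Finset.sum_congr rfl fun b _ => by ring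

lemma markovOp_mono [Nontrivial Γ] {G : WeightedGraph Γ} (hf : G.FiniteNbrs) {u v : Γ → ℝ}
    {a : Γ} (h : ∀ b, G.graph.Adj a b → u b ≤ v b) : G.markovOp u a ≤ G.markovOp v a := by
  obtain ⟨W, hW⟩ := hf.exists_finset a
  rw [G.markovOp_eq_sum hW, G.markovOp_eq_sum hW]
  refine Finset.sum_le_sum fun b _ => ?_
  by_cases hab : G.graph.Adj a b
  · exact mul_le_mul_of_nonneg_left (h b hab) (div_nonneg (G.weight_nonneg a b) (G.mu_pos a).le)
  · simp [G.weight_eq_zero a b hab]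

lemma markovOp_const [Nontrivial Γ] {G : WeightedGraph Γ} (hf : G.FiniteNbrs) (c : ℝ) (a : Γ) :
    G.markovOp (fun _ => c) a = c := by
  simpa using G.markovOp_const_sub hf (c + c) (fun _ => c) a |>.symm.trans
    (by simp : _ = G.markovOp (fun _ => c) a) |> fun h => by linarith

/-- A superharmonic function dominates `p` times its value at any neighbour. -/
lemma LowerWeights.le_of_superharmonic [Nontrivial Γ] {G : WeightedGraph Γ} {p : ℝ}
    (hp : G.LowerWeights p) {u : Γ → ℝ} {a b : Γ} (h0 : ∀ c, G.graph.Adj a c → 0 ≤ u c)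
    (hs : G.markovOp u a ≤ u a) (hab : G.graph.Adj a b) : p * u b ≤ u a := by
  refine le_trans ?_ hs
  obtain ⟨W, hW⟩ := hp.finiteNbrs.exists_finset a
  rw [G.markovOp_eq_sum hW]
  have h1 : p ≤ G.weight a b / G.mu a := (le_div_iff₀ (G.mu_pos a)).2 (hp.2 a b hab)
  refine (mul_le_mul_of_nonneg_right h1 (h0 b hab)).trans ?_
  refine Finset.single_le_sum (f := fun b => G.weight a b / G.mu a * u b) (fun c _ => ?_)
    (hW b hab)
  by_cases hac : G.graph.Adj a c
  · exact mul_nonneg (div_nonneg (G.weight_nonneg a c) (G.mu_pos a).le) (h0 c hac)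
  · simp [G.weight_eq_zero a c hac]

/-- The minimum principle on finite sets. -/
lemma FiniteNbrs.min_principle [Infinite Γ] {G : WeightedGraph Γ} (hf : G.FiniteNbrs)
    {D : Set Γ} (hD : D.Finite) {v : Γ → ℝ} (hs : ∀ a ∈ D, G.markovOp v a ≤ v a)
    (hb : ∀ a ∈ G.closedNhd D, a ∉ D → 0 ≤ v a) : ∀ a ∈ D, 0 ≤ v a := by
  intro a₀ ha₀
  obtain ⟨a, ha, hmin⟩ := hD.exists_minimalFor v D ⟨a₀, ha₀⟩
  have hmin : ∀ b ∈ D, v a ≤ v b := fun b hb => by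
    rcases le_total (v a) (v b) with h | h
    · exact h
    · exact hmin hb h
  by_contra! hneg
  have hva : v a < 0 := (hmin a₀ ha₀).trans_lt hneg
  -- A negative minimum spreads to all neighbours and cannot leave D, hence by connectedness it
  -- fills Γ; infinitude of Γ then contradicts finiteness of D.
  have step : ∀ b c, (b ∈ D ∧ v b = v a) → G.graph.Adj b c → (c ∈ D ∧ v c = v a) := by
    rintro b c ⟨hbD, hba⟩ hbc
    have hge : ∀ c, G.graph.Adj b c → v a ≤ v c := fun c hc => by
      by_cases hcD : c ∈ D
      · exact hmin c hcD
      · exact hva.le.trans (hb c (G.adj_mem_closedNhd hbD hc) hcD)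
    obtain ⟨W, hW⟩ := hf.exists_finset b
    have h1 := G.mu_mul_neg_laplacian hW v
    have h2 : 0 ≤ G.mu b * (v b - G.markovOp v b) :=
      mul_nonneg (G.mu_pos b).le (sub_nonneg.2 (hs b hbD))
    have hterm : ∀ c ∈ W, 0 ≤ G.weight b c * (v c - v b) := fun c _ => by
      by_cases h : G.graph.Adj b c
      · exact mul_nonneg (G.weight_nonneg b c) (sub_nonneg.2 (hba ▸ hge c h))
      · simp [G.weight_eq_zero b c h]
    have h3 : ∑ c ∈ W, G.weight b c * (v c - v b) = 0 := by
      refine le_antisymm ?_ (Finset.sum_nonneg hterm)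
      have : ∑ c ∈ W, G.weight b c * (v c - v b) = - ∑ c ∈ W, G.weight b c * (v b - v c) := by
        rw [← Finset.sum_neg_distrib]
        exact Finset.sum_congr rfl fun c _ => by ring
      linarith
    have h4 := (Finset.sum_eq_zero_iff_of_nonneg hterm).1 h3 c (hW c hbc)
    have h5 : v c = v a := by
      rcases mul_eq_zero.1 h4 with h | h
      · exact absurd h (G.weight_pos b c hbc).ne'
      · rw [← hba]; linarith
    refine ⟨?_, h5⟩
    by_contra hcD
    have := hb c (G.adj_mem_closedNhd hbD hbc) hcD
    linarith
  have hall : ∀ c, c ∈ D ∧ v c = v a := by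
    intro c
    obtain ⟨w⟩ := G.connected.preconnected a c
    have : ∀ b c (w : G.graph.Walk b c), (b ∈ D ∧ v b = v a) → (c ∈ D ∧ v c = v a) := by
      intro b c w
      induction w with
      | nil => exact id
      | cons h _ ih => exact fun hb => ih (step _ _ hb h)
    exact this a c w ⟨ha, rfl⟩
  exact Set.infinite_univ (hD.subset fun c _ => (hall c).1)

/-- Solvability of the Dirichlet problem `-Δ u = φ` on a finite set. -/
lemma FiniteNbrs.exists_dirichlet [Infinite Γ] {G : WeightedGraph Γ} (hf : G.FiniteNbrs)
    {D : Set Γ} (hD : D.Finite) (φ : Γ → ℝ) :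
    ∃ u : Γ → ℝ, (∀ a, a ∉ D → u a = 0) ∧ ∀ a ∈ D, u a - G.markovOp u a = φ a := by
  classical
  have : Fintype D := hD.fintype
  let ext : (D → ℝ) → Γ → ℝ := fun f a => if h : a ∈ D then f ⟨a, h⟩ else 0
  have ext_lin : ∀ (c d : ℝ) (f g : D → ℝ),
      ext (c • f + d • g) = fun x => c * ext f x + d * ext g x := by
    intro c d f g
    funext x
    by_cases h : x ∈ D <;> simp [ext, h]
  have ext_mem : ∀ (f : D → ℝ) (a : D), ext f a = f a := fun f a => by simp [ext]
  let T : (D → ℝ) →ₗ[ℝ] (D → ℝ) :=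
    { toFun := fun f a => ext f a - G.markovOp (ext f) a
      map_add' := fun f g => by
        funext a
        have := ext_lin 1 1 f g
        simp only [one_smul] at this
        rw [this, markovOp_lin hf]
        simp only [Pi.add_apply]
        ring
      map_smul' := fun c f => by
        funext a
        have := ext_lin c 0 f 0
        simp only [zero_smul, add_zero] at this
        rw [this, markovOp_lin hf]
        simp only [RingHom.id_apply, Pi.smul_apply, smul_eq_mul]
        ring }
  -- T is an endomorphism of a finite-dimensional space, so uniqueness from the minimum principle,
  -- applied to the extension and to its negative, already gives existence.
  have hinj : Function.Injective T := by
    rw [← LinearMap.ker_eq_bot, LinearMap.ker_eq_bot']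
    intro f hfT
    have hz : ∀ a ∈ D, ext f a - G.markovOp (ext f) a = 0 := fun a ha => congrFun hfT ⟨a, ha⟩
    have h0 : ∀ a, a ∉ D → ext f a = 0 := fun a ha => by simp [ext, ha]
    have h1 := hf.min_principle hD (v := ext f) (fun a ha => by linarith [hz a ha])
      (fun a _ ha => (h0 a ha).ge)
    have h2 := hf.min_principle hD (v := fun x => 0 - ext f x)
      (fun a ha => by rw [markovOp_const_sub hf]; linarith [hz a ha])
      (fun a _ ha => by simp [h0 a ha])
    funext a
    have := h1 a a.2
    have h3 := h2 a a.2
    rw [ext_mem] at this h3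
    simp only [Pi.zero_apply]
    linarith
  obtain ⟨f, hf'⟩ := (LinearMap.injective_iff_surjective.1 hinj) fun a => φ a
  exact ⟨ext f, fun a ha => by simp [ext, ha], fun a ha => congrFun hf' ⟨a, ha⟩⟩

/-! ### The mean exit time as the solution of a Dirichlet problem -/

/-- The indicator of the event that the path stays in `D` up to time `n`. -/
noncomputable def survive (D : Set Γ) (n : ℕ) (X : ℕ → Γ) : ℝ≥0∞ :=
  Set.indicator {X : ℕ → Γ | ∀ i ≤ n, X i ∈ D} 1 X

lemma survive_of_forall {D : Set Γ} {n : ℕ} {X : ℕ → Γ} (h : ∀ i ≤ n, X i ∈ D) :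
    survive D n X = 1 :=
  Set.indicator_of_mem (s := {X : ℕ → Γ | ∀ i ≤ n, X i ∈ D}) h _

lemma survive_of_notMem {D : Set Γ} {n i : ℕ} {X : ℕ → Γ} (hi : i ≤ n) (h : X i ∉ D) :
    survive D n X = 0 :=
  Set.indicator_of_notMem (s := {X : ℕ → Γ | ∀ i ≤ n, X i ∈ D}) (fun hh => h (hh i hi)) _

/-- Layer-cake formula: the exit time counts the n for which the path has not left D up to time n.
Its mean thus becomes a sum of survival probabilities. -/
lemma exitTime_eq_tsum (D : Set Γ) (X : ℕ → Γ) : exitTime D X = ∑' n, survive D n X := by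
  classical
  by_cases h : ∃ k, X k ∉ D
  · have hk := Nat.find_spec h
    have hmin : ∀ i, i < Nat.find h → X i ∈ D := fun i hi => not_not.1 (Nat.find_min h hi)
    set k := Nat.find h
    have h1 : exitTime D X = k := by
      refine le_antisymm (sInf_le ⟨k, hk, rfl⟩) (le_sInf ?_)
      rintro _ ⟨j, hj, rfl⟩
      have : k ≤ j := by
        by_contra! hlt
        exact hj (hmin j hlt)
      exact Nat.cast_le.2 this
    rw [h1, tsum_eq_sum (s := Finset.range k)]
    · rw [Finset.sum_congr rfl (g := fun _ => 1)]
      · simp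
      · intro n hn
        refine survive_of_forall fun i hi => hmin i ?_
        exact lt_of_le_of_lt hi (Finset.mem_range.1 hn)
    · intro n hn
      exact survive_of_notMem (by simpa using hn) hk
  · push Not at h
    have h1 : exitTime D X = ∞ := by
      have : {k | X k ∉ D} = ∅ := by
        ext k
        simp [h k]
      simp [exitTime, this]
    have h2 : ∀ n, survive D n X = 1 := fun n => survive_of_forall fun i _ => h i
    simp [h1, h2]

section Exit

variable [MeasurableSpace Γ] [DiscreteMeasurableSpace Γ]

lemma lintegral_stepKernel [Countable Γ] [Infinite Γ]
    (G : WeightedGraph Γ) (f : Γ → ℝ≥0∞) (a : Γ) :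
    ∫⁻ y, f y ∂G.stepKernel a = ∑' y, f y * ENNReal.ofReal (G.P a y) := by
  rw [lintegral_countable']
  refine tsum_congr fun y => ?_
  congr 1
  exact PMF.toMeasure_apply_singleton _ _ (measurableSet_singleton y)

lemma lintegral_stepKernel_ofReal [Countable Γ] [Infinite Γ]
    {G : WeightedGraph Γ} (hf : G.FiniteNbrs) {e : Γ → ℝ}
    (he : ∀ a, 0 ≤ e a) (a : Γ) :
    ∫⁻ y, ENNReal.ofReal (e y) ∂G.stepKernel a = ENNReal.ofReal (G.markovOp e a) := by
  have h0 : ∀ y, 0 ≤ G.P a y := fun y => div_nonneg (G.weight_nonneg a y) (G.mu_pos a).le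
  rw [lintegral_stepKernel, markovOp, ENNReal.ofReal_tsum_of_nonneg]
  · exact tsum_congr fun y => by rw [mul_comm, ENNReal.ofReal_mul (h0 y)]
  · exact fun y => mul_nonneg (h0 y) (he y)
  · refine summable_of_hasFiniteSupport ((hf a).subset fun y hy => ?_)
    by_contra h
    exact hy (by simp [P, G.weight_eq_zero a y h])

/-- The simple Markov property. -/
lemma lintegral_pathLaw_succ [Infinite Γ] (G : WeightedGraph Γ) (x : Γ) (n : ℕ)
    (F : (Finset.Iic n → Γ) → ℝ≥0∞) (hF : Measurable F) (f : Γ → ℝ≥0∞) :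
    ∫⁻ X, F (Preorder.frestrictLe n X) * f (X (n + 1)) ∂G.pathLaw x =
      ∫⁻ X, F (Preorder.frestrictLe n X) * ∫⁻ y, f y ∂G.stepKernel (X n) ∂G.pathLaw x := by
  have hf : Measurable f := Measurable.of_discrete
  have hmap := Kernel.partialTraj_compProd_eq_map_traj (κ := G.historyKernel) (Nat.zero_le n)
    (X := fun _ => Γ) (a := 0) (x₀ := fun _ => x)
  have hmeas : Measurable fun q : (Finset.Iic n → Γ) × Γ => F q.1 * f q.2 :=
    (hF.comp measurable_fst).mul (hf.comp measurable_snd)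
  have h1 : ∫⁻ X, F (Preorder.frestrictLe n X) * f (X (n + 1)) ∂G.pathLaw x =
      ∫⁻ q, F q.1 * f q.2 ∂((G.pathLaw x).map
        fun X => (Preorder.frestrictLe (π := fun _ => Γ) n X, X (n + 1))) := by
    rw [lintegral_map hmeas]
    exact (Preorder.measurable_frestrictLe n).prodMk (measurable_pi_apply _)
  rw [h1, pathLaw, ← hmap, Measure.lintegral_compProd hmeas,
    ← Kernel.traj_map_frestrictLe_apply, lintegral_map]
  · refine lintegral_congr fun X => ?_
    exact lintegral_const_mul (μ := G.stepKernel (X n))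
      (F (Preorder.frestrictLe (π := fun _ => Γ) n X)) hf
  · exact hmeas.lintegral_kernel_prod_right'
  · exact Preorder.measurable_frestrictLe n

lemma measurable_survive (D : Set Γ) (n : ℕ) : Measurable (survive D n) := by
  refine measurable_one.indicator ?_
  have : {X : ℕ → Γ | ∀ i ≤ n, X i ∈ D} = ⋂ i, ⋂ (_ : i ≤ n), (fun X => X i) ⁻¹' D := by
    ext; simp
  rw [this]
  exact MeasurableSet.iInter fun i => MeasurableSet.iInter fun _ =>
    measurable_pi_apply i (MeasurableSet.of_discrete)

/-- Survival up to time n depends only on the history, so the Markov property applies; the vanishing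
of f off D takes care of survival at time n + 1. -/
lemma lintegral_survive_succ [Infinite Γ] (G : WeightedGraph Γ) (D : Set Γ) (x : Γ) (n : ℕ)
    (f : Γ → ℝ≥0∞) (h0 : ∀ a, a ∉ D → f a = 0) :
    ∫⁻ X, survive D (n + 1) X * f (X (n + 1)) ∂G.pathLaw x =
      ∫⁻ X, survive D n X * ∫⁻ y, f y ∂G.stepKernel (X n) ∂G.pathLaw x := by
  have hF : Measurable (Set.indicator {h : Finset.Iic n → Γ | ∀ i, h i ∈ D}
      (1 : (Finset.Iic n → Γ) → ℝ≥0∞)) := by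
    refine measurable_one.indicator ?_
    have : {h : Finset.Iic n → Γ | ∀ i, h i ∈ D} = ⋂ i, (fun h => h i) ⁻¹' D := by
      ext; simp
    rw [this]
    exact MeasurableSet.iInter fun i => measurable_pi_apply i (MeasurableSet.of_discrete)
  have hF' : ∀ X : ℕ → Γ, Set.indicator {h : Finset.Iic n → Γ | ∀ i, h i ∈ D}
      (1 : (Finset.Iic n → Γ) → ℝ≥0∞) (Preorder.frestrictLe (π := fun _ => Γ) n X) =
        survive D n X := by
    intro X
    simp only [survive, Set.indicator]
    congr 1
    simp
  have h := G.lintegral_pathLaw_succ x n _ hF f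
  simp only [hF'] at h
  rw [← h]
  refine lintegral_congr fun X => ?_
  by_cases hX : X (n + 1) ∈ D
  · congr 1
    simp only [survive, Set.indicator]
    congr 1
    simp only [Set.mem_ofPred_eq, eq_iff_iff]
    constructor
    · exact fun hh i hi => hh i (by omega)
    · intro hh i hi
      rcases Nat.lt_or_ge n i with h1 | h1
      · rwa [show i = n + 1 by omega]
      · exact hh i h1
  · simp [h0 _ hX]

lemma pathLaw_zero [Infinite Γ] (G : WeightedGraph Γ) (x : Γ) (f : Γ → ℝ≥0∞) :
    ∫⁻ X, f (X 0) ∂G.pathLaw x = f x := by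
  rw [pathLaw, Kernel.lintegral_traj]
  · simp [Function.updateFinset]
  · exact (Measurable.of_discrete (f := f)).comp (measurable_pi_apply 0)

/-- The mean exit time from a finite set solves `-Δ e = 1`. -/
theorem meanExit_eq [Countable Γ] [Infinite Γ]
    {G : WeightedGraph Γ} (hf : G.FiniteNbrs) {D : Set Γ} (hD : D.Finite)
    {e : Γ → ℝ} (he0 : ∀ a, a ∉ D → e a = 0) (he : ∀ a, 0 ≤ e a)
    (heD : ∀ a ∈ D, e a - G.markovOp e a = 1) (x : Γ) :
    G.meanExit x D = ENNReal.ofReal (e x) := by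
  set A : ℕ → ℝ≥0∞ := fun n => ∫⁻ X, survive D n X * ENNReal.ofReal (e (X n)) ∂G.pathLaw x
    with hA
  set q : ℕ → ℝ≥0∞ := fun n => ∫⁻ X, survive D n X ∂G.pathLaw x with hq
  have hmeasX : ∀ (n : ℕ) (g : Γ → ℝ≥0∞), Measurable fun X : ℕ → Γ => g (X n) := fun n g =>
    (Measurable.of_discrete (f := g)).comp (measurable_pi_apply n)
  -- While the walk is in D, one step lowers e by 1 on average, so the survival probabilities
  -- telescope against A.
  have hstep : ∀ n, A (n + 1) + q n = A n := by
    intro n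
    simp only [hA, hq]
    rw [G.lintegral_survive_succ D x n (fun a => ENNReal.ofReal (e a))
      (fun a ha => by simp [he0 a ha]), ← lintegral_add_right _ (measurable_survive D n)]
    refine lintegral_congr fun X => ?_
    rw [lintegral_stepKernel_ofReal hf he]
    by_cases hX : X n ∈ D
    · have h1 := heD _ hX
      have h2 : 0 ≤ G.markovOp e (X n) :=
        tsum_nonneg fun y => mul_nonneg (div_nonneg (G.weight_nonneg _ y) (G.mu_pos _).le) (he y)
      rw [show e (X n) = G.markovOp e (X n) + 1 by linarith,
        ENNReal.ofReal_add h2 zero_le_one, ENNReal.ofReal_one, mul_add, mul_one]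
    · have : survive D n X = 0 := survive_of_notMem le_rfl hX
      simp [this]
  have hA0 : A 0 = ENNReal.ofReal (e x) := by
    simp only [hA]
    have := G.pathLaw_zero x fun a => ENNReal.ofReal (e a)
    rw [← this]
    refine lintegral_congr fun X => ?_
    by_cases h : X 0 ∈ D
    · have : survive D 0 X = 1 :=
        survive_of_forall fun i hi => by rwa [Nat.le_zero.1 hi]
      rw [this, one_mul]
    · simp [he0 _ h]
  have hsum : ∀ n, A n + ∑ i ∈ Finset.range n, q i = ENNReal.ofReal (e x) := by
    intro n
    induction n with
    | zero => simp [hA0]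
    | succ n ih =>
      rw [Finset.sum_range_succ, add_comm _ (q n), ← add_assoc, hstep, ih]
  have hE : G.meanExit x D = ∑' n, q n := by
    rw [meanExit]
    simp only [exitTime_eq_tsum]
    exact lintegral_tsum fun n => (measurable_survive D n).aemeasurable
  -- This bound alone forces q n → 0, and with e bounded the remainder A n tends to 0; no separate
  -- argument that the walk leaves D is needed.
  have hle : ∑' n, q n ≤ ENNReal.ofReal (e x) := by
    rw [ENNReal.tsum_eq_iSup_nat]
    exact iSup_le fun n => by rw [← hsum n]; exact le_add_self
  have hq0 : Filter.Tendsto q Filter.atTop (nhds 0) :=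
    ENNReal.tendsto_atTop_zero_of_tsum_ne_top (hle.trans_lt ENNReal.ofReal_lt_top).ne
  obtain ⟨M, hM⟩ : ∃ M : ℝ, ∀ a, e a ≤ M := by
    obtain ⟨M, hM⟩ := (hD.image e).bddAbove
    refine ⟨max M 0, fun a => ?_⟩
    by_cases ha : a ∈ D
    · exact (hM ⟨a, ha, rfl⟩).trans (le_max_left _ _)
    · rw [he0 a ha]; exact le_max_right _ _
  have hAq : ∀ n, A n ≤ q n * ENNReal.ofReal M := by
    intro n
    simp only [hA, hq]
    rw [← lintegral_mul_const _ (measurable_survive D n)]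
    exact lintegral_mono fun X => by gcongr; exact hM _
  have hA0 : Filter.Tendsto A Filter.atTop (nhds 0) := by
    refine tendsto_of_tendsto_of_tendsto_of_le_of_le tendsto_const_nhds ?_ (fun _ => zero_le) hAq
    simpa using ENNReal.Tendsto.mul_const hq0 (Or.inr ENNReal.ofReal_ne_top)
  rw [hE]
  refine tendsto_nhds_unique (ENNReal.tendsto_nat_tsum q) ?_
  have h1 : ∀ n, ∑ i ∈ Finset.range n, q i = ENNReal.ofReal (e x) - A n := by
    intro n
    refine ENNReal.eq_sub_of_add_eq ?_ (by rw [add_comm]; exact hsum n)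
    exact ((hAq n).trans_lt (ENNReal.mul_lt_top
      ((ENNReal.le_tsum n).trans hle |>.trans_lt ENNReal.ofReal_lt_top)
      ENNReal.ofReal_lt_top)).ne
  simp only [h1]
  simpa using ENNReal.Tendsto.sub tendsto_const_nhds hA0 (Or.inl ENNReal.ofReal_ne_top)

end Exit

/-! ### Green functions -/

/-- `g` is the Green function of `D` with pole `x`. -/
structure IsGreen (G : WeightedGraph Γ) (D : Set Γ) (x : Γ) (g : Γ → ℝ) : Prop where
  eq_zero : ∀ a, a ∉ D → g a = 0
  pole : (g x - G.markovOp g x) * G.mu x = 1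
  harm : ∀ a ∈ D, a ≠ x → G.markovOp g a = g a

lemma FiniteNbrs.exists_isGreen [Infinite Γ] {G : WeightedGraph Γ} (hf : G.FiniteNbrs)
    {D : Set Γ} (hD : D.Finite) {x : Γ} (hx : x ∈ D) : ∃ g, G.IsGreen D x g := by
  classical
  obtain ⟨g, hg0, hg⟩ := hf.exists_dirichlet hD fun a => if a = x then (G.mu x)⁻¹ else 0
  refine ⟨g, hg0, ?_, fun a ha hax => ?_⟩
  · rw [hg x hx, if_pos rfl, inv_mul_cancel₀ (G.mu_pos x).ne']
  · have := hg a ha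
    rw [if_neg hax] at this
    linarith

lemma IsGreen.superharmonic [Nontrivial Γ] {G : WeightedGraph Γ} {D : Set Γ} {x : Γ}
    {g : Γ → ℝ} (hg : G.IsGreen D x g) : ∀ a ∈ D, G.markovOp g a ≤ g a := by
  intro a ha
  by_cases hax : a = x
  · subst hax
    have := hg.pole
    have h := G.mu_pos a
    by_contra! hlt
    nlinarith
  · exact (hg.harm a ha hax).le

lemma IsGreen.nonneg [Infinite Γ] {G : WeightedGraph Γ} (hf : G.FiniteNbrs) {D : Set Γ}
    (hD : D.Finite) {x : Γ} {g : Γ → ℝ} (hg : G.IsGreen D x g) (a : Γ) : 0 ≤ g a := by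
  by_cases ha : a ∈ D
  · exact hf.min_principle hD hg.superharmonic (fun b _ hb => (hg.eq_zero b hb).ge) a ha
  · exact (hg.eq_zero a ha).ge

/-- Reproducing property: by Green's formula -Δg, weighted by μ, is a unit mass at the pole. -/
lemma IsGreen.dform_eq [Infinite Γ] {G : WeightedGraph Γ} {D : Set Γ} {x : Γ}
    (hx : x ∈ D) {g : Γ → ℝ} (hg : G.IsGreen D x g) {W : Finset Γ} (hW : G.closedNhd D ⊆ W)
    {f : Γ → ℝ} (hf : ∀ a, a ∉ D → f a = 0) : G.dform W g f = f x := by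
  rw [G.dform_eq_sum hW g hf, Finset.sum_eq_single x]
  · rw [mul_right_comm, hg.pole, one_mul]
  · intro a _ hax
    by_cases ha : a ∈ D
    · rw [hg.harm a ha hax]; ring
    · rw [hf a ha]; ring
  · exact fun h => absurd (hW (G.subset_closedNhd D hx)) h

lemma FiniteNbrs.exists_window {G : WeightedGraph Γ} (hf : G.FiniteNbrs) {D : Set Γ}
    (hD : D.Finite) : ∃ W : Finset Γ, G.closedNhd D ⊆ W :=
  ⟨(hf.closedNhd_finite hD).toFinset, by simp⟩

/-- Both values are the pairing of g with h under the symmetric Dirichlet form. -/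
lemma IsGreen.symm [Infinite Γ] {G : WeightedGraph Γ} (hf : G.FiniteNbrs) {D : Set Γ}
    (hD : D.Finite) {x y : Γ} (hx : x ∈ D) (hy : y ∈ D) {g h : Γ → ℝ}
    (hg : G.IsGreen D x g) (hh : G.IsGreen D y h) : g y = h x := by
  obtain ⟨W, hW⟩ := hf.exists_window hD
  rw [← hg.dform_eq hx hW hh.eq_zero, ← hh.dform_eq hy hW hg.eq_zero, dform_comm]

lemma IsGreen.inv_mu_le [Infinite Γ] {G : WeightedGraph Γ} (hf : G.FiniteNbrs) {D : Set Γ}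
    (hD : D.Finite) {x : Γ} {g : Γ → ℝ} (hg : G.IsGreen D x g) : (G.mu x)⁻¹ ≤ g x := by
  have h0 : 0 ≤ G.markovOp g x := by
    rw [← G.markovOp_const hf 0 x]
    exact markovOp_mono hf fun b _ => hg.nonneg hf hD b
  have h := G.mu_pos x
  rw [inv_le_iff_one_le_mul₀ h, ← hg.pole]
  exact mul_le_mul_of_nonneg_right (by linarith) h.le

/-- Beyond the sphere g has no pole, so the minimum principle applies to M - g there; outside D one
uses M ≥ 0. -/
lemma IsGreen.le_of_le_sphere [Infinite Γ] {G : WeightedGraph Γ} (hf : G.FiniteNbrs)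
    {D : Set Γ} (hD : D.Finite) {x : Γ} {g : Γ → ℝ} (hg : G.IsGreen D x g) {n : ℕ} {M : ℝ}
    (hM : 0 ≤ M) (h : ∀ y, G.graph.dist x y = n → g y ≤ M) (y : Γ) (hy : n ≤ G.graph.dist x y) :
    g y ≤ M := by
  by_cases hyD : y ∈ D
  swap
  · rw [hg.eq_zero y hyD]; exact hM
  rcases hy.eq_or_lt with hy | hy
  · exact h y hy.symm
  have := hf.min_principle (D := {y ∈ D | n < G.graph.dist x y})
    (hD.subset fun y hy => hy.1) (v := fun y => M - g y) ?_ ?_ y ⟨hyD, hy⟩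
  · linarith
  · rintro a ⟨ha, hna⟩
    rw [markovOp_const_sub hf, hg.harm a ha]
    rintro rfl
    simp at hna
  · rintro a (ha | ⟨b, ⟨-, hb⟩, hba⟩) ha'
    · exact absurd ha ha'
    · by_cases haD : a ∈ D
      · have h1 : ¬ n < G.graph.dist x a := fun h => ha' ⟨haD, h⟩
        have h2 := G.dist_adj_le x hba.symm
        have := h a (by omega)
        linarith
      · rw [hg.eq_zero a haD]; linarith

/-- The pole lies inside the sphere, but a lower bound only needs superharmonicity. -/
lemma IsGreen.ge_of_ge_sphere [Infinite Γ] {G : WeightedGraph Γ} (hf : G.FiniteNbrs)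
    {D : Set Γ} (hD : D.Finite) {x : Γ} {g : Γ → ℝ} (hg : G.IsGreen D x g) {n : ℕ} {m : ℝ}
    (hnD : ∀ y, G.graph.dist x y ≤ n → y ∈ D)
    (h : ∀ y, G.graph.dist x y = n → m ≤ g y) (y : Γ) (hy : G.graph.dist x y ≤ n) :
    m ≤ g y := by
  rcases hy.eq_or_lt with hy | hy
  · exact h y hy
  have := hf.min_principle (D := {y | G.graph.dist x y < n})
    (hD.subset fun y hy => hnD y (le_of_lt hy)) (v := fun y => 1 * g y + (-m) * 1) ?_ ?_ y hy
  · linarith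
  · intro a ha
    rw [markovOp_lin hf (1 : ℝ) (-m) g (fun _ => 1), markovOp_const hf]
    linarith [hg.superharmonic a (hnD a (le_of_lt ha))]
  · rintro a (ha | ⟨b, hb, hba⟩) ha'
    · exact absurd ha ha'
    · have h2 := G.dist_adj_le x hba
      have h1 : ¬ G.graph.dist x a < n := ha'
      have h3 : G.graph.dist x b < n := hb
      have := h a (by omega)
      linarith

/-- Superharmonic functions in a ball decay at most exponentially away from the centre. -/
lemma LowerWeights.pow_dist_mul_le [Nontrivial Γ] {G : WeightedGraph Γ} {p : ℝ}
    (hp : G.LowerWeights p) {u : Γ → ℝ} {x : Γ} {R : ℝ} (h0 : ∀ a, 0 ≤ u a)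
    (hs : ∀ a ∈ G.ball x R, G.markovOp u a ≤ u a) :
    ∀ (n : ℕ) (y : Γ), y ∈ G.ball x R → G.graph.dist x y = n → p ^ n * u x ≤ u y := by
  intro n
  induction n with
  | zero =>
    intro y _ hy
    rw [G.connected.dist_eq_zero_iff] at hy
    simp [hy]
  | succ n ih =>
    intro y hy hn
    obtain ⟨q, -, hq, hadj, hd, -⟩ := G.exists_geodesic x y
    have h1 := hadj n (by omega)
    rw [show n + 1 = G.graph.dist x y from hn.symm, hq] at h1
    have h2 := hd n (by omega)
    have h3 : q n ∈ G.ball x R := by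
      rw [mem_ball, h2]
      refine lt_trans ?_ hy
      rw [hn]
      exact_mod_cast Nat.lt_succ_self n
    have h4 := hp.le_of_superharmonic (fun c _ => h0 c) (hs y hy) h1.symm
    have h5 := mul_le_mul_of_nonneg_left (ih (q n) h3 h2) hp.1.le
    rw [pow_succ']
    linarith

lemma vol_eq {G : WeightedGraph Γ} [Nontrivial Γ] (hf : G.FiniteNbrs) (x : Γ) (R : ℝ) :
    G.vol x R = ENNReal.ofReal (∑ y ∈ (hf.ball_finite x R).toFinset, G.mu y) := by
  rw [vol, tsum_subtype (G.ball x R) fun y => ENNReal.ofReal (G.mu y),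
    ENNReal.ofReal_sum_of_nonneg fun y _ => (G.mu_pos y).le,
    tsum_eq_sum (s := (hf.ball_finite x R).toFinset)]
  · refine Finset.sum_congr rfl fun y hy => Set.indicator_of_mem ?_ _
    simpa using hy
  · intro y hy
    refine Set.indicator_of_notMem ?_ _
    simpa using hy

/-- Let e solve -Δe = 1 in the ball. The pairing of g with e equals e(x) when the Laplacian falls on
g, and the weighted sum of g when it falls on e. -/
lemma IsGreen.exitE_eq [Countable Γ] [Infinite Γ] [MeasurableSpace Γ]
    [DiscreteMeasurableSpace Γ] {G : WeightedGraph Γ} (hf : G.FiniteNbrs) {x : Γ} {R : ℝ}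
    (hR : 0 < R) {g : Γ → ℝ} (hg : G.IsGreen (G.ball x R) x g) :
    G.exitE x R = ENNReal.ofReal (∑ y ∈ (hf.ball_finite x R).toFinset, g y * G.mu y) := by
  classical
  have hD := hf.ball_finite x R
  obtain ⟨e, he0, heD⟩ := hf.exists_dirichlet hD fun _ => 1
  have hes : ∀ a ∈ G.ball x R, G.markovOp e a ≤ e a := fun a ha => by linarith [heD a ha]
  have henn : ∀ a, 0 ≤ e a := by
    intro a
    by_cases ha : a ∈ G.ball x R
    · exact hf.min_principle hD hes (fun b _ hb => (he0 b hb).ge) a ha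
    · exact (he0 a ha).ge
  rw [exitE, meanExit_eq hf hD he0 henn heD]
  congr 1
  obtain ⟨W, hW⟩ := hf.exists_window hD
  rw [← hg.dform_eq (G.mem_ball_self x hR) hW he0, dform_comm, G.dform_eq_sum hW e hg.eq_zero]
  symm
  refine Finset.sum_subset_zero_on_sdiff ?_ ?_ ?_
  · intro y hy
    exact hW (G.subset_closedNhd _ (by simpa using hy))
  · intro y hy
    have : y ∉ G.ball x R := by simpa using (Finset.mem_sdiff.1 hy).2
    simp [hg.eq_zero y this]
  · intro y hy
    rw [heD y (by simpa using hy), one_mul]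

lemma IsGreen.le_exitE [Countable Γ] [Infinite Γ] [MeasurableSpace Γ]
    [DiscreteMeasurableSpace Γ] {G : WeightedGraph Γ} (hf : G.FiniteNbrs) {x : Γ} {r R m : ℝ}
    (hR : 0 < R) (hrR : r ≤ R) {g : Γ → ℝ} (hg : G.IsGreen (G.ball x R) x g) (hm : 0 ≤ m)
    (h : ∀ y ∈ G.ball x r, m ≤ g y) : ENNReal.ofReal m * G.vol x r ≤ G.exitE x R := by
  rw [hg.exitE_eq hf hR, vol_eq hf, ← ENNReal.ofReal_mul hm, Finset.mul_sum]
  refine ENNReal.ofReal_le_ofReal ?_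
  refine (Finset.sum_le_sum (g := fun y => g y * G.mu y) fun y hy => ?_).trans
    (Finset.sum_le_sum_of_subset_of_nonneg ?_ fun y _ _ => ?_)
  · exact mul_le_mul_of_nonneg_right (h y (by simpa using hy)) (G.mu_pos y).le
  · exact Set.Finite.toFinset_mono (G.ball_subset_ball x hrR)
  · exact mul_nonneg (hg.nonneg hf (hf.ball_finite x R) y) (G.mu_pos y).le

/-! ### Energy minimizers and capacities -/

lemma dform_add_smul (G : WeightedGraph Γ) (W : Finset Γ) (f d : Γ → ℝ) (t : ℝ) :
    G.dform W (fun x => f x + t * d x) (fun x => f x + t * d x) =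
      G.dform W f f + 2 * t * G.dform W f d + t ^ 2 * G.dform W d d := by
  simp only [dform, Finset.mul_sum, ← Finset.sum_add_distrib]
  refine Finset.sum_congr rfl fun a _ => Finset.sum_congr rfl fun b _ => ?_
  ring

lemma clamp_sq_le (s t : ℝ) : (max 0 (min 1 s) - max 0 (min 1 t)) ^ 2 ≤ (s - t) ^ 2 := by
  rw [sq_le_sq]
  refine (abs_max_sub_max_le_max 0 _ 0 _).trans ?_
  simp only [sub_self, abs_zero, abs_nonneg, sup_of_le_right]
  refine (abs_min_sub_min_le_max 1 s 1 t).trans ?_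
  simp

/-- Direct method: the [0,1]-valued admissible functions are compact in the product topology, the
form on W involves finitely many coordinates, and clamping to [0,1] does not raise it. Harmonicity
is claimed only where all neighbours lie in W, since the form ignores other edges. -/
lemma exists_minimizer [Nontrivial Γ] {G : WeightedGraph Γ} (hf : G.FiniteNbrs) (W : Finset Γ)
    {A B : Set Γ} (hAB : Disjoint A B) :
    ∃ h : Γ → ℝ, (∀ a, 0 ≤ h a) ∧ (∀ a, h a ≤ 1) ∧ (∀ a ∈ A, h a = 1) ∧ (∀ a ∈ B, h a = 0) ∧
      (∀ f : Γ → ℝ, (∀ a ∈ A, f a = 1) → (∀ a ∈ B, f a = 0) →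
        G.dform W h h ≤ G.dform W f f) ∧
      ∀ a ∈ W, (∀ b, G.graph.Adj a b → b ∈ W) → a ∉ A → a ∉ B → G.markovOp h a = h a := by
  classical
  let S : Γ → Set ℝ := fun a => if a ∈ A then {1} else if a ∈ B then {0} else Set.Icc 0 1
  have hS01 : ∀ a, S a ⊆ Set.Icc 0 1 := by
    intro a
    simp only [S]
    split_ifs <;> simp
  have hcomp : IsCompact (Set.pi Set.univ S) := by
    refine isCompact_univ_pi fun a => ?_
    simp only [S]
    split_ifs
    exacts [isCompact_singleton, isCompact_singleton, isCompact_Icc]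
  have hcont : Continuous fun h : Γ → ℝ => G.dform W h h := by
    unfold dform
    fun_prop
  have hclamp : ∀ f : Γ → ℝ, (∀ a ∈ A, f a = 1) → (∀ a ∈ B, f a = 0) →
      (fun a => max 0 (min 1 (f a))) ∈ Set.pi Set.univ S := by
    intro f h1 h0 a _
    simp only [S]
    split_ifs with hA hB
    · simp [h1 a hA]
    · simp [h0 a hB]
    · simp
  have hne : (Set.pi Set.univ S).Nonempty := by
    refine ⟨_, hclamp (fun a => if a ∈ A then 1 else 0) (fun a ha => if_pos ha) fun a ha => ?_⟩
    exact if_neg fun h => hAB.le_bot ⟨h, ha⟩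
  obtain ⟨h, hhS, hmin⟩ := hcomp.exists_isMinOn hne hcont.continuousOn
  have hmin : ∀ f ∈ Set.pi Set.univ S, G.dform W h h ≤ G.dform W f f := fun f hf => hmin hf
  have h0 : ∀ a, 0 ≤ h a := fun a => (hS01 a (hhS a trivial)).1
  have h1 : ∀ a, h a ≤ 1 := fun a => (hS01 a (hhS a trivial)).2
  refine ⟨h, h0, h1, ?_, ?_, ?_, ?_⟩
  · intro a ha
    simpa [S, ha] using hhS a trivial
  · intro a ha
    have : a ∉ A := fun h => hAB.le_bot ⟨h, ha⟩
    simpa [S, ha, this] using hhS a trivial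
  · intro f hf1 hf0
    refine (hmin _ (hclamp f hf1 hf0)).trans (G.dform_le_dform W fun a b _ => ?_)
    have := clamp_sq_le (f a) (f b)
    nlinarith
  · intro a haW hnbr haA haB
    set t := G.markovOp h a - h a with ht
    let δ : Γ → ℝ := fun x => if x = a then 1 else 0
    have hδ : ∀ x, x ∉ ({a} : Set Γ) → δ x = 0 := fun x hx => if_neg hx
    have hW : G.closedNhd {a} ⊆ W := by
      rintro x (rfl | ⟨y, rfl, hxy⟩)
      exacts [haW, hnbr x hxy]
    have hsum : ∀ u, G.dform W u δ = (u a - G.markovOp u a) * G.mu a := by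
      intro u
      rw [G.dform_eq_sum hW u hδ, Finset.sum_eq_single a]
      · simp [δ]
      · intro b _ hb; simp [δ, hb]
      · exact fun hh => absurd haW hh
    have hPδ : G.markovOp δ a = 0 := by
      rw [G.markovOp_eq_sum hnbr]
      refine Finset.sum_eq_zero fun b _ => ?_
      by_cases hb : b = a
      · simp [hb, G.weight_eq_zero a a (G.graph.irrefl)]
      · simp [δ, hb]
    -- The competitor replaces h a by the average over the neighbours; this changes the energy by
    -- -t² μ(a), so minimality gives t = 0.
    have hmem : (fun x => h x + t * δ x) ∈ Set.pi Set.univ S := by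
      intro x _
      by_cases hx : x = a
      · have e : h x + t * δ x = G.markovOp h a := by simp [δ, hx, ht]
        have hc := markovOp_const (G := G) hf
        show h x + t * δ x ∈ S x
        rw [e, hx]
        simp only [S, haA, haB, if_false]
        constructor
        · rw [← hc 0 a]; exact markovOp_mono hf fun b _ => h0 b
        · rw [← hc 1 a]; exact markovOp_mono hf fun b _ => h1 b
      · simpa [δ, hx] using hhS x trivial
    have := hmin _ hmem
    rw [G.dform_add_smul, hsum, hsum, hPδ] at this
    have e1 : h a - G.markovOp h a = -t := by rw [ht]; ring
    rw [e1] at this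
    have e2 : δ a = 1 := if_pos rfl
    rw [e2] at this
    have hmu := G.mu_pos a
    have h3 : t ^ 2 * G.mu a ≤ 0 := by nlinarith
    have h4 : t ^ 2 ≤ 0 := by
      by_contra! hlt
      nlinarith
    have h5 : t = 0 := by nlinarith
    linarith

/-- The capacity of the annulus, i.e. the inverse of `ρ(x,r,R)`. -/
noncomputable def cap (G : WeightedGraph Γ) (x : Γ) (r R : ℝ) : ℝ := ((G.rho x r R)⁻¹).toReal

/-- The equilibrium potential of an annulus. -/
structure IsCapacitor (G : WeightedGraph Γ) (x : Γ) (r R : ℝ) (φ : Γ → ℝ) : Prop where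
  nonneg : ∀ a, 0 ≤ φ a
  le_one : ∀ a, φ a ≤ 1
  eq_one : ∀ a ∈ G.ball x r, φ a = 1
  eq_zero : ∀ a, a ∉ G.ball x R → φ a = 0
  superharmonic : ∀ a ∈ G.ball x R, G.markovOp φ a ≤ φ a
  dform_eq : ∀ W : Finset Γ, G.closedNhd (G.ball x R) ⊆ W → G.dform W φ φ = G.cap x r R

lemma capacity_aux [Infinite Γ] {G : WeightedGraph Γ} (hf : G.FiniteNbrs) (x : Γ) {r R : ℝ}
    (hr : 0 < r) (hrR : r ≤ R) :
    (∃ φ, G.IsCapacitor x r R φ) ∧ 0 < G.cap x r R ∧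
      G.rho x r R = ENNReal.ofReal (G.cap x r R)⁻¹ ∧
      ∀ W : Finset Γ, G.closedNhd (G.ball x R) ⊆ W → ∀ f : Γ → ℝ,
        (∀ a ∈ G.ball x r, f a = 1) → (∀ a, a ∉ G.ball x R → f a = 0) →
        G.cap x r R ≤ G.dform W f f := by
  have hD := hf.ball_finite x R
  have hxr := G.mem_ball_self x hr
  have hxR := G.mem_ball_self x (hr.trans_le hrR)
  obtain ⟨W, hW⟩ := hf.exists_window hD
  have hdisj : Disjoint (G.ball x r) (G.ball x R)ᶜ :=
    Set.disjoint_compl_right_iff_subset.2 (G.ball_subset_ball x hrR)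
  obtain ⟨φ, h0, h1, hA, hB, hmin, hharm⟩ := exists_minimizer hf W hdisj
  obtain ⟨g, hg⟩ := hf.exists_isGreen hD hxR
  -- Cauchy–Schwarz against the Green function: 1 = φ(x)² = E(g,φ)² ≤ E(g,g) E(φ,φ).
  have hpos : 0 < G.dform W φ φ := by
    have e := hg.dform_eq hxR hW hB
    rw [hA x hxr] at e
    have cs := G.dform_cauchy_schwarz W g φ
    rw [e] at cs
    refine (G.dform_self_nonneg W φ).lt_of_ne fun h => ?_
    rw [← h] at cs
    norm_num at cs
  have hrho : G.rho x r R = ENNReal.ofReal (G.dform W φ φ)⁻¹ := by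
    rw [rho, resistance, ENNReal.ofReal_inv_of_pos hpos]
    congr 1
    refine le_antisymm (sInf_le ⟨φ, ⟨?_, hA, hB⟩, ?_⟩) (le_sInf ?_)
    · refine hD.subset fun a ha => ?_
      by_contra h
      exact ha (hB a h)
    · simp only
      rw [G.energy_eq_dform hW hB]
    · rintro _ ⟨f, ⟨-, hf1, hf0⟩, rfl⟩
      simp only
      rw [G.energy_eq_dform hW hf0]
      exact ENNReal.ofReal_le_ofReal (hmin f hf1 hf0)
  have hcap : G.cap x r R = G.dform W φ φ := by
    rw [cap, hrho, ENNReal.ofReal_inv_of_pos hpos, inv_inv, ENNReal.toReal_ofReal hpos.le]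
  refine ⟨⟨φ, h0, h1, hA, hB, fun a ha => ?_, fun W' hW' => ?_⟩, ?_, ?_, fun W' hW' f hf1 hf0 => ?_⟩
  · by_cases har : a ∈ G.ball x r
    · rw [hA a har, ← markovOp_const hf 1 a]
      exact markovOp_mono hf fun b _ => h1 b
    · refine (hharm a (hW (G.subset_closedNhd _ ha)) (fun b hb => ?_) har (by simpa using ha)).le
      exact hW (G.adj_mem_closedNhd ha hb)
  · rw [hcap, ← G.energy_eq_dform hW hB, G.energy_eq_dform hW' hB]
  · rwa [hcap]
  · rw [hrho, hcap]
  · rw [hcap, ← G.energy_eq_dform hW' hf0, G.energy_eq_dform hW hf0]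
    exact hmin f hf1 hf0

lemma exists_isCapacitor [Infinite Γ] {G : WeightedGraph Γ} (hf : G.FiniteNbrs) (x : Γ)
    {r R : ℝ} (hr : 0 < r) (hrR : r ≤ R) : ∃ φ, G.IsCapacitor x r R φ :=
  (capacity_aux hf x hr hrR).1

lemma cap_pos [Infinite Γ] {G : WeightedGraph Γ} (hf : G.FiniteNbrs) (x : Γ)
    {r R : ℝ} (hr : 0 < r) (hrR : r ≤ R) : 0 < G.cap x r R :=
  (capacity_aux hf x hr hrR).2.1

lemma rho_eq [Infinite Γ] {G : WeightedGraph Γ} (hf : G.FiniteNbrs) (x : Γ)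
    {r R : ℝ} (hr : 0 < r) (hrR : r ≤ R) : G.rho x r R = ENNReal.ofReal (G.cap x r R)⁻¹ :=
  (capacity_aux hf x hr hrR).2.2.1

lemma cap_le [Infinite Γ] {G : WeightedGraph Γ} (hf : G.FiniteNbrs) {x : Γ}
    {r R : ℝ} (hr : 0 < r) (hrR : r ≤ R) {W : Finset Γ} (hW : G.closedNhd (G.ball x R) ⊆ W)
    {f : Γ → ℝ} (h1 : ∀ a ∈ G.ball x r, f a = 1) (h0 : ∀ a, a ∉ G.ball x R → f a = 0) :
    G.cap x r R ≤ G.dform W f f :=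
  (capacity_aux hf x hr hrR).2.2.2 W hW f h1 h0

lemma dform_min_le (G : WeightedGraph Γ) (W : Finset Γ) (g : Γ → ℝ) (m : ℝ) :
    G.dform W (fun x => min (g x) m) (fun x => min (g x) m) ≤
      G.dform W g fun x => min (g x) m := by
  refine G.dform_le_dform W fun a b _ => ?_
  rcases le_total (g a) m with h1 | h1 <;> rcases le_total (g b) m with h2 | h2 <;>
    simp only [h1, h2, min_eq_left, min_eq_right] <;> nlinarith

lemma dform_min_self_le (G : WeightedGraph Γ) (W : Finset Γ) (g : Γ → ℝ) (m : ℝ) :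
    G.dform W (fun x => min (g x) m) (fun x => min (g x) m) ≤ G.dform W g g := by
  refine G.dform_le_dform W fun a b _ => ?_
  rcases le_total (g a) m with h1 | h1 <;> rcases le_total (g b) m with h2 | h2 <;>
    simp only [h1, h2, min_eq_left, min_eq_right] <;> nlinarith

/-- A lower bound of the Green function on the inner ball bounds the capacity from above. -/
lemma IsGreen.mul_cap_le_one [Infinite Γ] {G : WeightedGraph Γ} (hf : G.FiniteNbrs) {x : Γ}
    {r R m : ℝ} (hr : 0 < r) (hrR : r ≤ R) {g : Γ → ℝ} (hg : G.IsGreen (G.ball x R) x g)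
    (hm : 0 < m) (h : ∀ y ∈ G.ball x r, m ≤ g y) : m * G.cap x r R ≤ 1 := by
  have hxR := G.mem_ball_self x (hr.trans_le hrR)
  obtain ⟨W, hW⟩ := hf.exists_window (hf.ball_finite x R)
  have h0 : ∀ a, a ∉ G.ball x R → min (g a) m = 0 := fun a ha => by
    rw [hg.eq_zero a ha, min_eq_left hm.le]
  -- The normalised truncation is admissible, and its energy is at most m⁻² E(g, min(g,m)) = m⁻² · m
  -- by the reproducing property.
  have h1 := cap_le hf hr hrR hW (f := fun y => m⁻¹ * min (g y) m)
    (fun a ha => by rw [min_eq_right (h a ha), inv_mul_cancel₀ hm.ne'])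
    (fun a ha => by rw [h0 a ha, mul_zero])
  rw [dform_smul_smul] at h1
  have h2 := G.dform_min_le W g m
  rw [hg.dform_eq hxR hW h0, min_eq_right (h x (G.mem_ball_self x hr))] at h2
  have h3 : G.cap x r R ≤ m⁻¹ * m⁻¹ * m :=
    h1.trans (mul_le_mul_of_nonneg_left h2 (by positivity))
  rw [mul_assoc, inv_mul_cancel₀ hm.ne', mul_one] at h3
  calc m * G.cap x r R ≤ m * m⁻¹ := mul_le_mul_of_nonneg_left h3 hm.le
    _ = 1 := mul_inv_cancel₀ hm.ne'

/-- An upper bound of the Green function near the boundary of the inner ball bounds the capacity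
from below. -/
lemma IsGreen.one_le_mul_cap [Infinite Γ] {G : WeightedGraph Γ} (hf : G.FiniteNbrs) {x : Γ}
    {r R M : ℝ} {n : ℕ} (hn : (n : ℝ) < r) (hrR : r ≤ R) {g : Γ → ℝ}
    (hg : G.IsGreen (G.ball x R) x g) (hM : 0 ≤ M)
    (h : ∀ y, G.graph.dist x y = n → g y ≤ M) : 1 ≤ M * G.cap x r R := by
  have hr : 0 < r := lt_of_le_of_lt n.cast_nonneg hn
  have hxR := G.mem_ball_self x (hr.trans_le hrR)
  have hD := hf.ball_finite x R
  obtain ⟨W, hW⟩ := hf.exists_window hD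
  obtain ⟨φ, hφ⟩ := exists_isCapacitor hf x hr hrR
  have h0 : ∀ a, a ∉ G.ball x R → min (g a) M = 0 := fun a ha => by
    rw [hg.eq_zero a ha, min_eq_left hM]
  have hout := hg.le_of_le_sphere hf hD hM h
  -- Edges within distance n see a constant φ; any other edge has both ends at distance at least n,
  -- where g ≤ M and the truncation does nothing.
  have e : G.dform W (fun y => min (g y) M) φ = G.dform W g φ := by
    refine G.dform_congr W fun a b hab => ?_
    by_cases hab' : G.graph.dist x a ≤ n ∧ G.graph.dist x b ≤ n
    · have : ∀ y, G.graph.dist x y ≤ n → φ y = 1 := fun y hy =>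
        hφ.eq_one y (lt_of_le_of_lt (Nat.cast_le.2 hy) hn)
      rw [this a hab'.1, this b hab'.2]
      ring
    · have h1 := G.dist_adj_le x hab
      have h2 := G.dist_adj_le x hab.symm
      rw [min_eq_left (hout a (by omega)), min_eq_left (hout b (by omega))]
  rw [hg.dform_eq hxR hW hφ.eq_zero, hφ.eq_one x (G.mem_ball_self x hr)] at e
  have cs := G.dform_cauchy_schwarz W (fun y => min (g y) M) φ
  rw [e, hφ.dform_eq W hW] at cs
  have h2 := G.dform_min_le W g M
  rw [hg.dform_eq hxR hW h0] at h2
  have h3 := h2.trans (min_le_right _ _)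
  have h4 := mul_le_mul_of_nonneg_right h3 (cap_pos hf x hr hrR).le
  linarith

/-! ### Harnack chains -/

/-- The elliptic Harnack inequality with constant `H`. -/
def HarnackWith (G : WeightedGraph Γ) (H : ℝ) : Prop :=
  1 < H ∧ ∀ (x : Γ) (R : ℝ), 0 < R → ∀ u : Γ → ℝ,
    (∀ y ∈ G.closedNhd (G.ball x (2 * R)), 0 ≤ u y) → G.HarmonicOn u (G.ball x (2 * R)) →
      ∀ y ∈ G.ball x R, ∀ z ∈ G.ball x R, u y ≤ H * u z

lemma chain_iterate {u : ℕ → ℝ} {A : ℝ} (hA : 1 ≤ A) {k n : ℕ}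
    (h : ∀ i j, i ≤ j → j ≤ i + k → j ≤ n → u i ≤ A * u j ∧ u j ≤ A * u i) :
    ∀ m j, j ≤ m * k → j ≤ n → u 0 ≤ A ^ m * u j ∧ u j ≤ A ^ m * u 0 := by
  have hA0 : 0 ≤ A := zero_le_one.trans hA
  intro m
  induction m with
  | zero =>
    intro j hj _
    have : j = 0 := by simpa using hj
    simp [this]
  | succ m ih =>
    intro j hj hjn
    obtain ⟨i, hij, hji, hi⟩ : ∃ i, i ≤ j ∧ j ≤ i + k ∧ i ≤ m * k := by
      rcases le_total j (m * k) with h1 | h1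
      · exact ⟨j, le_rfl, by omega, h1⟩
      · exact ⟨m * k, h1, by rw [Nat.succ_mul] at hj; exact hj, le_rfl⟩
    have h1 := ih i hi (hij.trans hjn)
    have h2 := h i j hij hji hjn
    have hp : 0 ≤ A ^ m := pow_nonneg hA0 m
    constructor
    · calc u 0 ≤ A ^ m * u i := h1.1
        _ ≤ A ^ m * (A * u j) := mul_le_mul_of_nonneg_left h2.1 hp
        _ = A ^ (m + 1) * u j := by ring
    · calc u j ≤ A * u i := h2.2
        _ ≤ A * (A ^ m * u 0) := mul_le_mul_of_nonneg_left h1.2 hA0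
        _ = A ^ (m + 1) * u 0 := by ring

lemma dist_path_le (G : WeightedGraph Γ) {q : ℕ → Γ} {n : ℕ}
    (hq : ∀ i, i < n → G.graph.Adj (q i) (q (i + 1))) (i j : ℕ) (hj : i + j ≤ n) :
    G.graph.dist (q i) (q (i + j)) ≤ j := by
  induction j with
  | zero => simp
  | succ j ih =>
    exact (G.dist_adj_le (q i) (hq (i + j) (by omega))).trans
      (Nat.add_le_add_right (ih (by omega)) 1)

/-- The constant depends on the ratio N of path length to radius and not on the scale. For r > 2
there is an integer step k with r/4 ≤ k < r/2, so at most 4N uses of Harnack with radius r/2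
suffice. For r ≤ 2 the path has at most 2N edges, each costing p⁻¹. -/
lemma harnack_chain [Nontrivial Γ] {G : WeightedGraph Γ} {p H : ℝ} (hp : G.LowerWeights p)
    (hH : G.HarnackWith H) (N : ℕ) :
    ∃ C : ℝ, 1 ≤ C ∧ ∀ r : ℝ, 0 < r → ∀ u : Γ → ℝ, (∀ a, 0 ≤ u a) → ∀ (n : ℕ) (q : ℕ → Γ),
      (n : ℝ) ≤ N * r → (∀ i, i < n → G.graph.Adj (q i) (q (i + 1))) →
      (∀ i, i ≤ n → G.HarmonicOn u (G.ball (q i) r)) →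
      u (q 0) ≤ C * u (q n) ∧ u (q n) ≤ C * u (q 0) := by
  have hpinv : 1 ≤ p⁻¹ := (one_le_inv₀ hp.1).2 hp.le_one
  have hC1 : 1 ≤ H ^ (4 * N) := one_le_pow₀ hH.1.le
  have hC2 : 1 ≤ p⁻¹ ^ (2 * N) := one_le_pow₀ hpinv
  refine ⟨max (H ^ (4 * N)) (p⁻¹ ^ (2 * N)), hC1.trans (le_max_left _ _), ?_⟩
  intro r hr u hu n q hn hadj hharm
  have conclude : ∀ K, K ≤ max (H ^ (4 * N)) (p⁻¹ ^ (2 * N)) →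
      (u (q 0) ≤ K * u (q n) ∧ u (q n) ≤ K * u (q 0)) →
      u (q 0) ≤ max (H ^ (4 * N)) (p⁻¹ ^ (2 * N)) * u (q n) ∧
        u (q n) ≤ max (H ^ (4 * N)) (p⁻¹ ^ (2 * N)) * u (q 0) := fun K hK h =>
    ⟨h.1.trans (mul_le_mul_of_nonneg_right hK (hu _)),
      h.2.trans (mul_le_mul_of_nonneg_right hK (hu _))⟩
  rcases le_or_gt r 2 with hr2 | hr2
  · refine conclude _ (le_max_right _ _) ?_
    have hharm' : ∀ i, i ≤ n → G.markovOp u (q i) ≤ u (q i) := fun i hi =>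
      (hharm i hi (q i) (G.mem_ball_self _ hr)).le
    refine chain_iterate (u := fun i => u (q i)) (k := 1) (n := n) hpinv ?_
      (2 * N) n ?_ le_rfl
    · intro i j hij hji hjn
      rcases hij.eq_or_lt with rfl | hlt
      · have := mul_le_mul_of_nonneg_right hpinv (hu (q i))
        constructor <;> linarith
      · have hj : j = i + 1 := by omega
        subst hj
        have h := hadj i (by omega)
        have h1 := hp.le_of_superharmonic (fun c _ => hu c) (hharm' i (by omega)) h
        have h2 := hp.le_of_superharmonic (fun c _ => hu c) (hharm' (i + 1) hjn) h.symm
        rw [inv_mul_eq_div, inv_mul_eq_div, le_div_iff₀ hp.1, le_div_iff₀ hp.1]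
        constructor <;> linarith
    · have : (n : ℝ) ≤ (2 * N * 1 : ℕ) := by
        push_cast
        have : (N : ℝ) * r ≤ N * 2 := mul_le_mul_of_nonneg_left hr2 N.cast_nonneg
        linarith
      exact_mod_cast this
  · refine conclude _ (le_max_left _ _) ?_
    obtain ⟨k, hk1, hk2⟩ : ∃ k : ℕ, (k : ℝ) < r / 2 ∧ r / 4 ≤ k := by
      have h1 : 1 < ⌈r / 2⌉₊ := Nat.lt_ceil.2 (by push_cast; linarith)
      have h2 := Nat.le_ceil (r / 2)
      have h3 := Nat.ceil_lt_add_one (a := r / 2) (by linarith)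
      refine ⟨⌈r / 2⌉₊ - 1, ?_, ?_⟩
      · rw [Nat.cast_sub h1.le]; push_cast; linarith
      · rcases le_total r 4 with h4 | h4
        · have : (1 : ℝ) ≤ ((⌈r / 2⌉₊ - 1 : ℕ) : ℝ) := by exact_mod_cast (by omega)
          linarith
        · rw [Nat.cast_sub h1.le]; push_cast; linarith
    refine chain_iterate (u := fun i => u (q i)) (k := k) (n := n) hH.1.le ?_
      (4 * N) n ?_ le_rfl
    · intro i j hij hji hjn
      obtain ⟨l, rfl⟩ := Nat.exists_eq_add_of_le hij
      have hd := G.dist_path_le hadj i l hjn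
      have hHi := hH.2 (q i) (r / 2) (by linarith) u (fun y _ => hu y)
        (by rw [mul_div_cancel₀ r two_ne_zero]; exact hharm i (hij.trans hjn))
      have hmi : q i ∈ G.ball (q i) (r / 2) := G.mem_ball_self _ (by linarith)
      have hmj : q (i + l) ∈ G.ball (q i) (r / 2) := by
        rw [mem_ball]
        have : (G.graph.dist (q i) (q (i + l)) : ℝ) ≤ k := by exact_mod_cast (by omega)
        linarith
      exact ⟨hHi _ hmi _ hmj, hHi _ hmj _ hmi⟩
    · have : (n : ℝ) ≤ (4 * N * k : ℕ) := by
        push_cast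
        have : (N : ℝ) * (r / 4) ≤ N * k := mul_le_mul_of_nonneg_left hk2 N.cast_nonneg
        linarith
      exact_mod_cast this

/-! ### Green functions under the Harnack inequality -/

/-- The Green function is comparable at points of the same distance from the pole. -/
lemma IsGreen.sphere_le [Infinite Γ] {G : WeightedGraph Γ} {p H : ℝ} (hp : G.LowerWeights p)
    (hH : G.HarnackWith H) :
    ∃ C : ℝ, 1 ≤ C ∧ ∀ (D : Set Γ), D.Finite → ∀ (x₀ : Γ) (n : ℕ),
      (∀ y, (G.graph.dist x₀ y : ℝ) ≤ 3 * n / 2 → y ∈ D) → ∀ g, G.IsGreen D x₀ g →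
      ∀ x y, G.graph.dist x₀ x = n → G.graph.dist x₀ y = n → g x ≤ C * g y := by
  have hf := hp.finiteNbrs
  obtain ⟨C, hC1, hC⟩ := harnack_chain hp hH 8
  refine ⟨C * C, by nlinarith, ?_⟩
  intro D hD x₀ n hnD g hg x y hx hy
  have hgnn := fun a => hg.nonneg hf hD a
  rcases Nat.eq_zero_or_pos n with rfl | hn
  · rw [G.connected.dist_eq_zero_iff] at hx hy
    rw [← hx, ← hy]
    exact le_mul_of_one_le_left (hgnn x₀) (one_le_mul_of_one_le_of_one_le hC1 hC1)
  have hnR : (0 : ℝ) < n := Nat.cast_pos.2 hn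
  have hnD' : ∀ y, G.graph.dist x₀ y ≤ n → y ∈ D := fun y hy => hnD y (by
    have : (G.graph.dist x₀ y : ℝ) ≤ n := by exact_mod_cast hy
    linarith)
  have hx₀D : x₀ ∈ D := hnD' x₀ (by simp)
  have hxD : x ∈ D := hnD' x hx.le
  have hyD : y ∈ D := hnD' y hy.le
  -- Close points are joined by a geodesic that stays clear of the pole. For distant points pole and
  -- argument are exchanged: g(x) = gx(x₀) ≤ C gx(y) = C gy(x) ≤ C² gy(x₀) = C² g(y). The chains run
  -- along geodesics from x₀, and radius n/8 keeps them off the new pole, which is at distance at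
  -- least n/4 from their endpoint.
  rcases lt_or_ge (G.graph.dist x y : ℝ) (n / 4) with hxy | hxy
  · obtain ⟨q, hq0, hqn, hadj, hd1, hd2⟩ := G.exists_geodesic x y
    have := (hC (n / 4) (by positivity) g hgnn (G.graph.dist x y) q (by push_cast; linarith)
      hadj ?_).1
    · rw [hq0, hqn] at this
      have h1 := le_mul_of_one_le_left (mul_nonneg (by linarith : 0 ≤ C) (hgnn y)) hC1
      linarith
    · intro i hi a ha
      rw [mem_ball] at ha
      have hiR : (i : ℝ) ≤ G.graph.dist x y := by exact_mod_cast hi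
      have h1 : (G.graph.dist x (q i) : ℝ) = i := by exact_mod_cast hd1 i hi
      have h2 := G.dist_triR x₀ x (q i)
      have h3 := G.dist_triR x₀ (q i) a
      have h4 : (G.graph.dist x₀ x : ℝ) = n := by exact_mod_cast hx
      refine hg.harm a (hnD a (by linarith)) ?_
      rintro rfl
      have h5 := G.dist_triR x (q i) a
      rw [SimpleGraph.dist_comm (v := a)] at h5
      linarith
  · obtain ⟨gx, hgx⟩ := hf.exists_isGreen hD hxD
    obtain ⟨gy, hgy⟩ := hf.exists_isGreen hD hyD
    have main : ∀ x y, G.graph.dist x₀ x = n → G.graph.dist x₀ y = n →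
        (n / 4 : ℝ) ≤ G.graph.dist x y → ∀ h, G.IsGreen D x h →
        h x₀ ≤ C * h y ∧ h y ≤ C * h x₀ := by
      intro x y hx hy hxy h hh
      obtain ⟨q, hq0, hqn, hadj, hd1, hd2⟩ := G.exists_geodesic x₀ y
      rw [hy] at hqn hadj hd1 hd2
      have := hC (n / 8) (by positivity) h (fun a => hh.nonneg hf hD a) n q
        (by push_cast; linarith) hadj ?_
      · rwa [hq0, hqn] at this
      · intro i hi a ha
        rw [mem_ball] at ha
        have hiR : (i : ℝ) ≤ n := by exact_mod_cast hi
        have h1 : (G.graph.dist x₀ (q i) : ℝ) = i := by exact_mod_cast hd1 i hi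
        have h2 : (G.graph.dist (q i) y : ℝ) + i = n := by exact_mod_cast hd2 i hi
        have h3 := G.dist_triR x₀ (q i) a
        have h4 : (G.graph.dist x₀ x : ℝ) = n := by exact_mod_cast hx
        refine hh.harm a (hnD a (by linarith)) ?_
        rintro rfl
        have h5 := G.dist_triR a (q i) y
        have ha' := ha
        rw [SimpleGraph.dist_comm] at ha'
        linarith
    have e1 := hg.symm hf hD hx₀D hxD hgx
    have e2 := hg.symm hf hD hx₀D hyD hgy
    have e3 := hgx.symm hf hD hxD hyD hgy
    have h1 := (main x y hx hy hxy gx hgx).1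
    have h2 := (main y x hy hx (by rwa [SimpleGraph.dist_comm]) gy hgy).2
    rw [e1, e2]
    calc gx x₀ ≤ C * gx y := h1
      _ = C * gy x := by rw [e3]
      _ ≤ C * (C * gy x₀) := mul_le_mul_of_nonneg_left h2 (by linarith)
      _ = C * C * gy x₀ := by ring

lemma IsGreen.sphere_le_inner [Infinite Γ] {G : WeightedGraph Γ} {p H : ℝ}
    (hp : G.LowerWeights p) (hH : G.HarnackWith H) :
    ∃ C : ℝ, 1 ≤ C ∧ ∀ (D : Set Γ), D.Finite → ∀ (x : Γ) (n : ℕ),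
      (∀ y, (G.graph.dist x y : ℝ) ≤ 3 * n / 2 → y ∈ D) → ∀ g, G.IsGreen D x g →
      ∀ z y, G.graph.dist x z = n → G.graph.dist x y ≤ n → g z ≤ C * g y := by
  have hf := hp.finiteNbrs
  obtain ⟨C, hC1, hC⟩ := IsGreen.sphere_le hp hH
  have hC0 : 0 < C := by linarith
  refine ⟨C, hC1, fun D hD x n hnD g hg z y hz hy => ?_⟩
  have := hg.ge_of_ge_sphere hf hD (n := n) (m := g z / C) (fun y hy => hnD y ?_) (fun y hy => ?_)
    y hy
  · rwa [div_le_iff₀' hC0] at this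
  · have : (G.graph.dist x y : ℝ) ≤ n := by exact_mod_cast hy
    have : (0 : ℝ) ≤ n := n.cast_nonneg
    linarith
  · rw [div_le_iff₀' hC0]
    exact hC D hD x n hnD g hg z y hz hy

/-- This n is the largest integer radius whose closed ball lies in the open ball of radius R. -/
lemma exists_nat_lt_le {R : ℝ} (hR : 0 < R) : ∃ n : ℕ, (n : ℝ) < R ∧ R ≤ n + 1 := by
  have h1 : 0 < ⌈R⌉₊ := Nat.ceil_pos.2 hR
  have h2 := Nat.ceil_lt_add_one hR.le
  have h3 := Nat.le_ceil R
  refine ⟨⌈R⌉₊ - 1, ?_, ?_⟩ <;> · rw [Nat.cast_sub h1]; push_cast; linarith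

/-- Inside the sphere of radius n this is `IsGreen.sphere_le_inner`. Beyond it, a chain of balls of
radius n follows the geodesic outwards; being open, they miss the pole. If n = 0 there is only one
edge to cross, which accounts for the factor p⁻¹. -/
lemma IsGreen.sphere_le_double [Infinite Γ] {G : WeightedGraph Γ} {p H : ℝ}
    (hp : G.LowerWeights p) (hH : G.HarnackWith H) :
    ∃ C : ℝ, 1 ≤ C ∧ ∀ (x : Γ) (R : ℝ) (n : ℕ), (n : ℝ) < R → R ≤ n + 1 →
      ∀ g, G.IsGreen (G.ball x (4 * R)) x g →
      ∀ z y, G.graph.dist x z = n → y ∈ G.ball x (2 * R) → g z ≤ C * g y := by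
  have hf := hp.finiteNbrs
  obtain ⟨C₁, hC₁, h₁⟩ := IsGreen.sphere_le_inner hp hH
  obtain ⟨C₂, hC₂, h₂⟩ := harnack_chain hp hH 4
  have hpinv : 1 ≤ p⁻¹ := (one_le_inv₀ hp.1).2 hp.le_one
  refine ⟨C₁ * C₂ * p⁻¹, ?_, ?_⟩
  · exact one_le_mul_of_one_le_of_one_le (one_le_mul_of_one_le_of_one_le hC₁ hC₂) hpinv
  intro x R n hnR hRn g hg z y hz hy
  have hn0 : (0 : ℝ) ≤ n := n.cast_nonneg
  have hD := hf.ball_finite x (4 * R)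
  have hgnn := fun a => hg.nonneg hf hD a
  have hinner := h₁ _ hD x n (fun y hy => by rw [mem_ball]; linarith) g hg
  rw [mem_ball] at hy
  suffices ∃ w, G.graph.dist x w ≤ n ∧ g w ≤ C₂ * p⁻¹ * g y by
    obtain ⟨w, hw, hwy⟩ := this
    calc g z ≤ C₁ * g w := hinner z w hz hw
      _ ≤ C₁ * (C₂ * p⁻¹ * g y) := mul_le_mul_of_nonneg_left hwy (by linarith)
      _ = _ := by ring
  have hCp : 1 ≤ C₂ * p⁻¹ := one_le_mul_of_one_le_of_one_le hC₂ hpinv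
  rcases le_or_gt (G.graph.dist x y) n with hyn | hyn
  · refine ⟨y, hyn, ?_⟩
    have := hgnn y
    nlinarith
  rcases Nat.eq_zero_or_pos n with rfl | hn
  · refine ⟨x, by simp, ?_⟩
    have h1 : G.graph.dist x y = 1 := by
      have : (G.graph.dist x y : ℝ) < (2 : ℕ) := by push_cast at hRn ⊢; linarith
      have := Nat.cast_lt.1 this
      omega
    have h2 := hp.le_of_superharmonic (fun c _ => hgnn c)
      (hg.superharmonic y (by rw [mem_ball]; linarith)) (SimpleGraph.dist_eq_one_iff_adj.1 h1).symm
    have h3 : g x ≤ p⁻¹ * g y := by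
      rw [inv_mul_eq_div, le_div_iff₀ hp.1]; linarith
    have h4 := hgnn y
    have h5 : p⁻¹ * g y ≤ C₂ * (p⁻¹ * g y) :=
      le_mul_of_one_le_left (mul_nonneg (by linarith) h4) hC₂
    linarith
  · have hnR' : (1 : ℝ) ≤ n := by exact_mod_cast hn
    obtain ⟨q, hq0, hqn, hadj, hd1, hd2⟩ := G.exists_geodesic x y
    refine ⟨q n, (hd1 n hyn.le).le, ?_⟩
    have h := (h₂ n (by linarith) g hgnn (G.graph.dist x y - n) (fun i => q (n + i)) ?_ ?_ ?_).1
    · simp only [add_zero, Nat.add_sub_cancel' hyn.le, hqn] at h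
      have h4 := hgnn y
      have h5 : C₂ * g y ≤ C₂ * g y * p⁻¹ :=
        le_mul_of_one_le_right (mul_nonneg (by linarith) h4) hpinv
      linarith
    · rw [Nat.cast_sub hyn.le]
      push_cast
      linarith
    · intro i hi
      exact hadj (n + i) (by omega)
    · intro i hi a ha
      rw [mem_ball] at ha
      have h1 : (G.graph.dist x (q (n + i)) : ℝ) = n + i := by
        exact_mod_cast hd1 (n + i) (by omega)
      have h2 := G.dist_triR x (q (n + i)) a
      have h3 : ((n + i : ℕ) : ℝ) ≤ G.graph.dist x y := by exact_mod_cast (by omega)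
      push_cast at h3
      refine hg.harm a (by rw [mem_ball]; linarith) ?_
      rintro rfl
      rw [SimpleGraph.dist_comm] at ha
      have : (0 : ℝ) ≤ i := i.cast_nonneg
      linarith

lemma FiniteNbrs.exists_max_sphere [Infinite Γ] {G : WeightedGraph Γ} (hf : G.FiniteNbrs)
    (x : Γ) (n : ℕ) (g : Γ → ℝ) :
    ∃ z, G.graph.dist x z = n ∧ ∀ y, G.graph.dist x y = n → g y ≤ g z := by
  have hfin : {y | G.graph.dist x y = n}.Finite := by
    refine (hf.ball_finite x (n + 1)).subset fun y (hy : G.graph.dist x y = n) => ?_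
    rw [mem_ball, hy]
    linarith
  obtain ⟨z, hz, hmax⟩ := hfin.exists_maximalFor g _ (hf.exists_dist_eq x n)
  exact ⟨z, hz, fun y hy => (le_total (g y) (g z)).elim id fun h => hmax hy h⟩

/-- Existence of a doubling constant for the outer resistances, in terms of capacities. -/
lemma cap_outer_le [Infinite Γ] {G : WeightedGraph Γ} {p H : ℝ} (hp : G.LowerWeights p)
    (hH : G.HarnackWith H) :
    ∃ C : ℝ, 1 ≤ C ∧ ∀ (x : Γ) (R : ℝ), 0 < R →
      G.cap x (2 * R) (4 * R) ≤ C * G.cap x R (4 * R) := by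
  have hf := hp.finiteNbrs
  obtain ⟨C, hC1, hC⟩ := IsGreen.sphere_le_double hp hH
  have hC0 : 0 < C := by linarith
  refine ⟨C, hC1, fun x R hR => ?_⟩
  obtain ⟨n, hn1, hn2⟩ := exists_nat_lt_le hR
  have hD := hf.ball_finite x (4 * R)
  obtain ⟨g, hg⟩ := hf.exists_isGreen hD (G.mem_ball_self x (by linarith))
  obtain ⟨z, hz, hmax⟩ := hf.exists_max_sphere x n g
  have hz0 := hg.nonneg hf hD z
  have h1 := hg.one_le_mul_cap hf hn1 (by linarith) hz0 hmax
  have hzpos : 0 < g z := by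
    refine hz0.lt_of_ne fun h => ?_
    rw [← h] at h1
    norm_num at h1
  have h2 := hg.mul_cap_le_one hf (r := 2 * R) (by linarith) (by linarith)
    (div_pos hzpos hC0) fun y hy => by
      rw [div_le_iff₀' hC0]
      exact hC x R n hn1 hn2 g hg z y hz hy
  rw [div_mul_eq_mul_div, div_le_one hC0] at h2
  refine le_of_mul_le_mul_left ?_ hzpos
  calc g z * G.cap x (2 * R) (4 * R) ≤ C * 1 := by linarith
    _ ≤ C * (g z * G.cap x R (4 * R)) := mul_le_mul_of_nonneg_left h1 hC0.le
    _ = _ := by ring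

/-- A superharmonic function that is large on a ball is large on the ball of twice the radius. -/
lemma superharmonic_double [Infinite Γ] {G : WeightedGraph Γ} {p H : ℝ}
    (hp : G.LowerWeights p) (hH : G.HarnackWith H) :
    ∃ c : ℝ, 0 < c ∧ c ≤ 1 / 2 ∧ ∀ (ξ : Γ) (r : ℝ), 0 < r → ∀ (h : Γ → ℝ) (t : ℝ), 0 ≤ t →
      (∀ a, (G.graph.dist ξ a : ℝ) < 4 * r + 1 → 0 ≤ h a) →
      (∀ a ∈ G.ball ξ (4 * r), G.markovOp h a ≤ h a) →
      (∀ a ∈ G.ball ξ r, t ≤ h a) → ∀ a ∈ G.ball ξ (2 * r), c * t ≤ h a := by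
  have hf := hp.finiteNbrs
  obtain ⟨C, hC1, hC⟩ := IsGreen.sphere_le_double hp hH
  have hC0 : 0 < C := by linarith
  -- The factor 2 only secures c ≤ 1/2, so that 1 - c is a positive contraction factor later.
  refine ⟨(2 * C)⁻¹, by positivity, ?_, ?_⟩
  · rw [one_div]
    exact inv_anti₀ two_pos (by linarith)
  intro ξ r hr h t ht hnn hsup hball a ha
  have hct : (2 * C)⁻¹ * t ≤ C⁻¹ * t :=
    mul_le_mul_of_nonneg_right (inv_anti₀ hC0 (by linarith)) ht
  refine hct.trans ?_
  obtain ⟨n, hn1, hn2⟩ := exists_nat_lt_le hr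
  have hD := hf.ball_finite ξ (4 * r)
  obtain ⟨g, hg⟩ := hf.exists_isGreen hD (G.mem_ball_self ξ (by linarith))
  obtain ⟨z, hz, hmax⟩ := hf.exists_max_sphere ξ n g
  have hz0 := hg.nonneg hf hD z
  have h1 := hg.one_le_mul_cap hf hn1 (by linarith) hz0 hmax
  have hzpos : 0 < g z := by
    refine hz0.lt_of_ne fun h => ?_
    rw [← h] at h1
    norm_num at h1
  rcases le_or_gt (G.graph.dist ξ a) n with han | han
  · have : (G.graph.dist ξ a : ℝ) ≤ n := by exact_mod_cast han
    have h2 := hball a (by rw [mem_ball]; linarith)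
    have h3 : C⁻¹ * t ≤ t := mul_le_of_le_one_left ht (inv_le_one_of_one_le₀ hC1)
    linarith
  have hsub := G.ball_subset_ball ξ (show 2 * r ≤ 4 * r by linarith)
  -- Comparison of h with t g / g(z) beyond the sphere of radius n: on the sphere the latter is at
  -- most t ≤ h, and outside the large ball it vanishes.
  have key := hf.min_principle (D := {b ∈ G.ball ξ (4 * r) | n < G.graph.dist ξ b})
    (hD.subset fun y hy => hy.1) (v := fun y => 1 * h y + (-(t / g z)) * g y) ?_ ?_ a
    ⟨hsub ha, han⟩
  · have h2 := hC ξ r n hn1 hn2 g hg z a hz ha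
    have h3 : C⁻¹ * t ≤ t / g z * g a := by
      rw [div_mul_eq_mul_div, le_div_iff₀ hzpos, inv_mul_eq_div, div_mul_eq_mul_div,
        div_le_iff₀ hC0]
      nlinarith
    linarith
  · rintro b ⟨hb, hbn⟩
    rw [markovOp_lin hf, hg.harm b hb (by rintro rfl; simp at hbn)]
    linarith [hsup b hb]
  · rintro b (hb | ⟨b', ⟨hb', hb'n⟩, hbb'⟩) hb''
    · exact absurd hb hb''
    · have h2 := G.dist_adj_leR ξ hbb'
      have h3 := hnn b (by rw [mem_ball] at hb'; linarith)
      by_cases hbD : b ∈ G.ball ξ (4 * r)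
      · have h4 : ¬ n < G.graph.dist ξ b := fun hh => hb'' ⟨hbD, hh⟩
        have h5 := G.dist_adj_le ξ hbb'.symm
        have h6 : G.graph.dist ξ b = n := by omega
        have h7 := hball b (by rw [mem_ball, h6]; exact hn1)
        have h8 : t / g z * g b ≤ t := by
          rw [div_mul_eq_mul_div, div_le_iff₀ hzpos]
          exact mul_le_mul_of_nonneg_left (hmax b h6) ht
        linarith
      · rw [hg.eq_zero b hbD]
        linarith

/-! ### Resistance conditions in terms of capacities -/

lemma outerResistanceBound_iff [Infinite Γ] {G : WeightedGraph Γ} (hf : G.FiniteNbrs) {C : ℝ}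
    (hC : 0 < C) : G.OuterResistanceBound C ↔
      ∀ (x : Γ) (R : ℝ), 0 < R → G.cap x (2 * R) (4 * R) ≤ C * G.cap x R (4 * R) := by
  refine forall_congr' fun x => forall_congr' fun R => forall_congr' fun hR => ?_
  have h1 := cap_pos hf x hR (by linarith : R ≤ 4 * R)
  have h2 := cap_pos hf x (by linarith : 0 < 2 * R) (by linarith : 2 * R ≤ 4 * R)
  rw [rho_eq hf x hR (by linarith), rho_eq hf x (by linarith : 0 < 2 * R) (by linarith),
    ← ENNReal.ofReal_mul hC.le, ENNReal.ofReal_le_ofReal_iff (by positivity),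
    inv_le_iff_one_le_mul₀ h1, mul_assoc, inv_mul_eq_div, mul_div_assoc', le_div_iff₀ h2, one_mul]

lemma innerResistanceBound_iff [Infinite Γ] {G : WeightedGraph Γ} (hf : G.FiniteNbrs) {C : ℝ}
    (hC : 0 < C) : G.InnerResistanceBound C ↔
      ∀ (x : Γ) (R : ℝ), 0 < R → G.cap x R (2 * R) ≤ C * G.cap x R (4 * R) := by
  refine forall_congr' fun x => forall_congr' fun R => forall_congr' fun hR => ?_
  have h1 := cap_pos hf x hR (by linarith : R ≤ 4 * R)
  have h2 := cap_pos hf x hR (by linarith : R ≤ 2 * R)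
  rw [rho_eq hf x hR (by linarith), rho_eq hf x hR (by linarith),
    ← ENNReal.ofReal_mul hC.le, ENNReal.ofReal_le_ofReal_iff (by positivity),
    inv_le_iff_one_le_mul₀ h1, mul_assoc, inv_mul_eq_div, mul_div_assoc', le_div_iff₀ h2, one_mul]

lemma closedNhd_mono (G : WeightedGraph Γ) {A B : Set Γ} (h : A ⊆ B) :
    G.closedNhd A ⊆ G.closedNhd B := by
  rintro y (hy | ⟨x, hx, hy⟩)
  exacts [Or.inl (h hy), Or.inr ⟨x, h hx, hy⟩]

/-! ### Almost additivity of resistances -/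

/-- Each scale gains a factor 1 - c. Let ζ lie at distance 6^j from w on the way to x; then φ = 1 on
B(ζ, 6^j), and `superharmonic_double`, applied to φ - (1 - S) around ζ, improves the bound on B(w,
6^j). The base 6 leaves room for the ball of radius 4·6^j about ζ and its neighbours. -/
lemma IsCapacitor.decay [Infinite Γ] {G : WeightedGraph Γ} {p H : ℝ} (hp : G.LowerWeights p)
    (hH : G.HarnackWith H) :
    ∃ c : ℝ, 0 < c ∧ c ≤ 1 / 2 ∧ ∀ (x : Γ) (R : ℝ), 1 ≤ R → ∀ φ, G.IsCapacitor x (2 * R) (4 * R) φ →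
      ∀ (n : ℕ) (w : Γ), (n : ℝ) < 2 * R → 2 * R ≤ n + 1 → G.graph.dist x w = n + 1 →
      ∀ (j : ℕ) (S : ℝ), 0 ≤ S → (6 : ℝ) ^ j ≤ R / 3 →
        (∀ q ∈ G.ball w (6 ^ j), 1 - φ q ≤ S) → 1 - φ w ≤ (1 - c) ^ j * S := by
  have hf := hp.finiteNbrs
  obtain ⟨c, hc0, hc2, hc⟩ := superharmonic_double hp hH
  refine ⟨c, hc0, hc2, fun x R hR φ hφ n w hn1 hn2 hw j => ?_⟩
  induction j with
  | zero =>
    intro S _ _ h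
    simpa using h w (G.mem_ball_self w (by simp))
  | succ j ih =>
    intro S hS hj h
    have hk1 : (1 : ℝ) ≤ 6 ^ j := one_le_pow₀ (by norm_num)
    rw [pow_succ] at hj
    have := ih ((1 - c) * S) (mul_nonneg (by linarith) hS) (by linarith) ?_
    · rw [pow_succ, mul_assoc]; exact this
    intro q hq
    rw [mem_ball] at hq
    obtain ⟨P, hP0, hPn, hadj, hd1, hd2⟩ := G.exists_geodesic w x
    rw [SimpleGraph.dist_comm, hw] at hd1 hd2
    have hkn : 6 ^ j ≤ n + 1 := by
      have : ((6 ^ j : ℕ) : ℝ) ≤ ((n + 1 : ℕ) : ℝ) := by push_cast; linarith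
      exact_mod_cast this
    set ζ := P (6 ^ j) with hζ
    have hwζ : (G.graph.dist w ζ : ℝ) = 6 ^ j := by exact_mod_cast hd1 _ hkn
    have hxζ : (G.graph.dist x ζ : ℝ) + 6 ^ j = n + 1 := by
      rw [SimpleGraph.dist_comm]
      exact_mod_cast hd2 _ hkn
    have key := hc ζ (6 ^ j) (by positivity) (fun y => 1 * φ y + (-(1 - S)) * 1) S hS ?_ ?_ ?_ q ?_
    · linarith
    · intro a ha
      have h1 := G.dist_triR w ζ a
      have := h a (by rw [mem_ball, pow_succ]; linarith)
      linarith
    · intro a ha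
      rw [mem_ball] at ha
      have h1 := G.dist_triR x ζ a
      rw [markovOp_lin hf (1 : ℝ) (-(1 - S)) φ (fun _ => 1), markovOp_const hf]
      linarith [hφ.superharmonic a (by rw [mem_ball]; linarith)]
    · intro a ha
      rw [mem_ball] at ha
      have h1 := G.dist_triR x ζ a
      have h2 : G.graph.dist x a < n + 1 := by
        have : (G.graph.dist x a : ℝ) < ((n + 1 : ℕ) : ℝ) := by push_cast; linarith
        exact_mod_cast this
      have h3 : (G.graph.dist x a : ℝ) ≤ n := by exact_mod_cast Nat.lt_succ_iff.1 h2
      rw [hφ.eq_one a (by rw [mem_ball]; linarith)]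
      linarith
    · have h1 := G.dist_triR ζ w q
      rw [SimpleGraph.dist_comm (u := ζ) (v := w)] at h1
      rw [mem_ball]
      linarith

/-- About log₆ R rounds of `IsCapacitor.decay` give 1 - φ(w) = O(R^(-β)). Since φ(w) ≥ p, the
inequality log φ ≥ 1 - 1/φ puts this in exponential form. -/
lemma IsCapacitor.le_near [Infinite Γ] {G : WeightedGraph Γ} {p H : ℝ} (hp : G.LowerWeights p)
    (hH : G.HarnackWith H) :
    ∃ K β : ℝ, 0 < K ∧ 0 < β ∧ ∀ (x : Γ) (R : ℝ), 1 ≤ R →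
      ∀ φ, G.IsCapacitor x (2 * R) (4 * R) φ →
      ∀ (n : ℕ) (w : Γ), (n : ℝ) < 2 * R → 2 * R ≤ n + 1 → G.graph.dist x w = n + 1 →
        Real.exp (-(K * R ^ (-β))) ≤ φ w := by
  obtain ⟨c, hc0, hc2, hc⟩ := IsCapacitor.decay hp hH
  have hθ0 : 0 < 1 - c := by linarith
  set β := -Real.logb 6 (1 - c) with hβ
  have hβ0 : 0 < β := by
    have := Real.logb_neg (b := 6) (by norm_num) hθ0 (by linarith)
    linarith
  have h6 : (6 : ℝ) ^ (-β) = 1 - c := by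
    rw [hβ, neg_neg, Real.rpow_logb (by norm_num) (by norm_num) hθ0]
  set C := (1 - c)⁻¹ * 3 ^ β with hC
  have hC0 : 0 < C := by positivity
  refine ⟨C / p, β, div_pos hC0 hp.1, hβ0, fun x R hR φ hφ n w hn1 hn2 hw => ?_⟩
  have hR0 : 0 < R := by linarith
  have hwR : w ∈ G.ball x (4 * R) := by
    rw [mem_ball, hw]; push_cast; linarith
  have hpw : p ≤ φ w := by
    obtain ⟨P, hP0, hPn, hadj, hd1, hd2⟩ := G.exists_geodesic x w
    rw [hw] at hPn hadj hd1
    have h1 := hadj n (by omega)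
    rw [hPn] at h1
    have h2 : φ (P n) = 1 := hφ.eq_one _ (by rw [mem_ball, hd1 n (by omega)]; exact hn1)
    have h3 := hp.le_of_superharmonic (fun c _ => hφ.nonneg c) (hφ.superharmonic w hwR) h1.symm
    rwa [h2, mul_one] at h3
  have hsmall : 1 - φ w ≤ C * R ^ (-β) := by
    have e1 : C * R ^ (-β) = (1 - c)⁻¹ * (R / 3) ^ (-β) := by
      rw [hC, Real.div_rpow hR0.le (by norm_num), div_eq_mul_inv,
        ← Real.rpow_neg (by norm_num : (0 : ℝ) ≤ 3), neg_neg]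
      ring
    rw [e1]
    have hinv : 1 ≤ (1 - c)⁻¹ := (one_le_inv₀ hθ0).2 (by linarith)
    rcases lt_or_ge R 3 with h3 | h3
    · have h4 : 1 ≤ (R / 3) ^ (-β) :=
        Real.one_le_rpow_of_pos_of_le_one_of_nonpos (by linarith) (by linarith) (by linarith)
      have := hφ.nonneg w
      nlinarith
    · obtain ⟨J, hJ1, hJ2⟩ := exists_nat_pow_near (show 1 ≤ R / 3 by linarith)
        (show (1 : ℝ) < 6 by norm_num)
      have h4 := hc x R hR φ hφ n w hn1 hn2 hw J 1 zero_le_one hJ1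
        fun q _ => by linarith [hφ.nonneg q]
      rw [mul_one] at h4
      refine h4.trans ?_
      have h5 : (1 - c) ^ (J + 1) ≤ (R / 3) ^ (-β) := by
        rw [← h6, ← Real.rpow_natCast, ← Real.rpow_mul (by norm_num), mul_comm,
          Real.rpow_mul (by norm_num), Real.rpow_natCast]
        exact Real.rpow_le_rpow_of_nonpos (by linarith) hJ2.le (by linarith)
      rw [inv_mul_eq_div, le_div_iff₀ hθ0, ← pow_succ]
      exact h5
  have hφ0 : 0 < φ w := hp.1.trans_le hpw
  rw [← Real.le_log_iff_exp_le hφ0]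
  have h1 := Real.one_sub_inv_le_log_of_pos hφ0
  have h2 : (φ w)⁻¹ - 1 ≤ C / p * R ^ (-β) := by
    have : (φ w)⁻¹ - 1 = (1 - φ w) / φ w := by field_simp
    rw [this, div_mul_eq_mul_div]
    exact div_le_div₀ (by positivity) hsmall hp.1 hpw
  linarith

/-- Resistances of consecutive annuli are almost superadditive. -/
lemma cap_series [Infinite Γ] {G : WeightedGraph Γ} {p H : ℝ} (hp : G.LowerWeights p)
    (hH : G.HarnackWith H) :
    ∃ K β : ℝ, 0 < K ∧ 0 < β ∧ ∀ (x : Γ) (R : ℝ), 1 ≤ R →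
      (G.cap x R (2 * R))⁻¹ + Real.exp (-(K * R ^ (-β))) * (G.cap x (2 * R) (4 * R))⁻¹ ≤
        (G.cap x R (4 * R))⁻¹ := by
  have hf := hp.finiteNbrs
  obtain ⟨K, β, hK, hβ, hnear⟩ := IsCapacitor.le_near hp hH
  refine ⟨2 * K, β, by positivity, hβ, fun x R hR => ?_⟩
  have hR0 : 0 < R := by linarith
  obtain ⟨n, hn1, hn2⟩ := exists_nat_lt_le (show 0 < 2 * R by linarith)
  obtain ⟨f₁, h₁⟩ := exists_isCapacitor hf x hR0 (show R ≤ 2 * R by linarith)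
  obtain ⟨φ, hφ⟩ := exists_isCapacitor hf x (show 0 < 2 * R by linarith)
    (show 2 * R ≤ 4 * R by linarith)
  set m := Real.exp (-(K * R ^ (-β))) with hm
  have hm0 : 0 < m := Real.exp_pos _
  have hm1 : m ≤ 1 := Real.exp_le_one_iff.2 (by
    have : 0 ≤ K * R ^ (-β) := by positivity
    linarith)
  obtain ⟨W, hW⟩ := hf.exists_window (hf.ball_finite x (4 * R))
  have hW2 : G.closedNhd (G.ball x (2 * R)) ⊆ W :=
    (G.closedNhd_mono (G.ball_subset_ball x (by linarith))).trans hW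
  -- Truncation at m makes f₂ equal to 1 up to distance n + 1, so no edge carries a gradient of both
  -- f₁ and f₂ and the cross term vanishes. The energy grows by at most m⁻², which is why K is
  -- doubled.
  set f₂ : Γ → ℝ := fun y => m⁻¹ * min (φ y) m with hf₂
  have hφn : ∀ y, G.graph.dist x y ≤ n → φ y = 1 := fun y hy => hφ.eq_one y (by
    have : (G.graph.dist x y : ℝ) ≤ n := by exact_mod_cast hy
    rw [mem_ball]; linarith)
  have hf₂one : ∀ y, G.graph.dist x y ≤ n + 1 → f₂ y = 1 := by
    intro y hy
    have : m ≤ φ y := by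
      rcases Nat.lt_or_ge n (G.graph.dist x y) with h | h
      · exact hnear x R hR φ hφ n y hn1 hn2 (by omega)
      · rw [hφn y h]; exact hm1
    simp only [hf₂, min_eq_right this, inv_mul_cancel₀ hm0.ne']
  have hf₂zero : ∀ y, y ∉ G.ball x (4 * R) → f₂ y = 0 := by
    intro y hy
    simp only [hf₂, hφ.eq_zero y hy, min_eq_left hm0.le, mul_zero]
  have hf₁zero : ∀ y, n < G.graph.dist x y → f₁ y = 0 := fun y hy => h₁.eq_zero y (by
    have : (n : ℝ) + 1 ≤ G.graph.dist x y := by exact_mod_cast hy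
    rw [mem_ball]; linarith)
  set E₁ := G.cap x R (2 * R) with hE₁
  set E₂ := G.dform W f₂ f₂ with hE₂
  have hE₁0 : 0 < E₁ := cap_pos hf x hR0 (by linarith)
  have hcap2 : 0 < G.cap x (2 * R) (4 * R) := cap_pos hf x (by linarith) (by linarith)
  have hcap3 : 0 < G.cap x R (4 * R) := cap_pos hf x hR0 (by linarith)
  have hsub : ∀ y ∈ G.ball x (2 * R), G.graph.dist x y ≤ n := by
    intro y hy
    rw [mem_ball] at hy
    have : (G.graph.dist x y : ℝ) < ((n + 1 : ℕ) : ℝ) := by push_cast; linarith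
    exact Nat.lt_succ_iff.1 (by exact_mod_cast this)
  have hE₂0 : 0 < E₂ := hcap2.trans_le (cap_le hf (by linarith) (by linarith) hW
    (fun y hy => hf₂one y ((hsub y hy).trans (Nat.le_succ n))) hf₂zero)
  have hE₂le : E₂ ≤ m⁻¹ * m⁻¹ * G.cap x (2 * R) (4 * R) := by
    rw [hE₂, hf₂, dform_smul_smul, ← hφ.dform_eq W hW]
    exact mul_le_mul_of_nonneg_left (G.dform_min_self_le W φ m) (by positivity)
  have hcross : ∀ s : ℝ, G.dform W (fun y => s * f₁ y) f₂ = 0 := by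
    intro s
    have : G.dform W (fun y => s * f₁ y) f₂ = G.dform W (fun _ => 0) (fun _ => 0) := by
      refine G.dform_congr W fun a b hab => ?_
      have h1 := G.dist_adj_le x hab
      have h2 := G.dist_adj_le x hab.symm
      rcases Nat.lt_or_ge n (G.graph.dist x a) with ha | ha <;>
        rcases Nat.lt_or_ge n (G.graph.dist x b) with hb | hb
      · rw [hf₁zero a ha, hf₁zero b hb]; ring
      · rw [hf₂one a (by omega), hf₂one b (by omega)]; ring
      · rw [hf₂one a (by omega), hf₂one b (by omega)]; ring
      · rw [hf₂one a (by omega), hf₂one b (by omega)]; ring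
    rw [this]
    simp [dform]
  -- This weight minimises s²E₁ + (1-s)²E₂; the minimum is the series value (1/E₁ + 1/E₂)⁻¹.
  set s := E₂ / (E₁ + E₂) with hs
  have hcap := cap_le hf hR0 (show R ≤ 4 * R by linarith) hW
    (f := fun y => s * f₁ y + (1 - s) * f₂ y)
    (fun y hy => by
      rw [h₁.eq_one y hy, hf₂one y ((hsub y (G.ball_subset_ball x (by linarith) hy)).trans
        (Nat.le_succ n))]
      ring)
    (fun y hy => by
      rw [h₁.eq_zero y fun h => hy (G.ball_subset_ball x (by linarith) h), hf₂zero y hy]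
      ring)
  rw [G.dform_add_smul W (fun y => s * f₁ y) f₂ (1 - s), hcross, dform_smul_smul,
    h₁.dform_eq W hW2, ← hE₁, ← hE₂] at hcap
  have hval : s * s * E₁ + 2 * (1 - s) * 0 + (1 - s) ^ 2 * E₂ = (E₁⁻¹ + E₂⁻¹)⁻¹ := by
    rw [hs]
    field_simp
    ring
  rw [hval] at hcap
  have h4 : E₁⁻¹ + E₂⁻¹ ≤ (G.cap x R (4 * R))⁻¹ := by
    rw [le_inv_comm₀ (by positivity) hcap3]
    exact hcap
  have h5 : Real.exp (-(2 * K * R ^ (-β))) * (G.cap x (2 * R) (4 * R))⁻¹ ≤ E₂⁻¹ := by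
    have e : Real.exp (-(2 * K * R ^ (-β))) = m * m := by
      rw [hm, ← Real.exp_add]; ring_nf
    rw [e, le_inv_comm₀ (by positivity) hE₂0, mul_inv, mul_inv, inv_inv]
    exact hE₂le
  linarith

/-! ### Iteration over dyadic scales -/

lemma exists_dyadic {R : ℝ} (hR : 1 ≤ R) :
    ∃ (k : ℕ) (r : ℝ), 1 ≤ r ∧ r ≤ 2 ∧ R = 2 ^ k * r := by
  obtain ⟨k, h1, h2⟩ := exists_nat_pow_near hR one_lt_two
  have hk : (0 : ℝ) < 2 ^ k := by positivity
  refine ⟨k, R / 2 ^ k, (one_le_div₀ hk).2 h1, ?_, by field_simp⟩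
  rw [div_le_iff₀ hk, ← pow_succ']
  exact h2.le

/-- Along R = 2^k r the error exponents are dominated by a geometric series with sum L = K/(1 -
2^(-β)), so all errors together cost a constant and the exponent log₂ A is not perturbed. -/
lemma dyadic_iteration {A K β : ℝ} (hA : 0 < A) (hK : 0 < K) (hβ : 0 < β) :
    ∃ c : ℝ, 0 < c ∧ ∀ (Q : ℝ → ℝ) (q : ℝ), 0 ≤ q →
      (∀ R, 1 ≤ R → Q R ≤ A * Real.exp (K * R ^ (-β)) * Q (2 * R)) →
      (∀ R, 1 ≤ R → R ≤ 2 → q ≤ Q R) →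
      ∀ R, 1 ≤ R → c * q * R ^ (-Real.logb 2 A) ≤ Q R := by
  set γ := Real.logb 2 A with hγ
  set b : ℝ := 2 ^ (-β) with hb
  have hb0 : 0 < b := by positivity
  have hb1 : b < 1 := Real.rpow_lt_one_of_one_lt_of_neg one_lt_two (by linarith)
  set L := K / (1 - b) with hL
  have hL0 : 0 < L := div_pos hK (by linarith)
  have hKL : K = L * (1 - b) := by rw [hL, div_mul_cancel₀ _ (by linarith)]
  -- The second factor absorbs r^(-γ) for r between 1 and 2, whatever the sign of γ.
  refine ⟨Real.exp (-L) * 2 ^ (-|γ|), by positivity, fun Q q hq hstep hbase R hR => ?_⟩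
  obtain ⟨k, r, hr1, hr2, rfl⟩ := exists_dyadic hR
  have main : ∀ k : ℕ, q * Real.exp (-(L * (1 - b ^ k))) ≤ A ^ k * Q (2 ^ k * r) := by
    intro k
    induction k with
    | zero => simpa using hbase r hr1 hr2
    | succ k ih =>
      have h2k : (1 : ℝ) ≤ 2 ^ k := one_le_pow₀ one_le_two
      have h1 := hstep (2 ^ k * r) (one_le_mul_of_one_le_of_one_le h2k hr1)
      rw [← mul_assoc 2, ← pow_succ'] at h1
      have h2 : K * (2 ^ k * r) ^ (-β) ≤ L * (1 - b) * b ^ k := by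
        rw [← hKL]
        refine mul_le_mul_of_nonneg_left ?_ hK.le
        rw [Real.mul_rpow (by positivity) (by linarith), hb, ← Real.rpow_natCast,
          ← Real.rpow_natCast, ← Real.rpow_mul two_pos.le, ← Real.rpow_mul two_pos.le,
          mul_comm (k : ℝ)]
        exact mul_le_of_le_one_right (by positivity)
          (Real.rpow_le_one_of_one_le_of_nonpos hr1 (by linarith))
      have hpos : 0 ≤ A ^ k * Q (2 ^ k * r) := (mul_nonneg hq (Real.exp_pos _).le).trans ih
      have hQ : 0 ≤ Q (2 ^ (k + 1) * r) := by
        have hAk : 0 < A ^ k := by positivity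
        have h3 : 0 ≤ Q (2 ^ k * r) := by
          by_contra! h
          nlinarith
        have h4 := h3.trans h1
        have h5 : 0 < A * Real.exp (K * (2 ^ k * r) ^ (-β)) := by positivity
        by_contra! h
        nlinarith
      calc q * Real.exp (-(L * (1 - b ^ (k + 1))))
          = q * Real.exp (-(L * (1 - b ^ k))) * Real.exp (-(L * (1 - b) * b ^ k)) := by
            rw [mul_assoc, ← Real.exp_add]
            congr 2
            ring
        _ ≤ A ^ k * Q (2 ^ k * r) * Real.exp (-(L * (1 - b) * b ^ k)) :=
            mul_le_mul_of_nonneg_right ih (Real.exp_pos _).le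
        _ ≤ A ^ k * (A * Real.exp (K * (2 ^ k * r) ^ (-β)) * Q (2 ^ (k + 1) * r)) *
              Real.exp (-(L * (1 - b) * b ^ k)) := by gcongr
        _ = A ^ (k + 1) * Q (2 ^ (k + 1) * r) *
              (Real.exp (K * (2 ^ k * r) ^ (-β)) * Real.exp (-(L * (1 - b) * b ^ k))) := by ring
        _ ≤ A ^ (k + 1) * Q (2 ^ (k + 1) * r) * 1 := by
            refine mul_le_mul_of_nonneg_left ?_ (by positivity)
            rw [← Real.exp_add]
            exact Real.exp_le_one_iff.2 (by linarith)
        _ = _ := mul_one _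
  have hAk : (0 : ℝ) < A ^ k := by positivity
  have h1 : Real.exp (-L) ≤ Real.exp (-(L * (1 - b ^ k))) := by
    refine Real.exp_le_exp.2 ?_
    have : 0 ≤ L * b ^ k := by positivity
    linarith
  have h2 : (2 : ℝ) ^ (-|γ|) * (2 ^ k * r) ^ (-γ) ≤ (A ^ k)⁻¹ := by
    have e : (A ^ k)⁻¹ = ((2 : ℝ) ^ k) ^ (-γ) := by
      rw [← Real.rpow_natCast, ← Real.rpow_natCast, ← Real.rpow_mul two_pos.le, mul_neg, mul_comm,
        Real.rpow_neg two_pos.le, Real.rpow_mul two_pos.le, hγ,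
        Real.rpow_logb two_pos (by norm_num) hA]
    rw [e, Real.mul_rpow (by positivity) (by linarith), mul_left_comm]
    refine mul_le_of_le_one_right (by positivity) ?_
    rw [Real.rpow_neg two_pos.le, inv_mul_le_one₀ (by positivity)]
    calc r ^ (-γ) ≤ r ^ |γ| := Real.rpow_le_rpow_of_exponent_le hr1 (neg_le_abs γ)
      _ ≤ 2 ^ |γ| := Real.rpow_le_rpow (by linarith) hr2 (abs_nonneg γ)
  calc Real.exp (-L) * 2 ^ (-|γ|) * q * (2 ^ k * r) ^ (-γ)
      = q * Real.exp (-L) * (2 ^ (-|γ|) * (2 ^ k * r) ^ (-γ)) := by ring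
    _ ≤ q * Real.exp (-(L * (1 - b ^ k))) * (A ^ k)⁻¹ := by gcongr
    _ ≤ A ^ k * Q (2 ^ k * r) * (A ^ k)⁻¹ := 
        mul_le_mul_of_nonneg_right (main k) (inv_nonneg.2 hAk.le)
    _ = Q (2 ^ k * r) := by field_simp

/-! ### Bounds at bounded scales -/

lemma cap_le_mul_mu [Infinite Γ] {G : WeightedGraph Γ} {p : ℝ} (hp : G.LowerWeights p)
    (N : ℕ) (x : Γ) {R : ℝ} (hR : 0 < R) (hRN : R ≤ N) :
    G.cap x R (2 * R) ≤ (p ^ N)⁻¹ * G.mu x := by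
  have hf := hp.finiteNbrs
  have hD := hf.ball_finite x (2 * R)
  obtain ⟨g, hg⟩ := hf.exists_isGreen hD (G.mem_ball_self x (by linarith))
  have hmu := G.mu_pos x
  have hpN : 0 < p ^ N := pow_pos hp.1 N
  have h := hg.mul_cap_le_one hf (m := p ^ N * (G.mu x)⁻¹) hR (by linarith) (by positivity) ?_
  · rw [mul_assoc, inv_mul_eq_div, mul_div_assoc', div_le_one hmu] at h
    rwa [inv_mul_eq_div, le_div_iff₀' hpN]
  · intro y hy
    have hyR := G.ball_subset_ball x (show R ≤ 2 * R by linarith) hy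
    have h1 := hp.pow_dist_mul_le (fun a => hg.nonneg hf hD a) hg.superharmonic _ y hyR rfl
    refine le_trans ?_ h1
    have h2 : p ^ N ≤ p ^ G.graph.dist x y := by
      refine pow_le_pow_of_le_one hp.1.le hp.le_one ?_
      rw [mem_ball] at hy
      exact_mod_cast (hy.trans_le hRN).le
    exact mul_le_mul h2 (hg.inv_mu_le hf hD) (by positivity) (pow_nonneg hp.1.le _)

/-- Some edge of the path carries a drop of at least 1/N, and its weight is at least p^N μ(q 0). -/
lemma le_dform_of_path [Nontrivial Γ] {G : WeightedGraph Γ} {p : ℝ} (hp : G.LowerWeights p)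
    {N : ℕ} (hN : 0 < N) {W : Finset Γ} {q : ℕ → Γ} (hqW : ∀ i, i ≤ N → q i ∈ W)
    (hadj : ∀ i, i < N → G.graph.Adj (q i) (q (i + 1))) {f : Γ → ℝ} (h1 : f (q 0) = 1)
    (h0 : f (q N) = 0) : p ^ N / (2 * N ^ 2) * G.mu (q 0) ≤ G.dform W f f := by
  have hNR : (0 : ℝ) < N := Nat.cast_pos.2 hN
  obtain ⟨i, hi, hdiff⟩ : ∃ i, i < N ∧ 1 / (N : ℝ) ≤ f (q i) - f (q (i + 1)) := by
    by_contra! h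
    have : ∑ i ∈ Finset.range N, (f (q i) - f (q (i + 1))) < ∑ i ∈ Finset.range N, 1 / (N : ℝ) :=
      Finset.sum_lt_sum_of_nonempty (by simpa using hN.ne') fun i hi => h i (Finset.mem_range.1 hi)
    rw [Finset.sum_range_sub' fun i => f (q i)] at this
    simp only [h1, h0, Finset.sum_const, Finset.card_range, nsmul_eq_mul] at this
    rw [mul_one_div_cancel hNR.ne'] at this
    linarith
  have hmu : ∀ j, j ≤ N → p ^ j * G.mu (q 0) ≤ G.mu (q j) := by
    intro j
    induction j with
    | zero => simp
    | succ j ih =>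
      intro hj
      have h2 := mu_le_of_adj hp (hadj j (by omega))
      have h3 := mul_le_mul_of_nonneg_left (ih (by omega)) hp.1.le
      rw [pow_succ']
      linarith
  have hw : p ^ N * G.mu (q 0) ≤ G.weight (q i) (q (i + 1)) := by
    have h2 := hp.2 _ _ (hadj i hi)
    have h3 := mul_le_mul_of_nonneg_left (hmu i hi.le) hp.1.le
    rw [← mul_assoc, ← pow_succ'] at h3
    have h4 : p ^ N ≤ p ^ (i + 1) := pow_le_pow_of_le_one hp.1.le hp.le_one hi
    have := mul_le_mul_of_nonneg_right h4 (G.mu_pos (q 0)).le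
    linarith
  have hterm : ∀ a b, 0 ≤ G.weight a b * ((f a - f b) * (f a - f b)) := fun a b =>
    mul_nonneg (G.weight_nonneg a b) (mul_self_nonneg _)
  have h2 : G.weight (q i) (q (i + 1)) * ((f (q i) - f (q (i + 1))) * (f (q i) - f (q (i + 1)))) ≤
      ∑ a ∈ W, ∑ b ∈ W, G.weight a b * ((f a - f b) * (f a - f b)) :=
    (Finset.single_le_sum (f := fun b => G.weight (q i) b * ((f (q i) - f b) * (f (q i) - f b)))
      (fun b _ => hterm _ b) (hqW (i + 1) hi)).trans
    (Finset.single_le_sum (f := fun a => ∑ b ∈ W, G.weight a b * ((f a - f b) * (f a - f b)))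
      (fun a _ => Finset.sum_nonneg fun b _ => hterm a b) (hqW i hi.le))
  have h3 : p ^ N * G.mu (q 0) * (1 / N * (1 / N)) ≤
      G.weight (q i) (q (i + 1)) * ((f (q i) - f (q (i + 1))) * (f (q i) - f (q (i + 1)))) := by
    have := G.mu_pos (q 0)
    have := hp.1
    refine mul_le_mul hw ?_ (by positivity) (G.weight_nonneg _ _)
    exact mul_le_mul hdiff hdiff (by positivity) ((by positivity : (0 : ℝ) ≤ 1 / N).trans hdiff)
  have e : p ^ N / (2 * N ^ 2) * G.mu (q 0) = 1 / 2 * (p ^ N * G.mu (q 0) * (1 / N * (1 / N))) := by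
    field_simp
  rw [e, dform]
  exact mul_le_mul_of_nonneg_left (h3.trans h2) (by norm_num)

lemma mul_mu_le_cap [Infinite Γ] {G : WeightedGraph Γ} {p : ℝ} (hp : G.LowerWeights p)
    {N : ℕ} (hN : 0 < N) (x : Γ) {r R : ℝ} (hr : 0 < r) (hrR : r ≤ R) (hRN : R ≤ N) :
    p ^ N / (2 * N ^ 2) * G.mu x ≤ G.cap x r R := by
  have hf := hp.finiteNbrs
  obtain ⟨φ, hφ⟩ := exists_isCapacitor hf x hr hrR
  obtain ⟨W, hW⟩ := hf.exists_window (hf.ball_finite x (N + 1))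
  obtain ⟨y, hy⟩ := hf.exists_dist_eq x N
  obtain ⟨q, hq0, hqn, hadj, hd1, -⟩ := G.exists_geodesic x y
  rw [hy] at hqn hadj hd1
  rw [← hφ.dform_eq W ((G.closedNhd_mono (G.ball_subset_ball x (by linarith))).trans hW), ← hq0]
  refine le_dform_of_path hp hN (fun i hi => hW (G.subset_closedNhd _ ?_)) hadj ?_ ?_
  · rw [mem_ball, hd1 i hi]
    have : (i : ℝ) ≤ N := by exact_mod_cast hi
    linarith
  · rw [hq0]; exact hφ.eq_one x (G.mem_ball_self x hr)
  · rw [hqn]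
    exact hφ.eq_zero y (by rw [mem_ball, hy]; linarith)

/-! ### Growth of the capacities -/

/-- Subtracting the outer resistance in the series law from its multiple in (R₂) leaves the factor
C₂ - exp(-s), which is C₂ - 1 up to a summable relative error. -/
lemma cap_le_of_outer [Infinite Γ] {G : WeightedGraph Γ} {p H : ℝ} (hp : G.LowerWeights p)
    (hH : G.HarnackWith H) {C₂ : ℝ} (hC₂ : 1 < C₂) (hout : G.OuterResistanceBound C₂) :
    ∃ C : ℝ, 0 < C ∧ ∀ (x : Γ) (R : ℝ), 1 ≤ R →
      G.cap x R (2 * R) ≤ C * G.mu x * R ^ Real.logb 2 (C₂ - 1) := by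
  have hf := hp.finiteNbrs
  rw [outerResistanceBound_iff hf (by linarith)] at hout
  obtain ⟨K, β, hK, hβ, hser⟩ := cap_series hp hH
  have hA : 0 < C₂ - 1 := by linarith
  obtain ⟨c, hc, hit⟩ := dyadic_iteration hA (div_pos hK hA) hβ
  have hp2 : 0 < p ^ 2 := pow_pos hp.1 2
  refine ⟨(c * p ^ 2)⁻¹, by positivity, fun x R hR => ?_⟩
  have hmu := G.mu_pos x
  have hcap : ∀ R, 1 ≤ R → 0 < G.cap x R (2 * R) := fun R hR =>
    cap_pos hf x (by linarith) (by linarith)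
  have h := hit (fun R => (G.cap x R (2 * R))⁻¹) (p ^ 2 * (G.mu x)⁻¹) (by positivity) ?_ ?_ R hR
  · rw [le_inv_comm₀ (by positivity) (hcap R hR)] at h
    refine h.trans (le_of_eq ?_)
    rw [Real.rpow_neg (by linarith)]
    field_simp
  · intro R hR
    have e : 2 * (2 * R) = 4 * R := by ring
    simp only [e]
    have h1 := hser x R hR
    have h2 := hout x R (by linarith)
    have hc2 : 0 < G.cap x (2 * R) (4 * R) := cap_pos hf x (by linarith) (by linarith)
    have hc3 : 0 < G.cap x R (4 * R) := cap_pos hf x (by linarith) (by linarith)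
    have h3 : (G.cap x R (4 * R))⁻¹ ≤ C₂ * (G.cap x (2 * R) (4 * R))⁻¹ := by
      rw [inv_le_iff_one_le_mul₀ hc3, mul_assoc, inv_mul_eq_div, mul_div_assoc', le_div_iff₀ hc2,
        one_mul]
      exact h2
    set s := K * R ^ (-β) with hs
    have h4 := Real.one_sub_le_exp_neg s
    have h5 := Real.add_one_le_exp (K / (C₂ - 1) * R ^ (-β))
    -- The additive error s becomes multiplicative; this is why the iteration runs with K / (C₂ -
    -- 1).
    have h6 : C₂ - 1 + s ≤ (C₂ - 1) * Real.exp (K / (C₂ - 1) * R ^ (-β)) := by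
      refine le_trans (le_of_eq ?_) (mul_le_mul_of_nonneg_left h5 hA.le)
      rw [hs]
      field_simp
      ring
    have hinv : 0 < (G.cap x (2 * R) (4 * R))⁻¹ := inv_pos.2 hc2
    calc (G.cap x R (2 * R))⁻¹
        ≤ (C₂ - Real.exp (-s)) * (G.cap x (2 * R) (4 * R))⁻¹ := by linarith
      _ ≤ _ := mul_le_mul_of_nonneg_right (by linarith) hinv.le
  · intro R hR hR2
    have := cap_le_mul_mu hp 2 x (show 0 < R by linarith) (by simpa using hR2)
    rw [le_inv_comm₀ (by positivity) (hcap R hR), mul_inv, inv_inv]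
    exact this

/-- The dual of `cap_le_of_outer`: here the inner resistance is subtracted, and the iteration runs
on capacities instead of resistances. -/
lemma le_cap_of_inner [Infinite Γ] {G : WeightedGraph Γ} {p H : ℝ} (hp : G.LowerWeights p)
    (hH : G.HarnackWith H) {C₁ : ℝ} (hC₁ : 1 < C₁) (hin : G.InnerResistanceBound C₁) :
    ∃ c : ℝ, 0 < c ∧ ∀ (x : Γ) (R : ℝ), 1 ≤ R →
      c * G.mu x * R ^ (-Real.logb 2 (C₁ - 1)) ≤ G.cap x R (2 * R) := by
  have hf := hp.finiteNbrs
  rw [innerResistanceBound_iff hf (by linarith)] at hin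
  obtain ⟨K, β, hK, hβ, hser⟩ := cap_series hp hH
  have hA : 0 < C₁ - 1 := by linarith
  obtain ⟨c, hc, hit⟩ := dyadic_iteration hA hK hβ
  have hp4 : 0 < p ^ 4 := pow_pos hp.1 4
  refine ⟨c * (p ^ 4 / (2 * (4 : ℕ) ^ 2)), by positivity, fun x R hR => ?_⟩
  have hmu := G.mu_pos x
  rw [mul_assoc c]
  refine hit (fun R => G.cap x R (2 * R)) (p ^ 4 / (2 * (4 : ℕ) ^ 2) * G.mu x) (by positivity)
    ?_ ?_ R hR
  · intro R hR
    have e : 2 * (2 * R) = 4 * R := by ring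
    simp only [e]
    have h1 := hser x R hR
    have h2 := hin x R (by linarith)
    have hc1 : 0 < G.cap x R (2 * R) := cap_pos hf x (by linarith) (by linarith)
    have hc2 : 0 < G.cap x (2 * R) (4 * R) := cap_pos hf x (by linarith) (by linarith)
    have hc3 : 0 < G.cap x R (4 * R) := cap_pos hf x (by linarith) (by linarith)
    have h3 : (G.cap x R (4 * R))⁻¹ ≤ C₁ * (G.cap x R (2 * R))⁻¹ := by
      rw [inv_le_iff_one_le_mul₀ hc3, mul_assoc, inv_mul_eq_div, mul_div_assoc', le_div_iff₀ hc1,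
        one_mul]
      exact h2
    set s := K * R ^ (-β) with hs
    have h4 : Real.exp (-s) * (G.cap x (2 * R) (4 * R))⁻¹ ≤ (C₁ - 1) * (G.cap x R (2 * R))⁻¹ := by
      linarith
    rw [Real.exp_neg, ← mul_inv, ← div_eq_mul_inv, inv_le_comm₀ (by positivity) (by positivity),
      inv_div, div_le_iff₀ hA] at h4
    linarith
  · intro R hR hR2
    exact mul_mu_le_cap hp (by norm_num) x (by linarith) (by linarith) (by push_cast; linarith)

/-! ### Lower bounds for mean exit times -/

/-- The maximum of g on the last sphere inside B(x,R) is at least the resistance, and Harnack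
carries this to the whole inner ball. -/
lemma IsGreen.inner_ge [Infinite Γ] {G : WeightedGraph Γ} {p H : ℝ}
    (hp : G.LowerWeights p) (hH : G.HarnackWith H) :
    ∃ c : ℝ, 0 < c ∧ ∀ (x : Γ) (R : ℝ), 0 < R → ∀ g, G.IsGreen (G.ball x (2 * R)) x g →
      ∀ y ∈ G.ball x R, c * (G.cap x R (2 * R))⁻¹ ≤ g y := by
  have hf := hp.finiteNbrs
  obtain ⟨C, hC1, hC⟩ := IsGreen.sphere_le_inner hp hH
  have hC0 : 0 < C := by linarith
  refine ⟨C⁻¹, inv_pos.2 hC0, fun x R hR g hg y hy => ?_⟩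
  obtain ⟨n, hn1, hn2⟩ := exists_nat_lt_le hR
  have hD := hf.ball_finite x (2 * R)
  obtain ⟨z, hz, hmax⟩ := hf.exists_max_sphere x n g
  have h1 := hg.one_le_mul_cap hf hn1 (by linarith) (hg.nonneg hf hD z) hmax
  have hyn : G.graph.dist x y ≤ n := by
    rw [mem_ball] at hy
    have : (G.graph.dist x y : ℝ) < ((n + 1 : ℕ) : ℝ) := by push_cast; linarith
    exact Nat.lt_succ_iff.1 (by exact_mod_cast this)
  have h2 := hC _ hD x n (fun y hy => by rw [mem_ball]; linarith) g hg z y hz hyn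
  have hcap := cap_pos hf x hR (by linarith : R ≤ 2 * R)
  rw [← mul_inv, inv_le_iff_one_le_mul₀ (by positivity)]
  have := mul_le_mul_of_nonneg_right h2 hcap.le
  linarith

lemma le_exitE_double [Countable Γ] [Infinite Γ] [MeasurableSpace Γ]
    [DiscreteMeasurableSpace Γ] {G : WeightedGraph Γ} {p H : ℝ}
    (hp : G.LowerWeights p) (hH : G.HarnackWith H) :
    ∃ c : ℝ, 0 < c ∧ ∀ (x : Γ) (R : ℝ), 0 < R →
      ENNReal.ofReal (c * (G.cap x R (2 * R))⁻¹) * G.vol x R ≤ G.exitE x (2 * R) := by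
  have hf := hp.finiteNbrs
  obtain ⟨c, hc, h⟩ := IsGreen.inner_ge hp hH
  refine ⟨c, hc, fun x R hR => ?_⟩
  obtain ⟨g, hg⟩ := hf.exists_isGreen (hf.ball_finite x (2 * R)) (G.mem_ball_self x (by linarith))
  have hcap := cap_pos hf x hR (by linarith : R ≤ 2 * R)
  exact hg.le_exitE hf (by linarith) (by linarith) (by positivity) (h x R hR g hg)

lemma cap_anti [Infinite Γ] {G : WeightedGraph Γ} (hf : G.FiniteNbrs) (x : Γ) {r R R' : ℝ}
    (hr : 0 < r) (hrR : r ≤ R) (hR : R ≤ R') : G.cap x r R' ≤ G.cap x r R := by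
  obtain ⟨φ, hφ⟩ := exists_isCapacitor hf x hr hrR
  obtain ⟨W, hW⟩ := hf.exists_window (hf.ball_finite x R')
  have hsub := G.ball_subset_ball x hR
  rw [← hφ.dform_eq W ((G.closedNhd_mono hsub).trans hW)]
  exact cap_le hf hr (hrR.trans hR) hW hφ.eq_one fun a ha => hφ.eq_zero a fun h => ha (hsub h)

/-- Volume bound from the linear cut-off function. -/
lemma sq_mul_cap_le_vol [Infinite Γ] {G : WeightedGraph Γ} (hf : G.FiniteNbrs) (x : Γ) {R : ℝ}
    (hR : 0 < R) : ENNReal.ofReal (R ^ 2 * G.cap x R (2 * R)) ≤ G.vol x (2 * R) := by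
  classical
  have hD := hf.ball_finite x (2 * R)
  obtain ⟨W, hW⟩ := hf.exists_window hD
  set f : Γ → ℝ := fun y => max 0 (min 1 ((2 * R - G.graph.dist x y) / R)) with hfdef
  have hcap := cap_le hf hR (by linarith : R ≤ 2 * R) hW (f := f) (fun a ha => ?_) (fun a ha => ?_)
  · rw [vol_eq hf]
    refine ENNReal.ofReal_le_ofReal ?_
    rw [mul_comm, ← le_div_iff₀ (by positivity)]
    refine hcap.trans ?_
    -- Charging each edge to its endpoints in the ball bounds the energy by R⁻² times the volume of
    -- the ball itself, without enlarging it.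
    set χ : Γ → ℝ := fun a => if a ∈ G.ball x (2 * R) then 1 else 0 with hχ
    have hterm : ∀ a b, G.weight a b * ((f a - f b) * (f a - f b)) ≤
        (R ^ 2)⁻¹ * (G.weight a b * χ a + G.weight a b * χ b) := by
      intro a b
      by_cases hab : G.graph.Adj a b
      swap
      · simp [G.weight_eq_zero a b hab]
      have hw := G.weight_nonneg a b
      have hχ0 : ∀ a, 0 ≤ χ a := fun a => by simp only [hχ]; split_ifs <;> norm_num
      rw [← mul_add, mul_left_comm (R ^ 2)⁻¹]
      refine mul_le_mul_of_nonneg_left ?_ hw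
      by_cases hout : a ∉ G.ball x (2 * R) ∧ b ∉ G.ball x (2 * R)
      · have hz : ∀ a, a ∉ G.ball x (2 * R) → f a = 0 := by
          intro a ha
          rw [mem_ball, not_lt] at ha
          have : (2 * R - G.graph.dist x a) / R ≤ 0 := div_nonpos_of_nonpos_of_nonneg
            (by linarith) hR.le
          simp only [hfdef]
          rw [max_eq_left ((min_le_right _ _).trans this)]
        rw [hz a hout.1, hz b hout.2]
        have := hχ0 a
        have := hχ0 b
        simp only [sub_zero, mul_zero]
        positivity
      · have hχ1 : 1 ≤ χ a + χ b := by
          have h1 := hχ0 a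
          have h2 := hχ0 b
          by_cases ha : a ∈ G.ball x (2 * R)
          · have : χ a = 1 := if_pos ha
            linarith
          · have : χ b = 1 := if_pos (by tauto)
            linarith
        have h1 := clamp_sq_le ((2 * R - G.graph.dist x a) / R) ((2 * R - G.graph.dist x b) / R)
        have h2 : ((2 * R - G.graph.dist x a) / R - (2 * R - G.graph.dist x b) / R) ^ 2 ≤
            (R ^ 2)⁻¹ := by
          rw [← sub_div, div_pow, div_eq_mul_inv]
          refine mul_le_of_le_one_left (by positivity) ?_
          rw [sq_le_one_iff_abs_le_one, abs_le]
          have h3 := G.dist_adj_leR x hab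
          have h4 := G.dist_adj_leR x hab.symm
          constructor <;> linarith
        have h5 : (f a - f b) * (f a - f b) ≤ (R ^ 2)⁻¹ := by
          rw [← sq]; exact h1.trans h2
        exact h5.trans (le_mul_of_one_le_right (by positivity) hχ1)
    have hside : ∑ a ∈ W, ∑ b ∈ W, G.weight a b * χ a = ∑ y ∈ hD.toFinset, G.mu y := by
      symm
      refine Finset.sum_subset_zero_on_sdiff ?_ ?_ ?_
      · exact fun y hy => hW (G.subset_closedNhd _ (by simpa using hy))
      · intro y hy
        have : y ∉ G.ball x (2 * R) := by simpa using (Finset.mem_sdiff.1 hy).2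
        simp [hχ, this]
      · intro y hy
        have hy : y ∈ G.ball x (2 * R) := by simpa using hy
        rw [G.mu_eq_sum fun b hb => hW (G.adj_mem_closedNhd hy hb)]
        exact Finset.sum_congr rfl fun b _ => by simp [hχ, hy]
    have hside' : ∑ a ∈ W, ∑ b ∈ W, G.weight a b * χ b = ∑ y ∈ hD.toFinset, G.mu y := by
      rw [Finset.sum_comm, ← hside]
      exact Finset.sum_congr rfl fun a _ => Finset.sum_congr rfl fun b _ => by rw [G.weight_symm]
    calc G.dform W f f ≤ 1 / 2 * ∑ a ∈ W, ∑ b ∈ W,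
          (R ^ 2)⁻¹ * (G.weight a b * χ a + G.weight a b * χ b) :=
          mul_le_mul_of_nonneg_left (Finset.sum_le_sum fun a _ => Finset.sum_le_sum fun b _ =>
            hterm a b) (by norm_num)
      _ = (R ^ 2)⁻¹ * ((1 / 2) * (∑ a ∈ W, ∑ b ∈ W, G.weight a b * χ a +
            ∑ a ∈ W, ∑ b ∈ W, G.weight a b * χ b)) := by
          simp only [← Finset.mul_sum, ← Finset.sum_add_distrib]
          ring
      _ = (∑ y ∈ hD.toFinset, G.mu y) / R ^ 2 := by
          rw [hside, hside']
          ring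
  · rw [mem_ball] at ha
    have : 1 ≤ (2 * R - G.graph.dist x a) / R := by
      rw [one_le_div₀ hR]; linarith
    simp [hfdef, min_eq_left this]
  · rw [mem_ball, not_lt] at ha
    have : (2 * R - G.graph.dist x a) / R ≤ 0 := div_nonpos_of_nonpos_of_nonneg
      (by linarith) hR.le
    exact max_eq_left ((min_le_right _ _).trans this)

theorem exists_exitE_bounds [Countable Γ] [Infinite Γ] [MeasurableSpace Γ]
    [DiscreteMeasurableSpace Γ] {G : WeightedGraph Γ} {p H : ℝ}
    (hp : G.LowerWeights p) (hH : G.HarnackWith H) :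
    ∃ c : ℝ, 0 < c ∧ ∀ (x : Γ) (R : ℝ), 0 < R →
      ENNReal.ofReal (c * R ^ 2) ≤ G.exitE x R ∧ G.exitE x R < ∞ := by
  have hf := hp.finiteNbrs
  obtain ⟨c, hc, h⟩ := le_exitE_double hp hH
  obtain ⟨C, hC1, hC⟩ := cap_outer_le hp hH
  have hC0 : 0 < C := by linarith
  refine ⟨c / (16 * C), by positivity, fun x R hR => ⟨?_, ?_⟩⟩
  · have h1 := h x (R / 2) (by linarith)
    have h2 := sq_mul_cap_le_vol hf x (show 0 < R / 4 by linarith)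
    have h3 := hC x (R / 4) (by linarith)
    have h4 := cap_anti hf x (show 0 < R / 4 by linarith) (show R / 4 ≤ R / 2 by linarith)
      (show R / 2 ≤ R by linarith)
    have hcap : 0 < G.cap x (R / 2) R := cap_pos hf x (by linarith) (by linarith)
    rw [show 2 * (R / 2) = R by ring] at h1
    rw [show 2 * (R / 4) = R / 2 by ring] at h2 h3
    rw [show 4 * (R / 4) = R by ring] at h3
    refine le_trans ?_ h1
    refine le_trans ?_ (mul_le_mul_right h2 _)
    rw [← ENNReal.ofReal_mul (by positivity)]
    refine ENNReal.ofReal_le_ofReal ?_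
    have h5 : G.cap x (R / 2) R ≤ C * G.cap x (R / 4) (R / 2) :=
      h3.trans (mul_le_mul_of_nonneg_left h4 hC0.le)
    calc c / (16 * C) * R ^ 2
        = c * (G.cap x (R / 2) R)⁻¹ * ((R / 4) ^ 2 * (G.cap x (R / 2) R / C)) := by
          field_simp
          ring
      _ ≤ c * (G.cap x (R / 2) R)⁻¹ * ((R / 4) ^ 2 * G.cap x (R / 4) (R / 2)) := by
          gcongr
          rw [div_le_iff₀' hC0]
          exact h5
  · obtain ⟨g, hg⟩ := hf.exists_isGreen (hf.ball_finite x R) (G.mem_ball_self x hR)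
    rw [hg.exitE_eq hf hR]
    exact ENNReal.ofReal_lt_top

/-! ### Volume bounds -/

theorem exists_vol_le_of_outer [Countable Γ] [Infinite Γ] [MeasurableSpace Γ]
    [DiscreteMeasurableSpace Γ] {G : WeightedGraph Γ} {p H : ℝ}
    (hp : G.LowerWeights p) (hH : G.HarnackWith H) {C₂ : ℝ} (hC₂ : 1 < C₂)
    (hout : G.OuterResistanceBound C₂) :
    ∃ C : ℝ, 0 < C ∧ ∀ (x : Γ) (R : ℝ), 1 ≤ R →
      G.vol x R ≤ ENNReal.ofReal (C * G.mu x * R ^ Real.logb 2 (C₂ - 1)) * G.exitE x (2 * R) := by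
  have hf := hp.finiteNbrs
  obtain ⟨C, hC, hcap⟩ := cap_le_of_outer hp hH hC₂ hout
  obtain ⟨c, hc, h⟩ := le_exitE_double hp hH
  refine ⟨C / c, by positivity, fun x R hR => ?_⟩
  have hmu := G.mu_pos x
  have hpos : 0 < G.cap x R (2 * R) := cap_pos hf x (by linarith) (by linarith)
  refine le_trans ?_ (mul_le_mul_right (h x R (by linarith)) _)
  rw [← mul_assoc, ← ENNReal.ofReal_mul (by positivity)]
  refine le_mul_of_one_le_left' ?_
  rw [ENNReal.one_le_ofReal]
  have e : C / c * G.mu x * R ^ Real.logb 2 (C₂ - 1) * (c * (G.cap x R (2 * R))⁻¹) =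
      C * G.mu x * R ^ Real.logb 2 (C₂ - 1) / G.cap x R (2 * R) := by field_simp
  rw [e, one_le_div₀ hpos]
  exact hcap x R hR

theorem exists_le_vol_of_inner [Infinite Γ] {G : WeightedGraph Γ} {p H : ℝ}
    (hp : G.LowerWeights p) (hH : G.HarnackWith H) {C₁ : ℝ} (hC₁ : 1 < C₁)
    (hin : G.InnerResistanceBound C₁) :
    ∃ c : ℝ, 0 < c ∧ ∀ (x : Γ) (R : ℝ), 1 ≤ R →
      ENNReal.ofReal (c * G.mu x * R ^ (2 - Real.logb 2 (C₁ - 1))) ≤ G.vol x (2 * R) := by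
  have hf := hp.finiteNbrs
  obtain ⟨c, hc, hcap⟩ := le_cap_of_inner hp hH hC₁ hin
  refine ⟨c, hc, fun x R hR => ?_⟩
  have hR0 : 0 < R := by linarith
  refine le_trans (ENNReal.ofReal_le_ofReal ?_) (sq_mul_cap_le_vol hf x hR0)
  have h := mul_le_mul_of_nonneg_left (hcap x R hR) (sq_nonneg R)
  refine le_trans (le_of_eq ?_) h
  rw [sub_eq_add_neg, Real.rpow_add hR0, Real.rpow_two]
  ring

/-- Polynomial lower bound of the Green function up to the boundary of the ball. -/
lemma IsGreen.boundary_ge [Infinite Γ] {G : WeightedGraph Γ} {p H : ℝ}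
    (hp : G.LowerWeights p) (hH : G.HarnackWith H) :
    ∃ c γ : ℝ, 0 < c ∧ 0 ≤ γ ∧ ∀ (x : Γ) (R : ℝ), 1 ≤ R → ∀ g, G.IsGreen (G.ball x R) x g →
      ∀ y ∈ G.ball x R, c * R ^ (-γ) * (G.mu x)⁻¹ ≤ g y := by
  have hf := hp.finiteNbrs
  obtain ⟨C₀, hC₀, hout⟩ := cap_outer_le hp hH
  have hout' : G.OuterResistanceBound (C₀ + 1) := by
    rw [outerResistanceBound_iff hf (by linarith)]
    intro x R hR
    have := hout x R hR
    have := cap_pos hf x hR (by linarith : R ≤ 4 * R)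
    linarith
  obtain ⟨C, hC, hcap⟩ := cap_le_of_outer hp hH (by linarith) hout'
  set γ₂ := Real.logb 2 (C₀ + 1 - 1) with hγ₂
  have hγ₂0 : 0 ≤ γ₂ := Real.logb_nonneg one_lt_two (by linarith)
  obtain ⟨c, hc, hinner⟩ := IsGreen.inner_ge hp hH
  obtain ⟨A, hA1, hA⟩ := harnack_chain hp hH 4
  have hA0 : 0 < A := by linarith
  set γ₁ := Real.logb 2 A with hγ₁
  have hγ₁0 : 0 ≤ γ₁ := Real.logb_nonneg one_lt_two hA1
  have hp16 : 0 < p ^ 16 := pow_pos hp.1 16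
  have hp0 := hp.1
  refine ⟨min (p ^ 16) (p * (A⁻¹ * (c / C))), γ₁ + γ₂, lt_min hp16 (by positivity), by positivity,
    fun x R hR g hg y hy => ?_⟩
  have hR0 : 0 < R := by linarith
  have hmu := G.mu_pos x
  have hD := hf.ball_finite x R
  have hgnn := fun a => hg.nonneg hf hD a
  rcases lt_or_ge R 16 with hR16 | hR16
  · have h1 := hp.pow_dist_mul_le hgnn hg.superharmonic _ y hy rfl
    refine le_trans ?_ h1
    have h2 : p ^ 16 ≤ p ^ G.graph.dist x y := by
      refine pow_le_pow_of_le_one hp.1.le hp.le_one ?_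
      rw [mem_ball] at hy
      have : (G.graph.dist x y : ℝ) < (16 : ℕ) := by push_cast; linarith
      exact_mod_cast this.le
    have h3 : R ^ (-(γ₁ + γ₂)) ≤ 1 :=
      Real.rpow_le_one_of_one_le_of_nonpos hR (by linarith)
    refine mul_le_mul ?_ (hg.inv_mu_le hf hD) (by positivity) (pow_nonneg hp.1.le _)
    calc min (p ^ 16) (p * (A⁻¹ * (c / C))) * R ^ (-(γ₁ + γ₂)) ≤ p ^ 16 * 1 :=
          mul_le_mul (min_le_left _ _) h3 (by positivity) hp16.le
      _ ≤ _ := by rw [mul_one]; exact h2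
  have hRp : 0 < R ^ (-γ₂) := by positivity
  set m := c / C * R ^ (-γ₂) * (G.mu x)⁻¹ with hm
  have hm0 : 0 < m := by positivity
  -- the inner half of the ball
  have stage1 : ∀ y ∈ G.ball x (R / 2), m ≤ g y := by
    intro y hy
    have h1 := hinner x (R / 2) (by linarith) g (by rwa [mul_div_cancel₀ R two_ne_zero]) y hy
    refine le_trans ?_ h1
    have h2 := hcap x (R / 2) (by linarith)
    have hpos := cap_pos hf x (show 0 < R / 2 by linarith) (show R / 2 ≤ 2 * (R / 2) by linarith)
    have h3 : G.cap x (R / 2) (2 * (R / 2)) ≤ C * G.mu x * R ^ γ₂ := by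
      refine h2.trans (mul_le_mul_of_nonneg_left ?_ (by positivity))
      exact Real.rpow_le_rpow (by linarith) (by linarith) hγ₂0
    have h4 := inv_anti₀ hpos h3
    refine le_trans (le_of_eq ?_) (mul_le_mul_of_nonneg_left h4 hc.le)
    rw [hm, Real.rpow_neg hR0.le]
    field_simp
  -- the bulk of the ball
  have stage2 : ∀ y, (G.graph.dist x y : ℝ) ≤ 3 * R / 4 → A⁻¹ * m ≤ g y := by
    intro y hy
    rw [inv_mul_eq_div, div_le_iff₀' hA0]
    by_cases hyR : y ∈ G.ball x (R / 2)
    · exact (stage1 y hyR).trans (le_mul_of_one_le_left (hgnn y) hA1)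
    rw [mem_ball, not_lt] at hyR
    obtain ⟨n, hn1, hn2⟩ := exists_nat_lt_le (show 0 < R / 2 by linarith)
    have hny : n ≤ G.graph.dist x y := by exact_mod_cast (hn1.trans_le hyR).le
    obtain ⟨q, hq0, hqn, hadj, hd1, -⟩ := G.exists_geodesic x y
    have h := (hA (R / 8) (by linarith) g hgnn (G.graph.dist x y - n) (fun i => q (n + i))
      ?_ ?_ ?_).1
    · simp only [add_zero, Nat.add_sub_cancel' hny, hqn] at h
      exact (stage1 (q n) (by rw [mem_ball, hd1 n hny]; exact hn1)).trans h
    · rw [Nat.cast_sub hny]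
      push_cast
      linarith
    · exact fun i hi => hadj (n + i) (by omega)
    · intro i hi a ha
      rw [mem_ball] at ha
      have h1 : (G.graph.dist x (q (n + i)) : ℝ) = n + i := by
        exact_mod_cast hd1 (n + i) (by omega)
      have h2 := G.dist_triR x (q (n + i)) a
      have h3 : ((n + i : ℕ) : ℝ) ≤ G.graph.dist x y := by exact_mod_cast (by omega)
      push_cast at h3
      refine hg.harm a (by rw [mem_ball]; linarith) ?_
      rintro rfl
      rw [SimpleGraph.dist_comm] at ha
      have : (0 : ℝ) ≤ i := i.cast_nonneg
      linarith
  -- dyadic approach to the boundary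
  have stage3 : ∀ (j : ℕ) (y : Γ), 1 ≤ R - G.graph.dist x y →
      R / 4 ≤ (R - G.graph.dist x y) * 2 ^ j → A⁻¹ * m ≤ A ^ j * g y := by
    intro j
    induction j with
    | zero =>
      intro y _ h
      rw [pow_zero, one_mul]
      exact stage2 y (by rw [pow_zero] at h; linarith)
    | succ j ih =>
      intro y h1 h2
      set t := R - G.graph.dist x y with ht
      rcases le_or_gt (R / 4) t with h3 | h3
      · exact (stage2 y (by linarith)).trans
          (le_mul_of_one_le_left (hgnn y) (one_le_pow₀ hA1))
      have hn1 := Nat.le_ceil t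
      have hn2 := Nat.ceil_lt_add_one (show 0 ≤ t by linarith)
      set n := ⌈t⌉₊
      have hny : n ≤ G.graph.dist x y := by
        have : (n : ℝ) ≤ G.graph.dist x y := by linarith
        exact_mod_cast this
      obtain ⟨q, hq0, hqn, hadj, hd1, -⟩ := G.exists_geodesic x y
      set k := G.graph.dist x y with hk
      have hkn : ((k - n : ℕ) : ℝ) = k - n := Nat.cast_sub hny
      have hdq : (G.graph.dist x (q (k - n)) : ℝ) = k - n := by
        rw [hd1 (k - n) (by omega), hkn]
      -- Walking n = ⌈t⌉ steps towards x at least doubles the distance t to radius R, while balls of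
      -- radius t about the path stay in B(x,R): each doubling costs one factor A.
      have h := (hA t (by linarith) g hgnn n (fun i => q (k - n + i)) ?_ ?_ ?_).1
      · simp only [add_zero, Nat.sub_add_cancel hny, hqn] at h
        have h4 := ih (q (k - n)) (by rw [hdq]; linarith) (by
          rw [hdq]
          rw [pow_succ] at h2
          refine h2.trans ?_
          have : 2 * t ≤ R - (k - n) := by linarith
          have := mul_le_mul_of_nonneg_right this (show (0 : ℝ) ≤ 2 ^ j by positivity)
          linarith)
        refine h4.trans ?_
        rw [pow_succ, mul_assoc]
        exact mul_le_mul_of_nonneg_left h (by positivity)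
      · push_cast
        linarith
      · exact fun i hi => hadj (k - n + i) (by omega)
      · intro i hi a ha
        rw [mem_ball] at ha
        have e1 : (G.graph.dist x (q (k - n + i)) : ℝ) = k - n + i := by
          rw [hd1 (k - n + i) (by omega)]
          push_cast
          rw [hkn]
        have e2 := G.dist_triR x (q (k - n + i)) a
        have e3 : (i : ℝ) ≤ n := by exact_mod_cast hi
        refine hg.harm a (by rw [mem_ball]; linarith) ?_
        rintro rfl
        rw [SimpleGraph.dist_comm] at ha
        have : (0 : ℝ) ≤ i := i.cast_nonneg
        linarith
  obtain ⟨J, hJ1, hJ2⟩ := exists_nat_pow_near hR one_lt_two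
  rw [pow_succ] at hJ2
  -- In the last layer, where less than distance 1 remains, one edge inwards reaches the range of
  -- stage3 at the cost of p.
  have stage4 : p * (A⁻¹ * m) ≤ A ^ J * g y := by
    have hfin : ∀ y, 1 ≤ R - G.graph.dist x y → A⁻¹ * m ≤ A ^ J * g y := fun y hy =>
      stage3 J y hy (by
        have := mul_le_mul_of_nonneg_right hy (show (0 : ℝ) ≤ 2 ^ J by positivity)
        linarith)
    have hAm : 0 < A⁻¹ * m := by positivity
    rcases le_or_gt 1 (R - G.graph.dist x y) with h1 | h1
    · exact (mul_le_of_le_one_left hAm.le hp.le_one).trans (hfin y h1)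
    · obtain ⟨q, hq0, hqn, hadj, hd1, -⟩ := G.exists_geodesic x y
      have hk : 1 ≤ G.graph.dist x y := by
        have : (1 : ℝ) ≤ G.graph.dist x y := by linarith
        exact_mod_cast this
      have h2 := hadj (G.graph.dist x y - 1) (by omega)
      rw [Nat.sub_add_cancel hk, hqn] at h2
      have h3 := hp.le_of_superharmonic (fun c _ => hgnn c) (hg.superharmonic y hy) h2.symm
      rw [mem_ball] at hy
      have h4 := hfin (q (G.graph.dist x y - 1)) (by
        rw [hd1 _ (by omega), Nat.cast_sub hk]
        push_cast
        linarith)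
      calc p * (A⁻¹ * m) ≤ p * (A ^ J * g (q (G.graph.dist x y - 1))) :=
            mul_le_mul_of_nonneg_left h4 hp.1.le
        _ = A ^ J * (p * g (q (G.graph.dist x y - 1))) := by ring
        _ ≤ A ^ J * g y := mul_le_mul_of_nonneg_left h3 (by positivity)
  have hAJ : A ^ J ≤ R ^ γ₁ := by
    have e : A ^ J = ((2 : ℝ) ^ J) ^ γ₁ := by
      rw [← Real.rpow_natCast, ← Real.rpow_natCast, ← Real.rpow_mul two_pos.le, mul_comm,
        Real.rpow_mul two_pos.le, hγ₁, Real.rpow_logb two_pos (by norm_num) hA0]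
    rw [e]
    exact Real.rpow_le_rpow (by positivity) hJ1 hγ₁0
  have h5 : p * (A⁻¹ * m) ≤ R ^ γ₁ * g y :=
    stage4.trans (mul_le_mul_of_nonneg_right hAJ (hgnn y))
  have h6 : R ^ (-γ₁) * (p * (A⁻¹ * m)) ≤ g y := by
    rw [Real.rpow_neg hR0.le, inv_mul_eq_div, div_le_iff₀' (by positivity)]
    exact h5
  refine le_trans ?_ h6
  rw [neg_add, Real.rpow_add hR0]
  calc min (p ^ 16) (p * (A⁻¹ * (c / C))) * (R ^ (-γ₁) * R ^ (-γ₂)) * (G.mu x)⁻¹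
      ≤ p * (A⁻¹ * (c / C)) * (R ^ (-γ₁) * R ^ (-γ₂)) * (G.mu x)⁻¹ := by
        gcongr
        exact min_le_right _ _
    _ = R ^ (-γ₁) * (p * (A⁻¹ * m)) := by
        rw [hm]
        ring

theorem exists_vol_le_exitE [Countable Γ] [Infinite Γ] [MeasurableSpace Γ]
    [DiscreteMeasurableSpace Γ] {G : WeightedGraph Γ} {p H : ℝ}
    (hp : G.LowerWeights p) (hH : G.HarnackWith H) :
    ∃ C₂ : ℝ, 1 < C₂ ∧ G.OuterResistanceBound C₂ ∧
      ∃ C : ℝ, 0 < C ∧ ∀ (x : Γ) (R : ℝ), 1 ≤ R →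
        G.vol x R ≤
          ENNReal.ofReal (C * G.mu x * R ^ Real.logb 2 (C₂ - 1)) * G.exitE x R := by
  have hf := hp.finiteNbrs
  obtain ⟨C₀, hC₀, hout⟩ := cap_outer_le hp hH
  obtain ⟨c, γ, hc, hγ, hg⟩ := IsGreen.boundary_ge hp hH
  have h2γ : (0 : ℝ) < 2 ^ γ := by positivity
  -- Enlarging the constant preserves (R₂), and C₂ - 1 ≥ 2^γ makes its exponent at least γ, the loss
  -- of the Green function at the boundary.
  refine ⟨max C₀ (1 + 2 ^ γ), lt_max_of_lt_right (by linarith), ?_, c⁻¹, inv_pos.2 hc,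
    fun x R hR => ?_⟩
  · rw [outerResistanceBound_iff hf (lt_max_of_lt_right (by linarith))]
    exact fun x R hR => (hout x R hR).trans
      (mul_le_mul_of_nonneg_right (le_max_left _ _) (cap_pos hf x hR (by linarith)).le)
  · have hR0 : 0 < R := by linarith
    have hmu := G.mu_pos x
    have hγle : γ ≤ Real.logb 2 (max C₀ (1 + 2 ^ γ) - 1) := by
      have h1 : (2 : ℝ) ^ γ ≤ max C₀ (1 + 2 ^ γ) - 1 := by
        have := le_max_right C₀ (1 + 2 ^ γ)
        linarith
      rw [Real.le_logb_iff_rpow_le one_lt_two (h2γ.trans_le h1)]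
      exact h1
    obtain ⟨g, hgreen⟩ := hf.exists_isGreen (hf.ball_finite x R) (G.mem_ball_self x hR0)
    have h1 := hgreen.le_exitE hf hR0 le_rfl (m := c * R ^ (-γ) * (G.mu x)⁻¹) (by positivity)
      (hg x R hR g hgreen)
    refine le_trans ?_ (mul_le_mul_right h1 _)
    rw [← mul_assoc, ← ENNReal.ofReal_mul (by positivity)]
    refine le_mul_of_one_le_left' ?_
    rw [ENNReal.one_le_ofReal]
    have h2 := Real.rpow_le_rpow_of_exponent_le hR hγle
    have e : c⁻¹ * G.mu x * R ^ Real.logb 2 (max C₀ (1 + 2 ^ γ) - 1) *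
        (c * R ^ (-γ) * (G.mu x)⁻¹) = R ^ Real.logb 2 (max C₀ (1 + 2 ^ γ) - 1) / R ^ γ := by
      rw [Real.rpow_neg hR0.le]
      field_simp
    rw [e, one_le_div₀ (by positivity)]
    exact h2

/-! ### The inner resistance bound under bounded covering -/

lemma dform_one_sub (G : WeightedGraph Γ) (W : Finset Γ) (f : Γ → ℝ) :
    G.dform W (fun y => 1 - f y) (fun y => 1 - f y) = G.dform W f f :=
  G.dform_congr W fun a b _ => by ring

lemma dform_min_le_add (G : WeightedGraph Γ) (W : Finset Γ) (f g : Γ → ℝ) :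
    G.dform W (fun y => min (f y) (g y)) (fun y => min (f y) (g y)) ≤
      G.dform W f f + G.dform W g g := by
  simp only [dform, ← mul_add, ← Finset.sum_add_distrib]
  refine mul_le_mul_of_nonneg_left ?_ (by norm_num)
  refine Finset.sum_le_sum fun a _ => Finset.sum_le_sum fun b _ => ?_
  refine mul_le_mul_of_nonneg_left ?_ (G.weight_nonneg a b)
  have h := abs_min_sub_min_le_max (f a) (g a) (f b) (g b)
  rw [← abs_mul_abs_self (min (f a) (g a) - _), ← abs_mul_abs_self (f a - _),
    ← abs_mul_abs_self (g a - _)]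
  rcases le_max_iff.1 h with h | h <;> nlinarith [abs_nonneg (f a - f b), abs_nonneg (g a - g b),
    abs_nonneg (min (f a) (g a) - min (f b) (g b))]

/-- Separation of small balls propagates: if `η` can be joined to `ξ` away from `z`, then a
function separating `z` from `ξ` yields one separating `z` from `η`. -/
lemma separate_transit [Infinite Γ] {G : WeightedGraph Γ} {p H : ℝ} (hp : G.LowerWeights p)
    (hH : G.HarnackWith H) (N : ℕ) :
    ∃ C : ℝ, 0 < C ∧ ∀ (z η ξ : Γ) (s : ℝ), 0 < s → ∀ W : Finset Γ,
      G.closedNhd (G.ball ξ ((N + 4) * s)) ⊆ W →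
      (G.graph.dist η ξ : ℝ) + 14 * s < G.graph.dist η z + G.graph.dist z ξ →
      (G.graph.dist η ξ : ℝ) + s ≤ N * s → ∀ f₀ : Γ → ℝ, (∀ a ∈ G.ball z s, f₀ a = 0) →
      (∀ a ∈ G.ball ξ s, f₀ a = 1) →
      ∃ f : Γ → ℝ, (∀ a, 0 ≤ f a) ∧ (∀ a, f a ≤ 1) ∧ (∀ a ∈ G.ball z s, f a = 0) ∧
        (∀ a ∈ G.ball η s, f a = 1) ∧ G.dform W f f ≤ C * G.dform W f₀ f₀ := by
  have hf := hp.finiteNbrs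
  obtain ⟨c, hc0, -, hhit⟩ := superharmonic_double hp hH
  obtain ⟨C, hC1, hC⟩ := harnack_chain hp hH N
  have hC0 : 0 < C := by linarith
  have hp0 := hp.1
  set m := p * c / C with hm
  have hm0 : 0 < m := by positivity
  have hmc : m ≤ c := by
    rw [hm, div_le_iff₀ hC0]
    nlinarith [hp.le_one]
  refine ⟨m⁻¹ * m⁻¹, by positivity, fun z η ξ s hs W hW hsep hN f₀ hf₀z hf₀ξ => ?_⟩
  have hzξ : 7 * s < G.graph.dist z ξ := by
    have := G.dist_triR η ξ z
    rw [SimpleGraph.dist_comm (u := ξ)] at this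
    linarith
  have hdisj : Disjoint (G.ball ξ s) (G.ball z s) := by
    rw [Set.disjoint_left]
    intro a ha ha'
    rw [mem_ball] at ha ha'
    have := G.dist_triR z a ξ
    rw [SimpleGraph.dist_comm (u := a)] at this
    linarith
  obtain ⟨h, h0, h1, hA, hB, hmin, hharm⟩ := exists_minimizer hf W hdisj
  have hin : ∀ a, (G.graph.dist ξ a : ℝ) < (N + 4) * s →
      a ∈ W ∧ ∀ b, G.graph.Adj a b → b ∈ W := fun a ha =>
    ⟨hW (G.subset_closedNhd _ ha), fun b hb => hW (G.adj_mem_closedNhd ha hb)⟩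
  have hsuper : ∀ a, (G.graph.dist ξ a : ℝ) < (N + 4) * s → a ∉ G.ball z s →
      G.markovOp h a ≤ h a := by
    intro a ha haz
    by_cases haξ : a ∈ G.ball ξ s
    · rw [hA a haξ, ← markovOp_const hf 1 a]
      exact markovOp_mono hf fun b _ => h1 b
    · exact (hharm a (hin a ha).1 (hin a ha).2 haξ haz).le
  have hNs : 0 ≤ N * s := by positivity
  have hnear : ∀ a ∈ G.ball ξ (2 * s), c ≤ h a := by
    have := hhit ξ s hs h 1 zero_le_one (fun a _ => h0 a) (fun a ha => ?_)
      (fun a ha => (hA a ha).ge)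
    · simpa using this
    · rw [mem_ball] at ha
      refine hsuper a (by linarith) fun haz => ?_
      rw [mem_ball] at haz
      have := G.dist_triR z a ξ
      rw [SimpleGraph.dist_comm (u := a)] at this
      linarith
  have hfar : ∀ q ∈ G.ball η s, m ≤ h q := by
    classical
    intro q hq
    rw [mem_ball] at hq
    obtain ⟨P, hP0, hPn, hadj, hd1, hd2⟩ := G.exists_geodesic q ξ
    set L := G.graph.dist q ξ with hL
    have hLle : (L : ℝ) ≤ G.graph.dist η ξ + s := by
      have := G.dist_triR q η ξ
      rw [SimpleGraph.dist_comm (u := q) (v := η)] at this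
      linarith
    -- A detour through B(z, 6s) would cost at most 12s, and moving between η and q costs s twice;
    -- hence the 14s in the separation hypothesis.
    have haway : ∀ i, i ≤ L → 6 * s ≤ G.graph.dist z (P i) := by
      intro i hi
      by_contra! hlt
      have e1 : (G.graph.dist q (P i) : ℝ) = i := by exact_mod_cast hd1 i hi
      have e2 : (G.graph.dist (P i) ξ : ℝ) + i = L := by exact_mod_cast hd2 i hi
      have e3 := G.dist_triR η q z
      have e4 := G.dist_triR q (P i) z
      have e5 := G.dist_triR z (P i) ξ
      rw [SimpleGraph.dist_comm (u := P i) (v := z)] at e4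
      linarith
    have hPξ : ∀ i, i ≤ L → (G.graph.dist ξ (P i) : ℝ) ≤ L := by
      intro i hi
      rw [SimpleGraph.dist_comm]
      have e2 : (G.graph.dist (P i) ξ : ℝ) + i = L := by exact_mod_cast hd2 i hi
      have : (0 : ℝ) ≤ i := i.cast_nonneg
      linarith
    -- At the first entry into B(ξ, 2s) the potential is at least c. Before it, balls of radius s
    -- about the path miss both plates, so Harnack carries the bound back to q, with one extra edge
    -- costing p.
    have hex : ∃ i, P i ∈ G.ball ξ (2 * s) := ⟨L, by
      rw [hPn]; exact G.mem_ball_self ξ (by linarith)⟩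
    have hi₀ := Nat.find_spec hex
    have hlt := fun i (hi : i < Nat.find hex) => Nat.find_min hex hi
    have hi₀L : Nat.find hex ≤ L := Nat.find_min' hex (by
      rw [hPn]; exact G.mem_ball_self ξ (by linarith))
    set i₀ := Nat.find hex
    rcases Nat.eq_zero_or_pos i₀ with hz | hpos
    · rw [hz, hP0] at hi₀
      exact hmc.trans (hnear q hi₀)
    · obtain ⟨k, hk⟩ := Nat.exists_eq_succ_of_ne_zero hpos.ne'
      have hkL : k < L := by omega
      have hkstep : p * c ≤ h (P k) := by
        have e1 := hsuper (P k) (by have := hPξ k hkL.le; linarith) (fun hz => by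
          have := haway k hkL.le
          rw [mem_ball] at hz
          linarith)
        have e2 := hp.le_of_superharmonic (fun b _ => h0 b) e1 (hadj k hkL)
        refine le_trans (mul_le_mul_of_nonneg_left (hnear _ ?_) hp.1.le) e2
        rwa [hk] at hi₀
      have hchain := (hC s hs h h0 k P ?_ (fun i hi => hadj i (by omega)) ?_).2
      · rw [hP0] at hchain
        rw [hm, div_le_iff₀' hC0]
        exact hkstep.trans hchain
      · have : (k : ℝ) ≤ L := by exact_mod_cast hkL.le
        linarith
      · intro i hi a ha
        rw [mem_ball] at ha
        have hiL : i ≤ L := by omega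
        have e1 := hPξ i hiL
        have e2 := G.dist_triR ξ (P i) a
        have e3 : 2 * s ≤ G.graph.dist ξ (P i) := not_lt.1 (hlt i (by omega))
        have e4 := haway i hiL
        have e5 := G.dist_triR ξ a (P i)
        have e6 := G.dist_triR z a (P i)
        rw [SimpleGraph.dist_comm (u := a) (v := P i)] at e5 e6
        have := hin a (by linarith)
        refine hharm a this.1 this.2 (fun h => ?_) (fun h => ?_)
        · rw [mem_ball] at h; linarith
        · rw [mem_ball] at h; linarith
  refine ⟨fun y => m⁻¹ * min (h y) m, fun a => ?_, fun a => ?_, fun a ha => ?_, fun a ha => ?_, ?_⟩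
  · exact mul_nonneg (by positivity) (le_min (h0 a) hm0.le)
  · rw [inv_mul_le_one₀ hm0]
    exact min_le_right _ _
  · simp only [hB a ha, min_eq_left hm0.le, mul_zero]
  · simp only [min_eq_right (hfar a ha), inv_mul_cancel₀ hm0.ne']
  · rw [dform_smul_smul]
    exact mul_le_mul_of_nonneg_left
      ((G.dform_min_self_le W h m).trans (hmin f₀ hf₀ξ hf₀z)) (by positivity)

/-- Small balls on the two boundary components of an annulus can be separated at the cost of the
capacity of a larger annulus. -/
lemma separate_pair [Infinite Γ] {G : WeightedGraph Γ} {p H : ℝ} (hp : G.LowerWeights p)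
    (hH : G.HarnackWith H) :
    ∃ C : ℝ, 0 < C ∧ ∀ (x : Γ) (R : ℝ), 4 ≤ R → ∀ W : Finset Γ,
      G.closedNhd (G.ball x (100 * R)) ⊆ W → ∀ z z' : Γ,
      (G.graph.dist x z : ℝ) ≤ 2 * R → (G.graph.dist x z' : ℝ) ≤ 2 * R →
      R / 2 ≤ G.graph.dist z z' →
      ∃ f : Γ → ℝ, (∀ a, 0 ≤ f a) ∧ (∀ a, f a ≤ 1) ∧ (∀ a ∈ G.ball z (R / 64), f a = 1) ∧
        (∀ a ∈ G.ball z' (R / 64), f a = 0) ∧ G.dform W f f ≤ C * G.cap x R (4 * R) := by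
  have hf := hp.finiteNbrs
  obtain ⟨C, hC0, hC⟩ := separate_transit hp hH 800
  refine ⟨C * C, by positivity, fun x R hR W hW z z' hz hz' hzz' => ?_⟩
  -- The vertex ξ lies where the capacitor vanishes. Two transits turn a separation of x from ξ into
  -- one of u from ξ, and then into one of u from v.
  obtain ⟨ξ, hξ⟩ := hf.exists_dist_eq x ⌈8 * R⌉₊
  have hξ1 : 8 * R ≤ G.graph.dist x ξ := by rw [hξ]; exact Nat.le_ceil _
  have hξ2 : (G.graph.dist x ξ : ℝ) < 8 * R + 1 := by
    rw [hξ]; exact Nat.ceil_lt_add_one (by linarith)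
  obtain ⟨φ, hφ⟩ := exists_isCapacitor hf x (show 0 < R by linarith) (show R ≤ 4 * R by linarith)
  have hφE := hφ.dform_eq W ((G.closedNhd_mono (G.ball_subset_ball x (by linarith))).trans hW)
  have hball : ∀ y, (G.graph.dist x y : ℝ) ≤ 10 * R →
      G.closedNhd (G.ball y (((800 : ℕ) + 4) * (R / 64))) ⊆ W := by
    intro y hy
    refine (G.closedNhd_mono fun a ha => ?_).trans hW
    rw [mem_ball] at ha ⊢
    push_cast at ha
    have := G.dist_triR x y a
    linarith
  have main : ∀ u v : Γ, (G.graph.dist x u : ℝ) ≤ 2 * R → (G.graph.dist x v : ℝ) ≤ 2 * R →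
      (G.graph.dist v ξ : ℝ) + 14 * (R / 64) < G.graph.dist v u + G.graph.dist u ξ →
      ∃ f : Γ → ℝ, (∀ a, 0 ≤ f a) ∧ (∀ a, f a ≤ 1) ∧ (∀ a ∈ G.ball u (R / 64), f a = 0) ∧
        (∀ a ∈ G.ball v (R / 64), f a = 1) ∧ G.dform W f f ≤ C * C * G.cap x R (4 * R) := by
    intro u v hu hv hsep
    have huξ := G.dist_triR x u ξ
    have hvξ := G.dist_triR v x ξ
    rw [SimpleGraph.dist_comm (u := v) (v := x)] at hvξ
    obtain ⟨f, -, -, hfξ, hfu, hfE⟩ := hC ξ u x (R / 64) (by linarith) W (hball x (by simp; linarith))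
      (by
        rw [SimpleGraph.dist_comm (u := u) (v := x), SimpleGraph.dist_comm (u := ξ) (v := x)]
        linarith)
      (by
        rw [SimpleGraph.dist_comm (u := u) (v := x)]
        push_cast
        linarith)
      φ (fun a ha => hφ.eq_zero a fun h => by
        rw [mem_ball] at ha h
        have := G.dist_triR x a ξ
        rw [SimpleGraph.dist_comm (u := a)] at this
        linarith)
      (fun a ha => hφ.eq_one a (by rw [mem_ball] at ha ⊢; linarith))
    obtain ⟨f', h0, h1, hfu', hfv', hfE'⟩ := hC u v ξ (R / 64) (by linarith) W
      (hball ξ (by linarith)) hsep (by push_cast; linarith) (fun y => 1 - f y)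
      (fun a ha => by simp [hfu a ha]) (fun a ha => by simp [hfξ a ha])
    refine ⟨f', h0, h1, hfu', hfv', ?_⟩
    rw [dform_one_sub] at hfE'
    rw [hφE] at hfE
    calc G.dform W f' f' ≤ C * G.dform W f f := hfE'
      _ ≤ C * (C * G.cap x R (4 * R)) := mul_le_mul_of_nonneg_left hfE hC0.le
      _ = _ := by ring
  -- If the separation condition failed in both orders, adding the two would give 2 d(z,z') ≤
  -- 28R/64, contradicting d(z,z') ≥ R/2.
  rcases lt_or_ge ((G.graph.dist z ξ : ℝ) + 14 * (R / 64))
    (G.graph.dist z z' + G.graph.dist z' ξ) with h | h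
  · obtain ⟨f, h0, h1, hz0, hz1, hE⟩ := main z' z hz' hz h
    exact ⟨f, h0, h1, hz1, hz0, hE⟩
  · obtain ⟨f, h0, h1, hz0, hz1, hE⟩ := main z z' hz hz' (by
      rw [SimpleGraph.dist_comm (u := z') (v := z)]
      linarith)
    refine ⟨fun y => 1 - f y, fun a => by linarith [h1 a], fun a => by linarith [h0 a],
      fun a ha => by simp [hz0 a ha], fun a ha => by simp [hz1 a ha], ?_⟩
    rwa [dform_one_sub]

lemma BoundedCovering.pow_cover {G : WeightedGraph Γ} {K : ℕ}
    (hK : ∀ (x : Γ) (R : ℝ), 0 < R →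
      ∃ s : Finset Γ, s.card ≤ K ∧ G.ball x (2 * R) ⊆ ⋃ y ∈ s, G.ball y R) (j : ℕ) :
    ∀ (x : Γ) (R : ℝ), 0 < R →
      ∃ s : Finset Γ, s.card ≤ K ^ j ∧ G.ball x (2 ^ j * R) ⊆ ⋃ y ∈ s, G.ball y R := by
  classical
  induction j with
  | zero =>
    intro x R _
    exact ⟨{x}, by simp, by simp⟩
  | succ j ih =>
    intro x R hR
    obtain ⟨s, hs, hcov⟩ := hK x (2 ^ j * R) (by positivity)
    choose t ht htc using fun y => ih y R hR
    refine ⟨s.biUnion t, ?_, ?_⟩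
    · rw [pow_succ']
      exact (Finset.card_biUnion_le_card_mul s t _ fun y _ => ht y).trans
        (Nat.mul_le_mul_right _ hs)
    · intro a ha
      rw [pow_succ', mul_assoc] at ha
      obtain ⟨y, hy, hay⟩ := Set.mem_iUnion₂.1 (hcov ha)
      obtain ⟨w, hw, haw⟩ := Set.mem_iUnion₂.1 (htc y hay)
      exact Set.mem_iUnion₂.2 ⟨w, Finset.mem_biUnion.2 ⟨y, hy, hw⟩, haw⟩

/-- Covering of a subset of a ball by balls centred in the subset. -/
lemma BoundedCovering.exists_net {G : WeightedGraph Γ} {K : ℕ}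
    (hK : ∀ (x : Γ) (R : ℝ), 0 < R →
      ∃ s : Finset Γ, s.card ≤ K ∧ G.ball x (2 * R) ⊆ ⋃ y ∈ s, G.ball y R) (j : ℕ)
    (x : Γ) {R : ℝ} (hR : 0 < R) {S : Set Γ} (hS : S ⊆ G.ball x (2 ^ j * R)) :
    ∃ t : Finset Γ, t.card ≤ K ^ j ∧ (∀ y ∈ t, y ∈ S) ∧ S ⊆ ⋃ y ∈ t, G.ball y (2 * R) := by
  classical
  obtain ⟨s, hs, hcov⟩ := BoundedCovering.pow_cover hK j x R hR
  have hsel : ∀ y : Γ, ∃ w : Γ, (∃ a ∈ S, a ∈ G.ball y R) → w ∈ S ∧ w ∈ G.ball y R := by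
    intro y
    by_cases h : ∃ a ∈ S, a ∈ G.ball y R
    · obtain ⟨a, ha⟩ := h
      exact ⟨a, fun _ => ha⟩
    · exact ⟨y, fun h' => absurd h' h⟩
  choose w hw using hsel
  refine ⟨(s.filter fun y => ∃ a ∈ S, a ∈ G.ball y R).image w,
    (Finset.card_image_le.trans (Finset.card_filter_le _ _)).trans hs, ?_, ?_⟩
  · intro y hy
    obtain ⟨v, hv, rfl⟩ := Finset.mem_image.1 hy
    exact (hw v (Finset.mem_filter.1 hv).2).1
  · intro a ha
    obtain ⟨y, hy, hay⟩ := Set.mem_iUnion₂.1 (hcov (hS ha))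
    have hex : ∃ a ∈ S, a ∈ G.ball y R := ⟨a, ha, hay⟩
    refine Set.mem_iUnion₂.2 ⟨w y, Finset.mem_image.2 ⟨y, Finset.mem_filter.2 ⟨hy, hex⟩, rfl⟩, ?_⟩
    have h1 := (hw y hex).2
    rw [mem_ball] at h1 hay ⊢
    have := G.dist_triR (w y) y a
    rw [SimpleGraph.dist_comm (u := w y) (v := y)] at this
    linarith

/-- The energy of a minimum is at most the sum of the energies, and nonnegativity keeps every zero
set. -/
lemma glue_min {G : WeightedGraph Γ} {W : Finset Γ} {A : Set Γ} {U : Γ → Set Γ} {B : ℝ}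
    (T : Finset Γ)
    (h : ∀ z ∈ T, ∃ f : Γ → ℝ, (∀ a, 0 ≤ f a) ∧ (∀ a, f a ≤ 1) ∧ (∀ a ∈ A, f a = 1) ∧
      (∀ a ∈ U z, f a = 0) ∧ G.dform W f f ≤ B) :
    ∃ f : Γ → ℝ, (∀ a, 0 ≤ f a) ∧ (∀ a, f a ≤ 1) ∧ (∀ a ∈ A, f a = 1) ∧
      (∀ z ∈ T, ∀ a ∈ U z, f a = 0) ∧ G.dform W f f ≤ T.card * B := by
  classical
  induction T using Finset.induction_on with
  | empty => exact ⟨fun _ => 1, by simp, by simp, by simp, by simp, by simp [dform]⟩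
  | insert z T hz ih =>
    obtain ⟨f, f0, f1, fA, fU, fE⟩ := ih fun y hy => h y (Finset.mem_insert_of_mem hy)
    obtain ⟨g, g0, g1, gA, gU, gE⟩ := h z (Finset.mem_insert_self z T)
    refine ⟨fun y => min (f y) (g y), fun a => le_min (f0 a) (g0 a),
      fun a => (min_le_left _ _).trans (f1 a), fun a ha => by simp [fA a ha, gA a ha], ?_, ?_⟩
    · intro y hy a ha
      rcases Finset.mem_insert.1 hy with rfl | hy
      · simp [gU a ha, f0 a]
      · simp [fU y hy a ha, g0 a]
    · rw [Finset.card_insert_of_notMem hz]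
      push_cast
      have := G.dform_min_le_add W f g
      linarith

lemma exists_cap_inner_le [Infinite Γ] {G : WeightedGraph Γ} {p H : ℝ} (hp : G.LowerWeights p)
    (hH : G.HarnackWith H) (hBC : G.BoundedCovering) :
    ∃ C : ℝ, 0 < C ∧ ∀ (x : Γ) (R : ℝ), 4 ≤ R → G.cap x R (2 * R) ≤ C * G.cap x R (4 * R) := by
  have hf := hp.finiteNbrs
  obtain ⟨K, hK⟩ := hBC
  obtain ⟨C, hC0, hC⟩ := separate_pair hp hH
  refine ⟨(K : ℝ) ^ 9 * ((K : ℝ) ^ 9 * C) + 1, by positivity, fun x R hR => ?_⟩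
  have hR0 : 0 < R := by linarith
  have hcap4 : 0 < G.cap x R (4 * R) := cap_pos hf x hR0 (by linarith)
  obtain ⟨W, hW⟩ := hf.exists_window (hf.ball_finite x (100 * R))
  have ha1 := Nat.le_ceil R
  have ha2 := Nat.ceil_lt_add_one hR0.le
  have hb1 := Nat.floor_le (show 0 ≤ 2 * R by linarith)
  have hb2 := Nat.lt_floor_add_one (2 * R)
  set a := ⌈R⌉₊
  set b := ⌊2 * R⌋₊
  have hab : a < b := by
    have : (a : ℝ) < b := by linarith
    exact_mod_cast this
  have hsphere : ∀ n : ℕ, (n : ℝ) ≤ 2 * R →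
      ∃ t : Finset Γ, (t.card : ℝ) ≤ (K : ℝ) ^ 9 ∧ (∀ y ∈ t, G.graph.dist x y = n) ∧
        ∀ y, G.graph.dist x y = n → ∃ z ∈ t, y ∈ G.ball z (R / 64) := by
    intro n hn
    -- Nine halvings lead from radius 4R to R/128; recentring on the sphere doubles this to R/64.
    obtain ⟨t, ht, htS, hcov⟩ := BoundedCovering.exists_net hK 9 x (show 0 < R / 128 by linarith)
      (S := {y | G.graph.dist x y = n}) (fun y (hy : G.graph.dist x y = n) => by
        rw [mem_ball, hy]; linarith)
    refine ⟨t, by exact_mod_cast ht, htS, fun y hy => ?_⟩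
    obtain ⟨z, hz, hyz⟩ := Set.mem_iUnion₂.1 (hcov hy)
    exact ⟨z, hz, by rwa [show 2 * (R / 128) = R / 64 by ring] at hyz⟩
  obtain ⟨t, ht, htS, htc⟩ := hsphere a (by linarith)
  obtain ⟨t', ht', htS', htc'⟩ := hsphere b hb1
  set B := C * G.cap x R (4 * R) with hB
  have hB0 : 0 < B := by positivity
  have hz : ∀ z ∈ t, ∃ f : Γ → ℝ, (∀ a, 0 ≤ f a) ∧ (∀ a, f a ≤ 1) ∧
      (∀ a ∈ G.ball z (R / 64), f a = 1) ∧
      (∀ z' ∈ t', ∀ a ∈ G.ball z' (R / 64), f a = 0) ∧ G.dform W f f ≤ t'.card * B := by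
    intro z hz
    refine glue_min t' fun z' hz' => ?_
    have e1 : (G.graph.dist x z : ℝ) = a := by exact_mod_cast htS z hz
    have e2 : (G.graph.dist x z' : ℝ) = b := by exact_mod_cast htS' z' hz'
    have e3 := G.dist_triR x z z'
    exact hC x R hR W hW z z' (by linarith) (by linarith) (by linarith)
  obtain ⟨f, f0, f1, ft', ft, fE⟩ := glue_min (G := G) (W := W)
    (A := ⋃ z' ∈ t', G.ball z' (R / 64)) (U := fun z => G.ball z (R / 64))
    (B := t'.card * B) t (fun z hzt => by
      obtain ⟨f, f0, f1, fz, ft', fE⟩ := hz z hzt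
      refine ⟨fun y => 1 - f y, fun a => by linarith [f1 a], fun a => by linarith [f0 a], ?_,
        fun a ha => by simp [fz a ha], by rwa [dform_one_sub]⟩
      intro a ha
      obtain ⟨z', hz', haz⟩ := Set.mem_iUnion₂.1 ha
      simp [ft' z' hz' a haz])
  have hfa : ∀ y, G.graph.dist x y = a → f y = 0 := fun y hy => by
    obtain ⟨z, hz, hyz⟩ := htc y hy
    exact ft z hz y hyz
  have hfb : ∀ y, G.graph.dist x y = b → f y = 1 := fun y hy => by
    obtain ⟨z, hz, hyz⟩ := htc' y hy
    exact ft' y (Set.mem_iUnion₂.2 ⟨z, hz, hyz⟩)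
  -- Since 1 - f is already 1 on sphere a and 0 on sphere b, making it constant inside a and outside
  -- b creates no new energy.
  set F : Γ → ℝ := fun y => if G.graph.dist x y ≤ a then 1 else
    if b ≤ G.graph.dist x y then 0 else 1 - f y with hF
  have hF1 : ∀ y, G.graph.dist x y ≤ a → F y = 1 := fun y hy => if_pos hy
  have hF0 : ∀ y, b ≤ G.graph.dist x y → F y = 0 := fun y hy => by
    simp only [hF]
    rw [if_neg (by omega), if_pos hy]
  have hFm : ∀ y, a ≤ G.graph.dist x y → G.graph.dist x y ≤ b → F y = 1 - f y := by
    intro y h1 h2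
    rcases h1.eq_or_lt with h1 | h1
    · rw [hF1 y h1.ge, hfa y h1.symm, sub_zero]
    rcases h2.eq_or_lt with h2 | h2
    · rw [hF0 y h2.ge, hfb y h2, sub_self]
    · simp only [hF]
      rw [if_neg (by omega), if_neg (by omega)]
  have hFE : G.dform W F F ≤ G.dform W (fun y => 1 - f y) (fun y => 1 - f y) := by
    refine G.dform_le_dform W fun u v huv => ?_
    have h1 := G.dist_adj_le x huv
    have h2 := G.dist_adj_le x huv.symm
    by_cases hlow : G.graph.dist x u ≤ a ∧ G.graph.dist x v ≤ a
    · rw [hF1 u hlow.1, hF1 v hlow.2, sub_self, zero_mul]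
      exact mul_self_nonneg _
    by_cases hhigh : b ≤ G.graph.dist x u ∧ b ≤ G.graph.dist x v
    · rw [hF0 u hhigh.1, hF0 v hhigh.2, sub_self, zero_mul]
      exact mul_self_nonneg _
    rw [hFm u (by omega) (by omega), hFm v (by omega) (by omega)]
  have hcap := cap_le hf hR0 (show R ≤ 2 * R by linarith)
    ((G.closedNhd_mono (G.ball_subset_ball x (by linarith))).trans hW) (f := F)
    (fun y hy => hF1 y (by
      rw [mem_ball] at hy
      exact_mod_cast (hy.trans_le ha1).le))
    (fun y hy => hF0 y (by
      rw [mem_ball, not_lt] at hy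
      exact_mod_cast hb1.trans hy))
  rw [dform_one_sub] at hFE
  calc G.cap x R (2 * R) ≤ t.card * (t'.card * B) := hcap.trans (hFE.trans fE)
    _ ≤ (K : ℝ) ^ 9 * ((K : ℝ) ^ 9 * B) := by gcongr
    _ = (K : ℝ) ^ 9 * ((K : ℝ) ^ 9 * C) * G.cap x R (4 * R) := by rw [hB]; ring
    _ ≤ _ := by linarith

/-- For R < 4 both capacities are comparable to μ(x) by ellipticity; D is the ratio of the two
bounds. -/
theorem exists_innerResistanceBound [Infinite Γ] {G : WeightedGraph Γ} {p H : ℝ}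
    (hp : G.LowerWeights p) (hH : G.HarnackWith H) (hBC : G.BoundedCovering) :
    ∃ C₁ : ℝ, 1 < C₁ ∧ G.InnerResistanceBound C₁ := by
  have hf := hp.finiteNbrs
  obtain ⟨C, hC0, hC⟩ := exists_cap_inner_le hp hH hBC
  set D := (p ^ 4)⁻¹ / (p ^ 16 / (2 * (16 : ℕ) ^ 2)) with hD
  have hp4 : 0 < p ^ 4 := pow_pos hp.1 4
  have hp16 : 0 < p ^ 16 := pow_pos hp.1 16
  have hD0 : 0 < D := by positivity
  refine ⟨1 + C + D, by linarith, ?_⟩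
  rw [innerResistanceBound_iff hf (by linarith)]
  intro x R hR
  have hcap4 : 0 < G.cap x R (4 * R) := cap_pos hf x hR (by linarith)
  have hpos : 0 < C * G.cap x R (4 * R) ∧ 0 < D * G.cap x R (4 * R) :=
    ⟨by positivity, by positivity⟩
  rcases le_or_gt 4 R with h4 | h4
  · linarith [hC x R h4, hpos.2]
  · have h1 := cap_le_mul_mu hp 4 x hR (by push_cast; exact h4.le)
    have h2 := mul_mu_le_cap hp (N := 16) (by norm_num) x hR (show R ≤ 4 * R by linarith)
      (by push_cast; linarith)
    have h3 : (p ^ 4)⁻¹ * G.mu x ≤ D * G.cap x R (4 * R) := by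
      refine le_trans (le_of_eq ?_) (mul_le_mul_of_nonneg_left h2 hD0.le)
      rw [hD]
      field_simp
    linarith [hpos.1]

end WeightedGraph

theorem mainTheorem7 {Γ : Type*} [Countable Γ] [Infinite Γ]
    [MeasurableSpace Γ] [DiscreteMeasurableSpace Γ] (G : WeightedGraph Γ)
    (hp₀ : G.ControlledWeights) (hH : G.EllipticHarnack) :
    (∃ C₂ : ℝ, 1 < C₂ ∧ G.OuterResistanceBound C₂ ∧
      ∃ C : ℝ, 0 < C ∧ ∀ (x : Γ) (R : ℝ), 1 ≤ R →
        G.vol x R ≤ ENNReal.ofReal (C * G.mu x * R ^ Real.logb 2 (C₂ - 1)) * G.exitE x R) ∧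
    (∀ C₂ : ℝ, 1 < C₂ → G.OuterResistanceBound C₂ →
      ∃ C : ℝ, 0 < C ∧ ∀ (x : Γ) (R : ℝ), 1 ≤ R →
        G.vol x R ≤ ENNReal.ofReal (C * G.mu x * R ^ Real.logb 2 (C₂ - 1)) * G.exitE x (2 * R)) ∧
    (∃ c : ℝ, 0 < c ∧ ∀ (x : Γ) (R : ℝ), 0 < R →
      ENNReal.ofReal (c * R ^ 2) ≤ G.exitE x R ∧ G.exitE x R < ∞) ∧
    (G.BoundedCovering →
      (∃ C₁ : ℝ, 1 < C₁ ∧ G.InnerResistanceBound C₁) ∧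
      ∀ C₁ : ℝ, 1 < C₁ → G.InnerResistanceBound C₁ →
        ∃ c : ℝ, 0 < c ∧ ∀ (x : Γ) (R : ℝ), 1 ≤ R →
          ENNReal.ofReal (c * G.mu x * R ^ (2 - Real.logb 2 (C₁ - 1))) ≤ G.vol x (2 * R)) := by
  obtain ⟨p, hp⟩ := hp₀.exists_lowerWeights
  obtain ⟨H, hH⟩ := hH
  have hH : G.HarnackWith H := hH
  exact ⟨WeightedGraph.exists_vol_le_exitE hp hH,
    fun C₂ hC₂ hout => WeightedGraph.exists_vol_le_of_outer hp hH hC₂ hout,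
    WeightedGraph.exists_exitE_bounds hp hH,
    fun hBC => ⟨WeightedGraph.exists_innerResistanceBound hp hH hBC,
      fun C₁ hC₁ hin => WeightedGraph.exists_le_vol_of_inner hp hH hC₁ hin⟩⟩
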